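/- Let $V$ be a vertex operator algebra over $\mathbb C$ with vacuum $\mathbf 1$, Virasoro element $\omega$ and $L(n)=\omega_{n+1}$. A weak $V$-module is a vector space $M$ with a linear map $Y:V\to(\mathrm{End}\,M)[[x,x^{-1}]]$, $Y(v,x)=\sum_{n\in\mathbb Z}v_nx^{-n-1}$, satisfying all the axioms of a $V$-module that do not involve a grading of $M$: $Y(v,x)w\in M((x))$ for all $v\in V$, $w\in M$, $Y(\mathbf 1,x)=1$, the Jacobi identity, the Virasoro relations with central charge the rank of $V$, and $Y(L(-1)v,x)=\frac{d}{dx}Y(v,x)$. Weak $V\otimes V$-modules are defined in the same way for the tensor product vertex operator algebra $V\otimes V$. For a vector space $M$ and a linear map $G:V\to(\mathrm{End}\,M)[[x,x^{-1}]]$ put $G^{o}(v,x)=G(e^{xL(1)}(-x^{-2})^{L(0)}v,x^{-1})$. For a rational function $f(x)\in\mathbb C(x)$ let $\iota_{x;0}f$ and $\iota_{x;\infty}f$ be its Laurent expansions at $x=0$ and $x=\infty$. Let $(W,Y)$ be a weak $V$-module and $z\in\mathbb C$, $z\ne0$. Let $\mathcal D_{Q(z)}(W)\subset W^*$ be the space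 of all $\alpha\in W^*$ such that for every $v\in V$ there are $l,m\in\mathbb N$ such that, for every $w\in W$, the series $\langle\alpha,Y(v,x)w\rangle$ converges absolutely in $0<|x|<|z|$ to a rational function in $\mathbb C[x,x^{-1},(x+z)^{-1}]$ whose poles at $x=-z$ and $x=\infty$ have orders at most $l$ and $m$. Then: 1. There are unique linear maps $Y^L_{Q(z)},Y^R_{Q(z)}:V\to(\mathrm{End}\,\mathcal D_{Q(z)}(W))[[x,x^{-1}]]$ such that for all $v\in V$, $\alpha\in\mathcal D_{Q(z)}(W)$, $w\in W$, $$\langle (Y^L_{Q(z)})^{o}(v,x)\alpha,w\rangle=\iota_{x;\infty}\Big(\big(\iota_{y;0}^{-1}\langle\alpha,Y(v,y)w\rangle\big)\big|_{y=x-z}\Big),\qquad \langle Y^R_{Q(z)}(v,x)\alpha,w\rangle=\iota_{x;0}\Big(\big(\iota_{y;0}^{-1}\langle\alpha,Y(v,y)w\rangle\big)\big|_{y=x-z}\Big).$$ 2. $(\mathcal D_{Q(z)}(W),Y^L_{Q(z)})$ and $(\mathcal D_{Q(z)}(W),Y^R_{Q(z)})$ are weak $V$-modules, and $Y^L_{Q(z)}(u,x_1)Y^R_{Q(z)}(v,x_2)=Y^R_{Q(z)}(v,x_2)Y^L_{Q(z)}(u,x_1)$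 for all $u,v\in V$. 3. There is a unique linear map $Y_{Q(z)}:V\otimes V\to(\mathrm{End}\,\mathcal D_{Q(z)}(W))[[x,x^{-1}]]$ with $Y_{Q(z)}(u\otimes v,x)=Y^L_{Q(z)}(u,x)Y^R_{Q(z)}(v,x)$ for all $u,v\in V$ (each coefficient of the product, applied to any $\alpha$, is a finite sum), and $(\mathcal D_{Q(z)}(W),Y_{Q(z)})$ is a weak $V\otimes V$-module. -/

import Mathlib

open scoped TensorProduct

noncomputable section

namespace VOATheory

/-! Formal series.  A linear map `G` from `V` to `(End M)[[x, x⁻¹]]` is recorded by its modes: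
`G v n` is the coefficient of `x ^ (-n-1)` in `G(v, x)`. -/

/-- Linear maps `V → (End M)[[x, x⁻¹]]`, with `G(v, x) = ∑ n, (G v n) x ^ (-n-1)`. -/
abbrev FieldMap (V M : Type*) [AddCommGroup V] [Module ℂ V] [AddCommGroup M] [Module ℂ M] :
    Type _ :=
  V →ₗ[ℂ] (ℤ → Module.End ℂ M)

/-- The underlying data `(V, Y, 𝟏, ω)` of a vertex operator algebra, with its rank
(central charge). -/
structure VertexData (V : Type*) [AddCommGroup V] [Module ℂ V] where
  /-- the vertex operator map -/
  Y : FieldMap V V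
  /-- the vacuum vector -/
  vac : V
  /-- the Virasoro element -/
  omega : V
  /-- the rank -/
  rank : ℂ

section

variable {V M : Type*} [AddCommGroup V] [Module ℂ V] [AddCommGroup M] [Module ℂ M]

/-- `v_n w = 0` for `n` sufficiently large, that is, `G(v, x) w ∈ M((x))`. -/
def Truncation (G : FieldMap V M) : Prop :=
  ∀ (v : V) (w : M), ∃ N : ℤ, ∀ n : ℤ, N ≤ n → G v n w = 0

/-- The Jacobi identity
`x₀⁻¹ δ((x₁ - x₂)/x₀) G(u, x₁) G(v, x₂) w - x₀⁻¹ δ((x₂ - x₁)/(-x₀)) G(v, x₂) G(u, x₁) w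
  = x₂⁻¹ δ((x₁ - x₀)/x₂) G(Y(u, x₀) v, x₂) w`,
written as the equality of the coefficients of `x₀ ^ (-l-1) x₁ ^ (-m-1) x₂ ^ (-n-1)`.
All the sums are finite under the truncation condition for `Y` and `G`. -/
def Jacobi (Y : FieldMap V V) (G : FieldMap V M) : Prop :=
  ∀ (u v : V) (w : M) (l m n : ℤ),
    (∑ᶠ i : ℕ, ((-1 : ℂ) ^ i * (Ring.choose l i : ℤ)) • G u (l + m - i) (G v (n + i) w))
      - (∑ᶠ i : ℕ, ((-1 : ℂ) ^ l * (-1 : ℂ) ^ i * (Ring.choose l i : ℤ)) •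
          G v (l + n - i) (G u (m + i) w))
      = ∑ᶠ i : ℕ, ((Ring.choose m i : ℤ) : ℂ) • G (Y u (l + i) v) (m + n - i) w

/-- `(M, G)` is a weak module for `(V, Y, 𝟏, ω)`: all the axioms of a module hold except those
which involve a grading of `M`. -/
structure IsWeakModule (A : VertexData V) (G : FieldMap V M) : Prop where
  truncation : Truncation G
  /-- `G(𝟏, x) = 1` -/
  vacuum : ∀ n : ℤ, G A.vac n = if n = -1 then 1 else 0
  jacobi : Jacobi A.Y G
  /-- Virasoro relations for `L(n) = ω_{n+1}` on `M` -/
  virasoro : ∀ m n : ℤ,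
    G A.omega (m + 1) * G A.omega (n + 1) - G A.omega (n + 1) * G A.omega (m + 1)
      = ((m : ℂ) - n) • G A.omega (m + n + 1)
        + (if m + n = 0 then (((m : ℂ) ^ 3 - m) / 12) * A.rank else 0) • (1 : Module.End ℂ M)
  /-- `G(L(-1) v, x) = (d/dx) G(v, x)` -/
  derivative : ∀ (v : V) (n : ℤ), G (A.Y A.omega 0 v) n = (-n : ℂ) • G v (n - 1)

end

/-- Vertex operator algebras over `ℂ`. -/
structure VertexOperatorAlgebra (V : Type*) [AddCommGroup V] [Module ℂ V] extends
    VertexData V where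
  /-- the homogeneous subspaces -/
  grade : ℤ → Submodule ℂ V
  isInternal : DirectSum.IsInternal grade
  finiteDimensional : ∀ n : ℤ, FiniteDimensional ℂ (grade n)
  grade_lower : ∃ N : ℤ, ∀ n : ℤ, n < N → grade n = ⊥
  vac_mem : vac ∈ grade 0
  omega_mem : omega ∈ grade 2
  /-- truncation, vacuum property, Jacobi identity, Virasoro relations and the
  `L(-1)`-derivative property of `Y` on `V` -/
  adjoint : IsWeakModule toVertexData Y
  /-- `Y(v, x) 𝟏 ∈ V[[x]]` -/
  creation : ∀ (v : V) (n : ℤ), 0 ≤ n → Y v n vac = 0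
  /-- `Y(v, x) 𝟏` has constant term `v` -/
  creation_lim : ∀ v : V, Y v (-1) vac = v
  /-- `L(0) v = n v` for `v` homogeneous of weight `n` -/
  weight : ∀ (n : ℤ) (v : V), v ∈ grade n → Y omega 1 v = (n : ℂ) • v

/-! The tensor product of two vertex operator algebras, with
`Y(u ⊗ u', x) = Y(u, x) ⊗ Y(u', x)`. -/

section Tensor

variable {V V' : Type*} [AddCommGroup V] [Module ℂ V] [AddCommGroup V'] [Module ℂ V']

/-- `∑ i, F i t` is a finite sum for every `t`. -/
def PointwiseFinite {M : Type*} [AddCommGroup M] [Module ℂ M] (F : ℤ → Module.End ℂ M) : Prop :=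
  ∀ t : M, (Function.support fun i => F i t).Finite

/-- The sum of a pointwise finite family of endomorphisms. -/
def sumEnd {M : Type*} [AddCommGroup M] [Module ℂ M] (F : ℤ → Module.End ℂ M)
    (hF : PointwiseFinite F) : Module.End ℂ M where
  toFun t := ∑ᶠ i, F i t
  map_add' s t := by
    simp only [map_add]
    exact finsum_add_distrib (hF s) (hF t)
  map_smul' c t := by
    simp only [map_smul, RingHom.id_apply]
    exact (smul_finsum' c (hF t)).symm

theorem pointwiseFinite_tensor (G : FieldMap V V) (hG : Truncation G) (G' : FieldMap V' V')
    (hG' : Truncation G') (u : V) (u' : V') (n : ℤ) :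
    PointwiseFinite fun i => TensorProduct.map (G u i) (G' u' (n - 1 - i)) := by
  intro t
  induction t using TensorProduct.induction_on with
  | zero => simp
  | add s t hs ht =>
    refine (hs.union ht).subset ?_
    intro i hi
    by_contra h
    simp only [Set.mem_union, Function.mem_support, not_or, not_not] at h
    exact hi (by simp [h.1, h.2])
  | tmul v v' =>
    obtain ⟨N, hN⟩ := hG u v
    obtain ⟨N', hN'⟩ := hG' u' v'
    refine (Set.finite_Icc (n - 1 - N') N).subset ?_
    intro i hi
    by_contra h
    simp only [Set.mem_Icc, not_and_or, not_le] at h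
    apply hi
    rcases h with h | h
    · simp [hN' (n - 1 - i) (by omega)]
    · simp [hN i (by omega)]

/-- The vertex operator map of the tensor product: the coefficient of `x ^ (-n-1)` in
`Y(u, x) ⊗ Y(u', x)` is `∑ i, u_i ⊗ u'_{n-1-i}`. -/
def tensorField (G : FieldMap V V) (hG : Truncation G) (G' : FieldMap V' V')
    (hG' : Truncation G') : FieldMap (V ⊗[ℂ] V') (V ⊗[ℂ] V') :=
  TensorProduct.lift <| LinearMap.mk₂ ℂ
    (fun u u' n => sumEnd _ (pointwiseFinite_tensor G hG G' hG' u u' n))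
    (by
      intro u₁ u₂ u'
      funext n
      refine LinearMap.ext fun t => ?_
      change (∑ᶠ i, TensorProduct.map (G (u₁ + u₂) i) (G' u' (n - 1 - i)) t) =
        (∑ᶠ i, TensorProduct.map (G u₁ i) (G' u' (n - 1 - i)) t) +
          ∑ᶠ i, TensorProduct.map (G u₂ i) (G' u' (n - 1 - i)) t
      simp only [map_add, Pi.add_apply, TensorProduct.map_add_left, LinearMap.add_apply]
      exact finsum_add_distrib (pointwiseFinite_tensor G hG G' hG' u₁ u' n t)
        (pointwiseFinite_tensor G hG G' hG' u₂ u' n t))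
    (by
      intro c u u'
      funext n
      refine LinearMap.ext fun t => ?_
      change (∑ᶠ i, TensorProduct.map (G (c • u) i) (G' u' (n - 1 - i)) t) =
        c • ∑ᶠ i, TensorProduct.map (G u i) (G' u' (n - 1 - i)) t
      simp only [map_smul, Pi.smul_apply, TensorProduct.map_smul_left, LinearMap.smul_apply]
      exact (smul_finsum' c (pointwiseFinite_tensor G hG G' hG' u u' n t)).symm)
    (by
      intro u u₁ u₂
      funext n
      refine LinearMap.ext fun t => ?_
      change (∑ᶠ i, TensorProduct.map (G u i) (G' (u₁ + u₂) (n - 1 - i)) t) =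
        (∑ᶠ i, TensorProduct.map (G u i) (G' u₁ (n - 1 - i)) t) +
          ∑ᶠ i, TensorProduct.map (G u i) (G' u₂ (n - 1 - i)) t
      simp only [map_add, Pi.add_apply, TensorProduct.map_add_right, LinearMap.add_apply]
      exact finsum_add_distrib (pointwiseFinite_tensor G hG G' hG' u u₁ n t)
        (pointwiseFinite_tensor G hG G' hG' u u₂ n t))
    (by
      intro c u u'
      funext n
      refine LinearMap.ext fun t => ?_
      change (∑ᶠ i, TensorProduct.map (G u i) (G' (c • u') (n - 1 - i)) t) =
        c • ∑ᶠ i, TensorProduct.map (G u i) (G' u' (n - 1 - i)) t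
      simp only [map_smul, Pi.smul_apply, TensorProduct.map_smul_right, LinearMap.smul_apply]
      exact (smul_finsum' c (pointwiseFinite_tensor G hG G' hG' u u' n t)).symm)

theorem tensorField_tmul (G : FieldMap V V) (hG : Truncation G) (G' : FieldMap V' V')
    (hG' : Truncation G') (u : V) (u' : V') (n : ℤ) (t : V ⊗[ℂ] V') :
    tensorField G hG G' hG' (u ⊗ₜ u') n t
      = ∑ᶠ i, TensorProduct.map (G u i) (G' u' (n - 1 - i)) t := rfl

/-- The tensor product `A ⊗ B` of vertex operator algebras:
vacuum `𝟏 ⊗ 𝟏`, Virasoro element `ω ⊗ 𝟏 + 𝟏 ⊗ ω`, and the sum of the ranks. -/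
def tensorData (A : VertexOperatorAlgebra V) (B : VertexOperatorAlgebra V') :
    VertexData (V ⊗[ℂ] V') where
  Y := tensorField A.Y A.adjoint.truncation B.Y B.adjoint.truncation
  vac := A.vac ⊗ₜ B.vac
  omega := A.omega ⊗ₜ B.vac + A.vac ⊗ₜ B.omega
  rank := A.rank + B.rank

end Tensor

/-! Rational functions and their expansions. -/

/-- `iotaZero f k` is the coefficient of `x ^ k` in the Laurent expansion of `f` at `x = 0`. -/
def iotaZero (f : RatFunc ℂ) : ℤ → ℂ := fun k => (f : LaurentSeries ℂ).coeff k

/-- `iotaInfty f k` is the coefficient of `x ^ k` in the Laurent expansion of `f` at `x = ∞`: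
expand `f(y⁻¹)` at `y = 0` and put `y = x⁻¹`. -/
def iotaInfty (f : RatFunc ℂ) : ℤ → ℂ := fun k =>
  iotaZero (RatFunc.eval (algebraMap ℂ (RatFunc ℂ)) (RatFunc.X)⁻¹ f) (-k)

/-- The rational function `f(x - z)`. -/
def shift (z : ℂ) (f : RatFunc ℂ) : RatFunc ℂ :=
  RatFunc.eval (algebraMap ℂ (RatFunc ℂ)) (RatFunc.X - RatFunc.C z) f

/-- The inverse of `iotaZero` on its range. -/
def iotaZeroInv (a : ℤ → ℂ) : RatFunc ℂ := Function.invFun iotaZero a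

section Dual

variable {V W : Type*} [AddCommGroup V] [Module ℂ V] [AddCommGroup W] [Module ℂ W]

/-- The formal series `⟨α, Y(v, x) w⟩`: the coefficient of `x ^ k`. -/
def pairing (Y : FieldMap V W) (α : Module.Dual ℂ W) (v : V) (w : W) : ℤ → ℂ :=
  fun k => α (Y v (-k - 1) w)

/-- `α` is a `Q(z)`-linear functional: for each `v` there are `l`, `m` such that for every `w` the
series `⟨α, Y(v, x) w⟩` converges absolutely in `0 < |x| < |z|` to a rational function
`g(x) / (x ^ k (x + z) ^ l)`, where `k` may depend on `w`; its pole at `x = -z` has order at most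
`l`, and its pole at `x = ∞` has order at most `m`.  (Summability in `ℂ` over an index set is
absolute summability.) -/
def IsQLinear (Y : FieldMap V W) (z : ℂ) (α : Module.Dual ℂ W) : Prop :=
  ∀ v : V, ∃ l m : ℕ, ∀ w : W, ∃ (k : ℕ) (g : Polynomial ℂ),
    g.natDegree ≤ k + l + m ∧
      ∀ x : ℂ, 0 < ‖x‖ → ‖x‖ < ‖z‖ →
        HasSum (fun n : ℤ => pairing Y α v w n * x ^ n) (g.eval x / (x ^ k * (x + z) ^ l))

/-- The space of `Q(z)`-linear functionals on `W`. -/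
def DQ (Y : FieldMap V W) (z : ℂ) : Submodule ℂ (Module.Dual ℂ W) where
  carrier := {α | IsQLinear Y z α}
  zero_mem' := by
    intro v
    refine ⟨0, 0, fun w => ⟨0, 0, by simp, fun x _ _ => ?_⟩⟩
    simp [pairing, hasSum_zero]
  add_mem' := by
    intro α β hα hβ v
    obtain ⟨l, m, h⟩ := hα v
    obtain ⟨l', m', h'⟩ := hβ v
    refine ⟨l + l', m + m', fun w => ?_⟩
    obtain ⟨k, g, hg, hs⟩ := h w
    obtain ⟨k', g', hg', hs'⟩ := h' w
    have hp : ∀ (a b : ℕ), (Polynomial.X ^ a * (Polynomial.X + Polynomial.C z) ^ b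
        : Polynomial ℂ).natDegree ≤ a + b := by
      intro a b
      refine Polynomial.natDegree_mul_le.trans (add_le_add (by simp) ?_)
      refine Polynomial.natDegree_pow_le.trans ?_
      simp
    refine ⟨k + k', g * (Polynomial.X ^ k' * (Polynomial.X + Polynomial.C z) ^ l')
      + g' * (Polynomial.X ^ k * (Polynomial.X + Polynomial.C z) ^ l), ?_, ?_⟩
    · refine (Polynomial.natDegree_add_le _ _).trans (max_le ?_ ?_)
      · have := hp k' l'
        refine Polynomial.natDegree_mul_le.trans ?_
        omega
      · have := hp k l
        refine Polynomial.natDegree_mul_le.trans ?_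
        omega
    · intro x hx hxz
      have hx0 : x ≠ 0 := norm_pos_iff.mp hx
      have hxz0 : x + z ≠ 0 := by
        intro h0
        have : x = -z := eq_neg_of_add_eq_zero_left h0
        rw [this, norm_neg] at hxz
        exact lt_irrefl _ hxz
      convert (hs x hx hxz).add (hs' x hx hxz) using 1
      · funext n
        simp [pairing, add_mul]
      · simp only [Polynomial.eval_add, Polynomial.eval_mul, Polynomial.eval_pow,
          Polynomial.eval_X, Polynomial.eval_C]
        field_simp
        ring
  smul_mem' := by
    intro c α hα v
    obtain ⟨l, m, h⟩ := hα v
    refine ⟨l, m, fun w => ?_⟩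
    obtain ⟨k, g, hg, hs⟩ := h w
    refine ⟨k, Polynomial.C c * g, (Polynomial.natDegree_C_mul_le c g).trans hg, ?_⟩
    intro x hx hxz
    have hsum := (hs x hx hxz).mul_left c
    have e₁ : (fun n : ℤ => pairing Y (c • α) v w n * x ^ n)
        = fun n : ℤ => c * (pairing Y α v w n * x ^ n) := by
      funext n
      simp [pairing, mul_assoc]
    have e₂ : (Polynomial.C c * g).eval x / (x ^ k * (x + z) ^ l)
        = c * (g.eval x / (x ^ k * (x + z) ^ l)) := by
      simp [mul_div_assoc]
    rw [e₁, e₂]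
    exact hsum

end Dual

section Actions

variable {V M : Type*} [AddCommGroup V] [Module ℂ V] [AddCommGroup M] [Module ℂ M]

/-- The component of `v` of weight `h`. -/
def component (A : VertexOperatorAlgebra V) (h : ℤ) (v : V) : V :=
  ((LinearEquiv.ofBijective (DirectSum.coeLinearMap A.grade) A.isInternal).symm v h : A.grade h)

/-- The opposite operators `Gᵒ(v, x) = G(e^{x L(1)} (-x⁻²)^{L(0)} v, x⁻¹)`:
`opposite A G v n` is the coefficient of `x ^ (-n-1)`.  If `v_h` is the component of `v` of
weight `h`, then `e^{x L(1)} (-x⁻²)^{L(0)} v = ∑ h, ∑ j, ((-1)^h / j!) x^{j-2h} L(1)^j v_h`, a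
finite sum, and `G(u, x⁻¹) = ∑ p, (G u p) x^{p+1}`. -/
def opposite (A : VertexOperatorAlgebra V) (G : FieldMap V M) (v : V) (n : ℤ) :
    Module.End ℂ M :=
  ∑ᶠ h : ℤ, ∑ᶠ j : ℕ,
    ((-1 : ℂ) ^ h / (Nat.factorial j : ℂ)) •
      G (((A.Y A.omega 2) ^ j) (component A h v)) (2 * h - j - n - 2)

/-- `G(u ⊗ v, x) = G₁(u, x) G₂(v, x)`, where each coefficient of the product is a pointwise finite
sum. -/
def IsProductField (G₁ G₂ : FieldMap V M) (G : FieldMap (V ⊗[ℂ] V) M) : Prop :=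
  ∀ (u v : V) (n : ℤ) (a : M),
    (Function.support fun i : ℤ => G₁ u i (G₂ v (n - 1 - i) a)).Finite ∧
      G (u ⊗ₜ v) n a = ∑ᶠ i : ℤ, G₁ u i (G₂ v (n - 1 - i) a)

end Actions

section QActions

variable {V W : Type*} [AddCommGroup V] [Module ℂ V] [AddCommGroup W] [Module ℂ W]

/-- `YL` is the left action `Y^L_{Q(z)}` on the space of `Q(z)`-linear functionals:
`⟨(YL)ᵒ(v, x) α, w⟩ = ι_{x;∞} ((ι_{y;0}⁻¹ ⟨α, Y(v, y) w⟩)|_{y = x - z})`. -/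
def IsLeftAction (A : VertexOperatorAlgebra V) (Y : FieldMap V W) (z : ℂ)
    (YL : FieldMap V (DQ Y z)) : Prop :=
  ∀ (v : V) (n : ℤ) (α : DQ Y z) (w : W),
    ((opposite A YL v n α : DQ Y z) : Module.Dual ℂ W) w
      = iotaInfty (shift z (iotaZeroInv (pairing Y (α : Module.Dual ℂ W) v w))) (-n - 1)

/-- `YR` is the right action `Y^R_{Q(z)}` on the space of `Q(z)`-linear functionals:
`⟨YR(v, x) α, w⟩ = ι_{x;0} ((ι_{y;0}⁻¹ ⟨α, Y(v, y) w⟩)|_{y = x - z})`. -/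
def IsRightAction (Y : FieldMap V W) (z : ℂ) (YR : FieldMap V (DQ Y z)) : Prop :=
  ∀ (v : V) (n : ℤ) (α : DQ Y z) (w : W),
    ((YR v n α : DQ Y z) : Module.Dual ℂ W) w
      = iotaZero (shift z (iotaZeroInv (pairing Y (α : Module.Dual ℂ W) v w))) (-n - 1)

end QActions

end VOATheory

end

/-! Fix `α` in `DQ Y z`. The function of `y` represented by `⟨α, Y(v, y) w⟩` has poles only at `0`,
`-z` and `∞`; in the variable `x = y + z` they sit at `z`, `0` and `∞`. Everything is computed on
modes: a sequence `c : ℤ → E` stands for the series `∑ c n y ^ (-n-1)`, so that `shiftAdd ζ` is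
multiplication by `y + ζ`, vanishing along `atTop` means finitely many negative powers, and
vanishing along `atBot` means finitely many positive powers. By `mem_DQ_iff`, membership in `DQ Y z`
says that for every `v` the series of functionals `∑ (α ∘ v_n) y ^ (-n-1)` acquires finitely many
positive powers after multiplication by some `(y + z) ^ l`. From there on the argument is algebraic.

Division by `y + z` is possible and unique among series with finitely many positive powers. This
gives the expansion at `y = ∞` (`inftyExp`), and the substitution `y = x - z` (`reexpand`) gives the
expansion at `x = ∞`, whose modes form `leftField`. The expansion at `x = 0` comes from the residue
theorem: its mode `n` is the residue of `x ^ n f(x - z)` at `0`, that is, the residue on a large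
circle (`reexpand`) minus the residue at `x = z` (`reexpandZero`). This is `zeroVal`, whose modes
form `rightField`.

By the commutator formula, an operator of the right action commutes with the transposed modes of `u`
up to terms killed by a power of `y + z` (`shiftAdd_pow_rightVal_commutator`). Therefore `DQ Y z` is
stable under it (`rightVal_mem`), and by uniqueness of the expansion at infinity it commutes with
`leftField`.

Transposition reverses the order of operators, so the transposed modes satisfy a reversed Jacobi
identity. By `IsJacobi.transfer` a Jacobi identity survives the replacement of its series by others
that agree with them after multiplication by powers of `x₁ + ζ` and `x₂ + ζ`, provided suitable
truncations hold. With `ζ = z` this yields the reversed identity for `inftyField`, and translation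
of the variable yields it for `leftField`. With `ζ = -z` it passes from `leftField` to `rightField`;
the commutation of the two actions restores the usual order on the way. The passage to opposite
operators is an involution that turns the reversed identity into the usual one
(`oppositeField_involutive`, `oppositeField_jacobi`), hence existence, uniqueness and the Jacobi
identity for the left action. The derivative and Virasoro axioms follow from the Jacobi identity and
the vacuum axiom.

For `V ⊗ V`, a Jacobi identity amounts to weak commutativity together with a substitution rule `x₁ =
x₀ + x₂`. Both are multiplicative, so Jacobi triples can be multiplied (`IsJacobi.conv₂`). -/

set_option linter.unusedSectionVars false

noncomputable section

namespace VOATheory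

open Filter

/-! ### Sequences of modes: linear factors, expansion at infinity, translation of the variable. -/

section Sequences

variable {E E' : Type*} [AddCommGroup E] [Module ℂ E] [AddCommGroup E'] [Module ℂ E']

/-! ### Binomial sums -/

/-- `∑ i, (l choose i) f i`, for families `f` that vanish eventually. -/
def bsum (l : ℤ) (f : ℕ → E) : E := ∑ᶠ i : ℕ, ((Ring.choose l i : ℤ) : ℂ) • f i

/-- The family `s` vanishes eventually along `F`. -/
def EvZero {ι : Type*} (F : Filter ι) (s : ι → E) : Prop := ∀ᶠ n in F, s n = 0

theorem EvZero.add {ι : Type*} {F : Filter ι} {s t : ι → E} (hs : EvZero F s) (ht : EvZero F t) :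
    EvZero F (s + t) := by
  filter_upwards [hs, ht] with n h h' using by simp [h, h']

theorem EvZero.sub {ι : Type*} {F : Filter ι} {s t : ι → E} (hs : EvZero F s) (ht : EvZero F t) :
    EvZero F (s - t) := by
  filter_upwards [hs, ht] with n h h' using by simp [h, h']

theorem EvZero.smul {ι : Type*} {F : Filter ι} {s : ι → E} (c : ι → ℂ) (hs : EvZero F s) :
    EvZero F (fun n => c n • s n) := by
  filter_upwards [hs] with n h using by simp [h]

theorem EvZero.const_smul {ι : Type*} {F : Filter ι} {s : ι → E} (hs : EvZero F s) (c : ℂ) :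
    EvZero F (c • s) := hs.smul fun _ => c

theorem EvZero.map {ι : Type*} {F : Filter ι} {s : ι → E} (hs : EvZero F s) (f : E →ₗ[ℂ] E') :
    EvZero F (fun n => f (s n)) := by
  filter_upwards [hs] with n h using by simp [h]

theorem EvZero.finite_support {f : ℕ → E} (hf : EvZero atTop f) : (Function.support f).Finite := by
  obtain ⟨I, hI⟩ := eventually_atTop.1 hf
  refine (Set.finite_lt_nat I).subset fun i hi => ?_
  by_contra h
  exact hi (hI i (not_lt.1 h))

theorem EvZero.nat_succ {f : ℕ → E} (hf : EvZero atTop f) : EvZero atTop fun i => f (i + 1) :=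
  (tendsto_add_atTop_nat 1).eventually hf

theorem bsum_eq_sum {l : ℤ} {f : ℕ → E} {I : ℕ} (h : ∀ i, I ≤ i → f i = 0) :
    bsum l f = ∑ i ∈ Finset.range I, ((Ring.choose l i : ℤ) : ℂ) • f i := by
  refine finsum_eq_sum_of_support_subset _ fun i hi => ?_
  simp only [Finset.coe_range, Set.mem_Iio]
  by_contra h'
  exact hi (by simp [h i (not_lt.1 h')])

theorem bsum_congr {l : ℤ} {f g : ℕ → E} (h : ∀ i, f i = g i) : bsum l f = bsum l g := by
  rw [funext h]

@[simp] theorem bsum_zero_fun (l : ℤ) : bsum l (fun _ => (0 : E)) = 0 := by simp [bsum]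

theorem bsum_add {l : ℤ} {f g : ℕ → E} (hf : EvZero atTop f) (hg : EvZero atTop g) :
    bsum l (fun i => f i + g i) = bsum l f + bsum l g := by
  simp only [bsum, smul_add]
  exact finsum_add_distrib (hf.smul _).finite_support (hg.smul _).finite_support

theorem bsum_smul {l : ℤ} {f : ℕ → E} (c : ℂ) :
    bsum l (fun i => c • f i) = c • bsum l f := by
  simp only [bsum, smul_comm _ c]
  exact (smul_finsum c _).symm

theorem bsum_neg {l : ℤ} {f : ℕ → E} :
    bsum l (fun i => - f i) = - bsum l f := by
  simpa using bsum_smul (l := l) (f := f) (-1)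

theorem map_bsum {l : ℤ} {f : ℕ → E} (hf : EvZero atTop f) (φ : E →ₗ[ℂ] E') :
    φ (bsum l f) = bsum l fun i => φ (f i) := by
  have := AddMonoidHom.map_finsum φ.toAddMonoidHom
    (hf.smul fun i => ((Ring.choose l i : ℤ) : ℂ)).finite_support
  simpa [bsum] using this

@[simp] theorem bsum_zero (f : ℕ → E) : bsum 0 f = f 0 := by
  rw [bsum, finsum_eq_single _ 0]
  · simp
  · intro i hi
    simp [Ring.choose_zero_pos ℤ (Nat.pos_of_ne_zero hi)]

/-- Pascal's rule, the source of the recursions satisfied by `reexpand`, `reexpandZero`, `jacP` and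
`jacR`. -/
theorem bsum_succ {l : ℤ} {f : ℕ → E} (hf : EvZero atTop f) :
    bsum (l + 1) f = bsum l f + bsum l fun i => f (i + 1) := by
  obtain ⟨I, hI⟩ := eventually_atTop.1 hf
  rw [bsum_eq_sum (I := I + 1) fun i hi => hI i (by omega),
    bsum_eq_sum (I := I + 1) fun i hi => hI i (by omega),
    bsum_eq_sum (I := I) fun i hi => hI (i + 1) (by omega),
    Finset.sum_range_succ', Finset.sum_range_succ' (n := I)]
  simp only [Ring.choose_succ_succ, Ring.choose_zero_right, Int.cast_add, add_smul,
    Finset.sum_add_distrib]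
  abel

/-! ### Shift operators on sequences -/

/-- The operator `S + ζ` on sequences, `S` being the shift `(S s) n = s (n + 1)`. -/
def shiftAdd (ζ : ℂ) : Module.End ℂ (ℤ → E) where
  toFun s n := s (n + 1) + ζ • s n
  map_add' s t := by funext n; simp only [Pi.add_apply, smul_add]; abel
  map_smul' c s := by funext n; simp [smul_comm ζ c]

theorem shiftAdd_apply (ζ : ℂ) (s : ℤ → E) (n : ℤ) :
    shiftAdd ζ s n = s (n + 1) + ζ • s n := rfl

theorem shiftAdd_pow_succ (ζ : ℂ) (l : ℕ) (s : ℤ → E) (n : ℤ) :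
    (shiftAdd ζ ^ (l + 1)) s n = (shiftAdd ζ ^ l) s (n + 1) + ζ • (shiftAdd ζ ^ l) s n := by
  rw [pow_succ']; rfl

theorem shiftAdd_pow_succ' (ζ : ℂ) (l : ℕ) (s : ℤ → E) :
    (shiftAdd ζ ^ (l + 1)) s = (shiftAdd ζ ^ l) (shiftAdd ζ s) := by
  rw [pow_succ]; rfl

theorem shiftAdd_pow_add (ζ : ℂ) (l m : ℕ) (s : ℤ → E) :
    (shiftAdd ζ ^ (l + m)) s = (shiftAdd ζ ^ l) ((shiftAdd ζ ^ m) s) := by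
  rw [pow_add]; rfl

theorem shiftAdd_pow_map (ζ : ℂ) (l : ℕ) (φ : E →ₗ[ℂ] E') (s : ℤ → E) :
    (shiftAdd ζ ^ l) (fun n => φ (s n)) = fun n => φ ((shiftAdd ζ ^ l) s n) := by
  induction l with
  | zero => rfl
  | succ l ih => funext n; rw [shiftAdd_pow_succ, shiftAdd_pow_succ, ih]; simp

theorem shiftAdd_pow_translate (ζ : ℂ) (l : ℕ) (k : ℤ) (s : ℤ → E) :
    (shiftAdd ζ ^ l) (fun n => s (n + k)) = fun n => (shiftAdd ζ ^ l) s (n + k) := by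
  induction l with
  | zero => rfl
  | succ l ih =>
    funext n; rw [shiftAdd_pow_succ, shiftAdd_pow_succ, ih]
    simp only [add_right_comm n 1 k]

theorem shiftAdd_zero_pow (l : ℕ) (s : ℤ → E) (n : ℤ) :
    (shiftAdd 0 ^ l) s n = s (n + l) := by
  induction l generalizing n with
  | zero => simp
  | succ l ih => rw [shiftAdd_pow_succ, ih]; simp [add_comm, add_left_comm]

/-- Filters on `ℤ` stable under `n ↦ n + 1`. -/
theorem EvZero.shiftAdd {F : Filter ℤ} (hF : ∀ k : ℤ, Tendsto (fun n : ℤ => n + k) F F)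
    {s : ℤ → E} (hs : EvZero F s) (ζ : ℂ) : EvZero F (shiftAdd ζ s) := by
  filter_upwards [hs, (hF 1).eventually hs] with n h h' using by simp [shiftAdd_apply, h, h']

theorem EvZero.shiftAdd_pow {F : Filter ℤ} (hF : ∀ k : ℤ, Tendsto (fun n : ℤ => n + k) F F)
    {s : ℤ → E} (hs : EvZero F s) (ζ : ℂ) (l : ℕ) : EvZero F ((VOATheory.shiftAdd ζ ^ l) s) := by
  induction l with
  | zero => exact hs
  | succ l ih => rw [pow_succ']; exact ih.shiftAdd hF ζ

theorem tendsto_add_atBot (k : ℤ) : Tendsto (fun n : ℤ => n + k) atBot atBot :=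
  tendsto_atBot_add_const_right _ k tendsto_id

theorem tendsto_add_atTop (k : ℤ) : Tendsto (fun n : ℤ => n + k) atTop atTop :=
  tendsto_atTop_add_const_right _ k tendsto_id

/-- On two-sided series multiplication by `y + ζ` has a kernel, spanned for `ζ ≠ 0` by the multiples
of `n ↦ (-ζ) ^ n`; truncation on one side is what removes it. Here zeros propagate upwards. For
truncation along `atTop` they propagate downwards, which requires division by `ζ`. -/
theorem eq_zero_of_shiftAdd_atBot {ζ : ℂ} {s : ℤ → E} (hs : EvZero atBot s)
    (h : shiftAdd ζ s = 0) : s = 0 := by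
  obtain ⟨N, hN⟩ := eventually_atBot.1 hs
  funext n
  rcases le_total n N with hn | hn
  · exact hN n hn
  · induction n, hn using Int.leInduction with
    | base => exact hN N le_rfl
    | succ n _ ih => have := congrFun h n; simpa [shiftAdd_apply, ih] using this

theorem eq_zero_of_shiftAdd_atTop {ζ : ℂ} (hζ : ζ ≠ 0) {s : ℤ → E} (hs : EvZero atTop s)
    (h : shiftAdd ζ s = 0) : s = 0 := by
  obtain ⟨N, hN⟩ := eventually_atTop.1 hs
  funext n
  rcases le_total N n with hn | hn
  · exact hN n hn
  · induction n, hn using Int.leInductionDown with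
    | base => exact hN N le_rfl
    | pred n _ ih =>
      have := congrFun h (n - 1)
      simpa [shiftAdd_apply, ih, hζ] using this

theorem eq_zero_of_shift_atTop {s : ℤ → E} (h : shiftAdd 0 s = 0) : s = 0 := by
  funext n
  have := congrFun h (n - 1)
  simpa [shiftAdd_apply] using this

theorem eq_zero_of_pow_atBot {ζ : ℂ} {l : ℕ} {s : ℤ → E} (hs : EvZero atBot s)
    (h : (shiftAdd ζ ^ l) s = 0) : s = 0 := by
  induction l with
  | zero => exact h
  | succ l ih =>
    rw [pow_succ'] at h
    exact ih (eq_zero_of_shiftAdd_atBot (hs.shiftAdd_pow tendsto_add_atBot ζ l) h)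

theorem eq_zero_of_pow_atTop {ζ : ℂ} {l : ℕ} {s : ℤ → E} (hs : EvZero atTop s)
    (h : (shiftAdd ζ ^ l) s = 0) : s = 0 := by
  induction l with
  | zero => exact h
  | succ l ih =>
    rw [pow_succ'] at h
    by_cases hζ : ζ = 0
    · subst hζ; exact ih (eq_zero_of_shift_atTop h)
    · exact ih (eq_zero_of_shiftAdd_atTop hζ (hs.shiftAdd_pow tendsto_add_atTop ζ l) h)

theorem shiftAdd_pow_eq_of_le {ζ : ℂ} {l m : ℕ} (hlm : l ≤ m) {s t : ℤ → E}
    (h : (shiftAdd ζ ^ l) s = (shiftAdd ζ ^ l) t) :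
    (shiftAdd ζ ^ m) s = (shiftAdd ζ ^ m) t := by
  obtain ⟨k, rfl⟩ := Nat.exists_eq_add_of_le' hlm
  rw [shiftAdd_pow_add, shiftAdd_pow_add, h]

/-! ### Expansion at infinity -/

theorem exists_shiftAdd_eq (ζ : ℂ) {p : ℤ → E} (hp : EvZero atBot p) :
    ∃ e : ℤ → E, EvZero atBot e ∧ shiftAdd ζ e = p := by
  obtain ⟨N, hN⟩ := eventually_atBot.1 hp
  -- The recursion `e (n + 1) = p n - ζ • e n` is solved upwards from the value `0` at `N`; `toNat`
  -- gives all indices below `N` that same value.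
  let g : ℕ → E := fun k => Nat.rec 0 (fun k y => p (N + k) - ζ • y) k
  refine ⟨fun n => g (n - N).toNat, ?_, ?_⟩
  · filter_upwards [eventually_le_atBot N] with n hn
    simp [g, Int.toNat_of_nonpos (show n - N ≤ 0 by omega)]
  · funext n
    rw [shiftAdd_apply]
    rcases lt_or_ge n N with hn | hn
    · rw [Int.toNat_of_nonpos (by omega), Int.toNat_of_nonpos (by omega), hN n hn.le]
      simp [g]
    · obtain ⟨k, rfl⟩ := Int.le.dest hn
      rw [show (N + k + 1 - N).toNat = k + 1 by omega, show (N + (k : ℤ) - N).toNat = k by omega]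
      simp [g]

theorem exists_shiftAdd_pow_eq (ζ : ℂ) (l : ℕ) {p : ℤ → E} (hp : EvZero atBot p) :
    ∃ e : ℤ → E, EvZero atBot e ∧ (shiftAdd ζ ^ l) e = p := by
  induction l generalizing p with
  | zero => exact ⟨p, hp, rfl⟩
  | succ l ih =>
    obtain ⟨e, he, rfl⟩ := exists_shiftAdd_eq ζ hp
    obtain ⟨e', he', rfl⟩ := ih he
    exact ⟨e', he', by rw [pow_succ']; rfl⟩

open Classical in
/-- The sequence vanishing near `-∞` which agrees with `c` after multiplication by a power of
`S + z`: the expansion at `∞` of the rational function represented by `c`. -/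
def inftyExp (z : ℂ) (c : ℤ → E) : ℤ → E :=
  if h : ∃ e : ℤ → E, EvZero atBot e ∧ ∃ l : ℕ, (shiftAdd z ^ l) e = (shiftAdd z ^ l) c then
    h.choose
  else 0

theorem inftyExp_unique {z : ℂ} {c e e' : ℤ → E} {l l' : ℕ} (he : EvZero atBot e)
    (he' : EvZero atBot e') (h : (shiftAdd z ^ l) e = (shiftAdd z ^ l) c)
    (h' : (shiftAdd z ^ l') e' = (shiftAdd z ^ l') c) : e = e' := by
  rw [← sub_eq_zero]
  refine eq_zero_of_pow_atBot (ζ := z) (l := max l l') (he.sub he') ?_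
  rw [map_sub, shiftAdd_pow_eq_of_le (le_max_left l l') h,
    shiftAdd_pow_eq_of_le (le_max_right l l') h', sub_self]

theorem inftyExp_eq {z : ℂ} {c e : ℤ → E} {l : ℕ} (he : EvZero atBot e)
    (h : (shiftAdd z ^ l) e = (shiftAdd z ^ l) c) : inftyExp z c = e := by
  have hex : ∃ e : ℤ → E, EvZero atBot e ∧ ∃ l : ℕ, (shiftAdd z ^ l) e = (shiftAdd z ^ l) c :=
    ⟨e, he, l, h⟩
  rw [inftyExp, dif_pos hex]
  obtain ⟨h1, l', h2⟩ := hex.choose_spec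
  exact inftyExp_unique h1 he h2 h

/-- `(S + z) ^ l c` vanishes near `-∞`. -/
def Regular (z : ℂ) (l : ℕ) (c : ℤ → E) : Prop := EvZero atBot ((shiftAdd z ^ l) c)

theorem Regular.mono {z : ℂ} {l m : ℕ} {c : ℤ → E} (h : Regular z l c) (hlm : l ≤ m) :
    Regular z m c := by
  obtain ⟨k, rfl⟩ := Nat.exists_eq_add_of_le' hlm
  rw [Regular, shiftAdd_pow_add]
  exact EvZero.shiftAdd_pow tendsto_add_atBot h z k

theorem Regular.add {z : ℂ} {l m : ℕ} {c d : ℤ → E} (h : Regular z l c) (h' : Regular z m d) :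
    Regular z (max l m) (c + d) := by
  rw [Regular, map_add]
  exact EvZero.add (h.mono (le_max_left l m)) (h'.mono (le_max_right l m))

theorem Regular.add' {z : ℂ} {l : ℕ} {c d : ℤ → E} (h : Regular z l c) (h' : Regular z l d) :
    Regular z l (c + d) := by
  simpa using h.add h'

theorem Regular.smul {z : ℂ} {l : ℕ} {c : ℤ → E} (h : Regular z l c) (a : ℂ) :
    Regular z l (a • c) := by
  rw [Regular, map_smul]
  exact EvZero.smul (fun _ => a) h

theorem Regular.zero {z : ℂ} {l : ℕ} : Regular z l (0 : ℤ → E) := by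
  rw [Regular, map_zero]; exact Eventually.of_forall fun _ => rfl

theorem Regular.sum {ι : Type*} {z : ℂ} {l : ℕ} {c : ι → ℤ → E} (s : Finset ι)
    (h : ∀ i ∈ s, Regular z l (c i)) : Regular z l (∑ i ∈ s, c i) := by
  classical
  induction s using Finset.induction_on with
  | empty => exact Regular.zero
  | insert a s ha ih =>
    rw [Finset.sum_insert ha]
    exact (h a (by simp)).add' (ih fun i hi => h i (by simp [hi]))

theorem Regular.map {z : ℂ} {l : ℕ} {c : ℤ → E} (h : Regular z l c) (φ : E →ₗ[ℂ] E') :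
    Regular z l (fun n => φ (c n)) := by
  rw [Regular, shiftAdd_pow_map]; exact EvZero.map h φ

theorem Regular.translate {z : ℂ} {l : ℕ} {c : ℤ → E} (h : Regular z l c) (k : ℤ) :
    Regular z l (fun n => c (n + k)) := by
  rw [Regular, shiftAdd_pow_translate]
  exact (tendsto_add_atBot k).eventually h

/-- The definition of `inftyExp` allows any exponent. Solving `(S + z) ^ l e = (S + z) ^ l c`
directly shows that the exponent of regularity itself works, so bounds on `l` are inherited by the
expansion. -/
theorem Regular.inftyExp {z : ℂ} {l : ℕ} {c : ℤ → E} (h : Regular z l c) :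
    EvZero atBot (inftyExp z c) ∧ (shiftAdd z ^ l) (inftyExp z c) = (shiftAdd z ^ l) c := by
  obtain ⟨e, he, h'⟩ := exists_shiftAdd_pow_eq z l h
  rw [inftyExp_eq he h']
  exact ⟨he, h'⟩

theorem inftyExp_add {z : ℂ} {l m : ℕ} {c d : ℤ → E} (hc : Regular z l c) (hd : Regular z m d) :
    inftyExp z (c + d) = inftyExp z c + inftyExp z d := by
  refine inftyExp_eq (l := max l m) (hc.inftyExp.1.add hd.inftyExp.1) ?_
  rw [map_add, map_add, shiftAdd_pow_eq_of_le (le_max_left l m) hc.inftyExp.2,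
    shiftAdd_pow_eq_of_le (le_max_right l m) hd.inftyExp.2]

theorem inftyExp_smul {z : ℂ} {l : ℕ} {c : ℤ → E} (hc : Regular z l c) (a : ℂ) :
    inftyExp z (a • c) = a • inftyExp z c := by
  refine inftyExp_eq (l := l) (hc.inftyExp.1.smul fun _ => a) ?_
  refine (map_smul (shiftAdd z ^ l) a (inftyExp z c)).trans ?_
  rw [hc.inftyExp.2, map_smul]

theorem inftyExp_map {z : ℂ} {l : ℕ} {c : ℤ → E} (hc : Regular z l c) (φ : E →ₗ[ℂ] E') :
    inftyExp z (fun n => φ (c n)) = fun n => φ (inftyExp z c n) := by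
  refine inftyExp_eq (l := l) (hc.inftyExp.1.map φ) ?_
  rw [shiftAdd_pow_map, shiftAdd_pow_map, hc.inftyExp.2]

theorem inftyExp_translate {z : ℂ} {l : ℕ} {c : ℤ → E} (hc : Regular z l c) (k : ℤ) :
    inftyExp z (fun n => c (n + k)) = fun n => inftyExp z c (n + k) := by
  refine inftyExp_eq (l := l) ((tendsto_add_atBot k).eventually hc.inftyExp.1) ?_
  rw [shiftAdd_pow_translate, shiftAdd_pow_translate, hc.inftyExp.2]

/-! ### Change of the coordinate `y = x - z` -/

theorem EvZero.sub_nat {s : ℤ → E} (hs : EvZero atBot s) (n : ℤ) :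
    EvZero atTop fun i : ℕ => s (n - i) := by
  have : Tendsto (fun i : ℕ => n - (i : ℤ)) atTop atBot :=
    tendsto_atBot.2 fun b => by
      filter_upwards [eventually_ge_atTop (n - b).toNat] with i hi
      omega
  exact this.eventually hs

theorem EvZero.nat_cast {s : ℤ → E} (hs : EvZero atTop s) (n : ℤ) :
    EvZero atTop fun i : ℕ => s (n + i) := by
  have : Tendsto (fun i : ℕ => n + (i : ℤ)) atTop atTop :=
    tendsto_atTop.2 fun b => by
      filter_upwards [eventually_ge_atTop (b - n).toNat] with i hi
      omega
  exact this.eventually hs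

/-- Modes in `x` of a series in `y = x - z` expanded at `∞`. -/
def reexpand (z : ℂ) (e : ℤ → E) (n : ℤ) : E := bsum n fun i => z ^ i • e (n - i)

/-- Modes in `x = z + y` of a series in `y` expanded in nonnegative powers of `y`. -/
def reexpandZero (z : ℂ) (c : ℤ → E) (n : ℤ) : E := bsum n fun i => z ^ (n - i) • c i

theorem reexpand_evZero {z : ℂ} {e : ℤ → E} (he : EvZero atBot e) : EvZero atBot (reexpand z e) := by
  obtain ⟨N, hN⟩ := eventually_atBot.1 he
  filter_upwards [eventually_le_atBot N] with n hn
  rw [reexpand, ← bsum_zero_fun (E := E) n]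
  exact bsum_congr fun i => by rw [hN _ (by omega), smul_zero]

theorem reexpand_add {z : ℂ} {e e' : ℤ → E} (he : EvZero atBot e) (he' : EvZero atBot e') :
    reexpand z (e + e') = reexpand z e + reexpand z e' := by
  funext n
  simp only [reexpand, Pi.add_apply, smul_add]
  exact bsum_add ((he.sub_nat n).smul _) ((he'.sub_nat n).smul _)

theorem reexpand_smul {z : ℂ} {e : ℤ → E} (a : ℂ) :
    reexpand z (a • e) = a • reexpand z e := by
  funext n
  simp only [reexpand, Pi.smul_apply, smul_comm _ a]
  exact bsum_smul a

theorem reexpand_map {z : ℂ} {e : ℤ → E} (he : EvZero atBot e) (φ : E →ₗ[ℂ] E') :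
    reexpand z (fun n => φ (e n)) = fun n => φ (reexpand z e n) := by
  funext n
  simp only [reexpand]
  rw [map_bsum ((he.sub_nat n).smul _)]
  simp

/-- Multiplication by `x` and by `y + z` are the same operation, read off in the modes of `x` and of
`y`. `reexpandZero_shift` is the counterpart for the residue at `y = 0`. -/
theorem reexpand_shift {z : ℂ} {e : ℤ → E} (he : EvZero atBot e) (n : ℤ) :
    reexpand z e (n + 1) = reexpand z (shiftAdd z e) n := by
  rw [reexpand, bsum_succ ((he.sub_nat (n + 1)).smul _), reexpand]
  simp only [shiftAdd_apply, smul_add]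
  rw [bsum_add]
  · congr 1
    · exact bsum_congr fun i => by rw [show n + 1 - (i : ℤ) = n - i + 1 by ring]
    · exact bsum_congr fun i => by
        rw [pow_succ, mul_smul, show n + 1 - ((i + 1 : ℕ) : ℤ) = n - i by push_cast; ring]
  · have := (he.sub_nat (n + 1)).smul fun i => z ^ i
    refine this.mono fun i (hi : z ^ i • e (n + 1 - i) = 0) => ?_
    change z ^ i • e (n - i + 1) = 0
    rwa [show n - (i : ℤ) + 1 = n + 1 - i by ring]
  · exact ((he.sub_nat n).smul (fun _ => z)).smul _

theorem reexpandZero_add {z : ℂ} {c c' : ℤ → E} (hc : EvZero atTop c) (hc' : EvZero atTop c') :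
    reexpandZero z (c + c') = reexpandZero z c + reexpandZero z c' := by
  funext n
  have h := hc.nat_cast 0
  have h' := hc'.nat_cast 0
  simp only [zero_add] at h h'
  simp only [reexpandZero, Pi.add_apply, smul_add]
  exact bsum_add (h.smul _) (h'.smul _)

theorem reexpandZero_smul {z : ℂ} {c : ℤ → E} (a : ℂ) :
    reexpandZero z (a • c) = a • reexpandZero z c := by
  funext n
  simp only [reexpandZero, Pi.smul_apply, smul_comm _ a]
  exact bsum_smul a

theorem reexpandZero_shift {z : ℂ} (hz : z ≠ 0) {c : ℤ → E} (hc : EvZero atTop c) (n : ℤ) :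
    reexpandZero z c (n + 1) = reexpandZero z (shiftAdd z c) n := by
  have h : EvZero atTop fun i : ℕ => c i := by simpa using hc.nat_cast 0
  rw [reexpandZero, bsum_succ (h.smul _), reexpandZero]
  simp only [shiftAdd_apply, smul_add]
  rw [bsum_add, add_comm]
  · congr 1
    · exact bsum_congr fun i => by
        rw [show n + 1 - ((i + 1 : ℕ) : ℤ) = n - i by push_cast; ring]; norm_cast
    · exact bsum_congr fun i => by
        rw [show n + 1 - (i : ℤ) = n - i + 1 by ring, zpow_add_one₀ hz, mul_smul]
  · exact EvZero.smul (fun i : ℕ => z ^ (n - i)) (by simpa using h.nat_succ)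
  · exact (h.smul (fun _ => z)).smul _

/-- The two expansions agree, in nonnegative modes, on series which are finite. -/
theorem reexpand_eq_reexpandZero {z : ℂ} (hz : z ≠ 0) {e : ℤ → E} (hb : EvZero atBot e)
    (ht : EvZero atTop e) (k : ℕ) : reexpand z e k = reexpandZero z e k := by
  -- As `x ^ k = (y + z) ^ k` is a polynomial, the direction of its expansion does not matter. The
  -- factors are moved into `e` one at a time until only the mode `0`, a plain residue, remains.
  induction k generalizing e with
  | zero => simp [reexpand, reexpandZero]
  | succ k ih =>
    push_cast
    rw [reexpand_shift hb, reexpandZero_shift hz ht,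
      ih (hb.shiftAdd tendsto_add_atBot z) (ht.shiftAdd tendsto_add_atTop z)]

end Sequences

/-! ### The terms of the Jacobi identity as operations on double sequences, and its transfer between
series. -/

section JacobiCalculus

variable {E E' : Type*} [AddCommGroup E] [Module ℂ E] [AddCommGroup E'] [Module ℂ E']

/-! ### The three terms of the Jacobi identity for double sequences -/

/-- Modes of `(x₁ - x₂) ^ l P(x₁, x₂)`, expanded in nonnegative powers of `x₂`. -/
def jacP (l : ℤ) (P : ℤ → ℤ → E) (m n : ℤ) : E :=
  bsum l fun i => (-1 : ℂ) ^ i • P (l + m - i) (n + i)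

/-- Modes of `(x₁ - x₂) ^ l Q(x₁, x₂)`, expanded in nonnegative powers of `x₁`. -/
def jacQ (l : ℤ) (Q : ℤ → ℤ → E) (m n : ℤ) : E :=
  (-1 : ℂ) ^ l • jacP l (fun n m => Q m n) n m

/-- Modes of the third term of the Jacobi identity. -/
def jacR (R : ℤ → ℤ → E) (l m n : ℤ) : E :=
  bsum m fun i => R (l + i) (m + n - i)

/-- The Jacobi identity for double sequences. -/
def IsJacobi (P Q R : ℤ → ℤ → E) : Prop :=
  ∀ l m n : ℤ, jacP l P m n - jacQ l Q m n = jacR R l m n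

/-- Finiteness of the sums `jacP`. -/
def AntiFin (P : ℤ → ℤ → E) : Prop :=
  ∀ m n : ℤ, EvZero atTop fun i : ℕ => P (m - i) (n + i)

/-- Multiplication by `x₁ - x₂`. -/
def diffShift : Module.End ℂ (ℤ → ℤ → E) where
  toFun P m n := P (m + 1) n - P m (n + 1)
  map_add' P Q := by funext m n; simp only [Pi.add_apply]; abel
  map_smul' c P := by funext m n; simp [smul_sub]

theorem diffShift_apply (P : ℤ → ℤ → E) (m n : ℤ) :
    diffShift P m n = P (m + 1) n - P m (n + 1) := rfl

/-- `S + ζ` acting on the second index. -/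
def shiftAdd₂ (ζ : ℂ) : Module.End ℂ (ℤ → ℤ → E) := (shiftAdd ζ).compLeft ℤ

theorem shiftAdd₂_apply (ζ : ℂ) (P : ℤ → ℤ → E) (m n : ℤ) :
    shiftAdd₂ ζ P m n = P m (n + 1) + ζ • P m n := rfl

theorem shiftAdd₂_pow_apply (ζ : ℂ) (r : ℕ) (P : ℤ → ℤ → E) (m : ℤ) :
    (shiftAdd₂ ζ ^ r) P m = (shiftAdd ζ ^ r) (P m) := by
  induction r with
  | zero => rfl
  | succ r ih => rw [pow_succ', pow_succ', Module.End.mul_apply, Module.End.mul_apply, ← ih]; rfl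

theorem shiftAdd_pow_apply₂ (ζ : ℂ) (r : ℕ) (P : ℤ → ℤ → E) (m n : ℤ) :
    (shiftAdd ζ ^ r) P m n = (shiftAdd ζ ^ r) (fun m => P m n) m :=
  (congrFun (shiftAdd_pow_map ζ r (LinearMap.proj n : (ℤ → E) →ₗ[ℂ] E) P) m).symm

theorem shiftAdd₂_commute (ζ : ℂ) :
    Commute (shiftAdd₂ ζ : Module.End ℂ (ℤ → ℤ → E)) (shiftAdd ζ) := by
  refine LinearMap.ext fun P => funext fun m => funext fun n => ?_
  simp only [Module.End.mul_apply, shiftAdd₂_apply, shiftAdd_apply, Pi.add_apply, Pi.smul_apply,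
    smul_add]
  abel

theorem AntiFin.add {P Q : ℤ → ℤ → E} (hP : AntiFin P) (hQ : AntiFin Q) : AntiFin (P + Q) :=
  fun m n => EvZero.add (hP m n) (hQ m n)

theorem AntiFin.shiftAdd {P : ℤ → ℤ → E} (hP : AntiFin P) (ζ : ℂ) : AntiFin (shiftAdd ζ P) := by
  intro m n
  filter_upwards [hP m n, hP (m + 1) n] with i h h'
  rw [add_sub_right_comm] at h'
  simp [shiftAdd_apply, h, h']

theorem AntiFin.shiftAdd₂ {P : ℤ → ℤ → E} (hP : AntiFin P) (ζ : ℂ) :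
    AntiFin (shiftAdd₂ ζ P) := by
  intro m n
  filter_upwards [hP m n, hP m (n + 1)] with i h h'
  rw [add_right_comm] at h'
  simp [shiftAdd₂_apply, h, h']

theorem AntiFin.jacP_fin {P : ℤ → ℤ → E} (hP : AntiFin P) (l m n : ℤ) :
    EvZero atTop fun i : ℕ => (-1 : ℂ) ^ i • P (l + m - i) (n + i) := (hP (l + m) n).smul _

theorem jacP_shiftAdd {P : ℤ → ℤ → E} (hP : AntiFin P) (ζ : ℂ) (l : ℤ) :
    jacP l (shiftAdd ζ P) = shiftAdd ζ (jacP l P) := by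
  funext m n
  simp only [jacP, shiftAdd_apply, Pi.add_apply, Pi.smul_apply, smul_add, smul_comm _ ζ]
  rw [bsum_add, bsum_smul]
  · congr 1
    exact bsum_congr fun i => by rw [show l + m - (i : ℤ) + 1 = l + (m + 1) - i by ring]
  · have := hP.jacP_fin l (m + 1) n
    refine this.mono fun i hi => ?_
    change _ • P _ _ = 0
    rwa [show l + m - (i : ℤ) + 1 = l + (m + 1) - i by ring]
  · exact (hP.jacP_fin l m n).smul fun _ => ζ

theorem jacP_shiftAdd₂ {P : ℤ → ℤ → E} (hP : AntiFin P) (ζ : ℂ) (l : ℤ) :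
    jacP l (shiftAdd₂ ζ P) = shiftAdd₂ ζ (jacP l P) := by
  funext m n
  simp only [jacP, shiftAdd₂_apply, smul_add, smul_comm _ ζ]
  rw [bsum_add, bsum_smul]
  · congr 1
    exact bsum_congr fun i => by rw [add_right_comm]
  · have := hP.jacP_fin l m (n + 1)
    refine this.mono fun i hi => ?_
    change _ • P _ _ = 0
    rwa [add_right_comm]
  · exact (hP.jacP_fin l m n).smul fun _ => ζ

theorem jacP_shiftAdd_pow {P : ℤ → ℤ → E} (hP : AntiFin P) (ζ : ℂ) (l : ℤ) (p : ℕ) :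
    AntiFin ((shiftAdd ζ ^ p) P) ∧ jacP l ((shiftAdd ζ ^ p) P) = (shiftAdd ζ ^ p) (jacP l P) := by
  induction p with
  | zero => exact ⟨hP, rfl⟩
  | succ p ih =>
    rw [pow_succ', Module.End.mul_apply, Module.End.mul_apply, ← ih.2]
    exact ⟨ih.1.shiftAdd ζ, jacP_shiftAdd ih.1 ζ l⟩

theorem jacP_shiftAdd₂_pow {P : ℤ → ℤ → E} (hP : AntiFin P) (ζ : ℂ) (l : ℤ) (p : ℕ) :
    AntiFin ((shiftAdd₂ ζ ^ p) P) ∧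
      jacP l ((shiftAdd₂ ζ ^ p) P) = (shiftAdd₂ ζ ^ p) (jacP l P) := by
  induction p with
  | zero => exact ⟨hP, rfl⟩
  | succ p ih =>
    rw [pow_succ', Module.End.mul_apply, Module.End.mul_apply, ← ih.2]
    exact ⟨ih.1.shiftAdd₂ ζ, jacP_shiftAdd₂ ih.1 ζ l⟩

/-- Together with `jacQ_succ` and `jacR_succ` this makes the three terms of the Jacobi identity
solutions of one recursion in `l`. Equalities between such families can then be checked at a single
level and descended wherever multiplication by `x₁ - x₂` is injective. -/
theorem jacP_succ {P : ℤ → ℤ → E} (hP : AntiFin P) (l : ℤ) :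
    jacP (l + 1) P = diffShift (jacP l P) := by
  funext m n
  rw [jacP, bsum_succ (hP.jacP_fin (l + 1) m n), diffShift_apply, jacP, jacP, sub_eq_add_neg,
    ← bsum_neg]
  congr 1
  · exact bsum_congr fun i => by rw [add_right_comm l 1 m, add_assoc l m 1]
  · exact bsum_congr fun i => by
      rw [show l + 1 + m - ((i + 1 : ℕ) : ℤ) = l + m - i by push_cast; ring,
        show n + ((i + 1 : ℕ) : ℤ) = n + 1 + i by push_cast; ring, pow_succ]
      simp

theorem jacQ_succ {Q : ℤ → ℤ → E} (hQ : AntiFin fun n m => Q m n) (l : ℤ) :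
    jacQ (l + 1) Q = diffShift (jacQ l Q) := by
  funext m n
  rw [jacQ, jacP_succ hQ, diffShift_apply, diffShift_apply, jacQ, jacQ,
    zpow_add_one₀ (by norm_num)]
  simp only [mul_neg, mul_one, neg_smul, smul_sub]
  abel

/-- In the third term `x₁ - x₂` equals `x₀`, which acts by raising the first index of `R`; Pascal's
rule in `m` says the same. -/
theorem jacR_succ {R : ℤ → ℤ → E} (hR : EvZero atTop R) (l : ℤ) :
    jacR R (l + 1) = diffShift (jacR R l) := by
  funext m n
  have h : EvZero atTop fun i : ℕ => R (l + i) (m + 1 + n - i) :=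
    (hR.nat_cast l).mono fun i hi => by
      exact congrFun hi _
  rw [diffShift_apply, jacR, jacR, jacR, bsum_succ h, eq_sub_iff_add_eq, add_comm]
  congr 1
  · exact bsum_congr fun i => by rw [add_assoc m 1 n, add_comm 1 n]
  · exact bsum_congr fun i => by
      rw [show l + ((i + 1 : ℕ) : ℤ) = l + 1 + i by push_cast; ring,
        show m + 1 + n - ((i + 1 : ℕ) : ℤ) = m + n - i by push_cast; ring]

@[simp] theorem jacP_zero (P : ℤ → ℤ → E) : jacP 0 P = P := by funext m n; simp [jacP]

@[simp] theorem jacQ_zero (Q : ℤ → ℤ → E) : jacQ 0 Q = Q := by funext m n; simp [jacQ]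

theorem jacR_zero_left (R : ℤ → ℤ → E) (l n : ℤ) : jacR R l 0 n = R l n := by simp [jacR]

/-- A double sequence killed by `x₁ - x₂` depends on `m + n` only, so one column determines it. -/
theorem eq_zero_of_diffShift {X : ℤ → ℤ → E} (h : diffShift X = 0) (M : ℤ)
    (hM : ∀ n, X M n = 0) : X = 0 := by
  have h' : ∀ m n, X (m + 1) n = X m (n + 1) := fun m n =>
    sub_eq_zero.1 (congrFun (congrFun h m) n)
  funext m
  rcases le_total M m with hm | hm
  · induction m, hm using Int.leInduction with
    | base => exact funext hM
    | succ m _ ih => funext n; rw [h', ih]; rfl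
  · induction m, hm using Int.leInductionDown with
    | base => exact funext hM
    | pred m _ ih =>
      funext n
      have := h' (m - 1) (n - 1)
      rw [sub_add_cancel, sub_add_cancel, ih] at this
      exact this.symm

theorem eq_zero_of_diffShift_atBot {X : ℤ → ℤ → E} (h : diffShift X = 0)
    (hX : EvZero atBot X) : X = 0 := by
  obtain ⟨M, hM⟩ := eventually_atBot.1 hX
  exact eq_zero_of_diffShift h M fun n => congrFun (hM M le_rfl) n

/-! ### Truncation -/

/-- Vanishing near `-∞`, uniformly for the first index. -/
def BotTrunc (P : ℤ → ℤ → E) : Prop := EvZero atBot P ∧ ∀ m, EvZero atBot (P m)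

/-- Vanishing near `+∞`, uniformly for the second index. -/
def TopTrunc (P : ℤ → ℤ → E) : Prop :=
  EvZero atTop (fun n m => P m n) ∧ ∀ n, EvZero atTop fun m => P m n

theorem BotTrunc.antiFin {P : ℤ → ℤ → E} (hP : BotTrunc P) : AntiFin P := fun m n =>
  (hP.1.sub_nat m).mono fun i hi => congrFun hi (n + i)

theorem TopTrunc.antiFin {P : ℤ → ℤ → E} (hP : TopTrunc P) : AntiFin P := fun m n =>
  (hP.1.nat_cast n).mono fun i hi => congrFun hi (m - i)

theorem BotTrunc.jacP {P : ℤ → ℤ → E} (hP : BotTrunc P) (l : ℤ) : BotTrunc (jacP l P) := by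
  obtain ⟨N, hN⟩ := eventually_atBot.1 hP.1
  constructor
  · filter_upwards [eventually_le_atBot (N - l)] with m hm
    funext n
    rw [VOATheory.jacP, Pi.zero_apply, ← bsum_zero_fun (E := E) l]
    exact bsum_congr fun i => by rw [hN _ (by omega)]; simp
  · intro m
    obtain ⟨I, hI⟩ : ∃ I : ℕ, l + m - N ≤ I := ⟨_, Int.self_le_toNat _⟩
    have : ∀ᶠ n in atBot, ∀ i ∈ Finset.range I, P (l + m - i) (n + i) = 0 :=
      (Finset.eventually_all _).2 fun i _ =>
        (tendsto_add_atBot (i : ℤ)).eventually (hP.2 (l + m - i))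
    filter_upwards [this] with n hn
    rw [VOATheory.jacP, ← bsum_zero_fun (E := E) l]
    refine bsum_congr fun i => ?_
    by_cases hi : i < I
    · rw [hn i (by simpa using hi), smul_zero]
    · rw [hN _ (by omega)]; simp

theorem TopTrunc.jacP {P : ℤ → ℤ → E} (hP : TopTrunc P) (l : ℤ) : TopTrunc (jacP l P) := by
  obtain ⟨N, hN⟩ := eventually_atTop.1 hP.1
  have hN' : ∀ n, N ≤ n → ∀ m, P m n = 0 := fun n hn m => congrFun (hN n hn) m
  constructor
  · filter_upwards [eventually_ge_atTop N] with n hn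
    funext m
    rw [VOATheory.jacP, Pi.zero_apply, ← bsum_zero_fun (E := E) l]
    exact bsum_congr fun i => by rw [hN' _ (by omega), smul_zero]
  · intro n
    obtain ⟨I, hI⟩ : ∃ I : ℕ, N - n ≤ I := ⟨_, Int.self_le_toNat _⟩
    have : ∀ᶠ m in atTop, ∀ i ∈ Finset.range I, P (m + (l - i)) (n + i) = 0 :=
      (Finset.eventually_all _).2 fun i _ =>
        (tendsto_add_atTop (l - i)).eventually (hP.2 (n + i))
    filter_upwards [this] with m hm
    rw [VOATheory.jacP, ← bsum_zero_fun (E := E) l]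
    refine bsum_congr fun i => ?_
    by_cases hi : i < I
    · rw [show l + m - (i : ℤ) = m + (l - i) by ring, hm i (by simpa using hi), smul_zero]
    · rw [hN' _ (by omega), smul_zero]

/-- Only finitely many rows of `R` enter the third term at level `l`, so the truncation of the
single rows is enough in either variable. -/
theorem jacR_evZero {F : Filter ℤ} (hF : ∀ k : ℤ, Tendsto (fun n : ℤ => n + k) F F)
    {R : ℤ → ℤ → E} (hR : EvZero atTop R) (hR' : ∀ j, EvZero F (R j)) (l : ℤ) :
    (∀ n, EvZero F fun m => jacR R l m n) ∧ ∀ m, EvZero F (jacR R l m) := by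
  obtain ⟨I, hI⟩ := eventually_atTop.1 (hR.nat_cast l)
  have key : ∀ m n : ℤ, (∀ i ∈ Finset.range I, R (l + i) (m + n - i) = 0) → jacR R l m n = 0 := by
    intro m n h
    rw [jacR, ← bsum_zero_fun (E := E) m]
    refine bsum_congr fun i => ?_
    by_cases hi : i < I
    · exact h i (by simpa using hi)
    · exact congrFun (hI i (by omega)) _
  constructor
  · intro n
    have : ∀ᶠ m in F, ∀ i ∈ Finset.range I, R (l + i) (m + (n - i)) = 0 :=
      (Finset.eventually_all _).2 fun i _ => (hF (n - i)).eventually (hR' (l + i))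
    exact this.mono fun m hm => key m n fun i hi => by
      rw [show m + n - (i : ℤ) = m + (n - i) by ring]; exact hm i hi
  · intro m
    have : ∀ᶠ n in F, ∀ i ∈ Finset.range I, R (l + i) (n + (m - i)) = 0 :=
      (Finset.eventually_all _).2 fun i _ => (hF (m - i)).eventually (hR' (l + i))
    exact this.mono fun n hn => key m n fun i hi => by
      rw [show m + n - (i : ℤ) = n + (m - i) by ring]; exact hn i hi

/-! ### Transfer of the Jacobi identity -/

/-- The factors are cancelled one variable at a time with the other index frozen, so the truncation
in one variable need not be uniform in the other. -/
theorem eq_zero_of_pow_pow {F : Filter ℤ} (hF : F = atBot ∨ F = atTop) {ζ : ℂ} {p r : ℕ}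
    {X : ℤ → ℤ → E} (h₁ : ∀ n, EvZero F fun m => X m n) (h₂ : ∀ m, EvZero F (X m))
    (h : (shiftAdd ζ ^ p) ((shiftAdd₂ ζ ^ r) X) = 0) : X = 0 := by
  have hpow : ∀ {l : ℕ} {s : ℤ → E}, EvZero F s → (shiftAdd ζ ^ l) s = 0 → s = 0 := by
    rcases hF with rfl | rfl
    · exact eq_zero_of_pow_atBot
    · exact eq_zero_of_pow_atTop
  have hmid : ∀ (r : ℕ) (n : ℤ), EvZero F fun m => (shiftAdd₂ ζ ^ r) X m n := by
    intro r
    induction r with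
    | zero => exact h₁
    | succ r ih =>
      intro n
      rw [pow_succ']
      exact (ih (n + 1)).add ((ih n).smul fun _ => ζ)
  have h0 : (shiftAdd₂ ζ ^ r) X = 0 := by
    funext m n
    refine congrFun (hpow (l := p) (hmid r n) ?_) m
    funext m
    rw [← shiftAdd_pow_apply₂, h]; rfl
  funext m
  exact hpow (h₂ m) (by rw [← shiftAdd₂_pow_apply, h0]; rfl)

/-- Multiplication by a polynomial in `x₁` or in `x₂` commutes with multiplication by an expansion
of `(x₁ - x₂) ^ l`. `jacP_eq_of_pow` is the same argument without the exchange of variables. -/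
theorem jacQ_eq_of_pow {Q Q' : ℤ → ℤ → E} (hQ : AntiFin fun n m => Q m n)
    (hQ' : AntiFin fun n m => Q' m n) {ζ : ℂ} {p r : ℕ}
    (h : (shiftAdd ζ ^ p) ((shiftAdd₂ ζ ^ r) Q) = (shiftAdd ζ ^ p) ((shiftAdd₂ ζ ^ r) Q')) (l : ℤ) :
    (shiftAdd ζ ^ p) ((shiftAdd₂ ζ ^ r) (jacQ l Q))
      = (shiftAdd ζ ^ p) ((shiftAdd₂ ζ ^ r) (jacQ l Q')) := by
  have swap : ∀ (p : ℕ) (X : ℤ → ℤ → E), (fun n m => (shiftAdd ζ ^ p) X m n)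
      = (shiftAdd₂ ζ ^ p) fun n m => X m n := by
    intro p X
    funext n m
    rw [shiftAdd₂_pow_apply, shiftAdd_pow_apply₂]
  have swap' : ∀ (p : ℕ) (X : ℤ → ℤ → E), (fun n m => (shiftAdd₂ ζ ^ p) X m n)
      = (shiftAdd ζ ^ p) fun n m => X m n := by
    intro p X
    funext n m
    rw [shiftAdd₂_pow_apply, shiftAdd_pow_apply₂]
  have key : ∀ {Q : ℤ → ℤ → E}, (AntiFin fun n m => Q m n) →
      (shiftAdd ζ ^ p) ((shiftAdd₂ ζ ^ r) (jacQ l Q))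
        = jacQ l ((shiftAdd ζ ^ p) ((shiftAdd₂ ζ ^ r) Q)) := by
    intro Q hQ
    funext m n
    have e1 : jacQ l Q = (-1 : ℂ) ^ l • fun m n => jacP l (fun n m => Q m n) n m := rfl
    rw [e1, map_smul, map_smul, jacQ, swap, swap']
    have h1 := jacP_shiftAdd_pow hQ ζ l r
    rw [(jacP_shiftAdd₂_pow h1.1 ζ l p).2, h1.2, ← swap' r, ← swap p]
    rfl
  rw [key hQ, key hQ', h]

theorem jacP_eq_of_pow {P P' : ℤ → ℤ → E} (hP : AntiFin P) (hP' : AntiFin P') {ζ : ℂ} {p r : ℕ}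
    (h : (shiftAdd ζ ^ p) ((shiftAdd₂ ζ ^ r) P) = (shiftAdd ζ ^ p) ((shiftAdd₂ ζ ^ r) P')) (l : ℤ) :
    (shiftAdd ζ ^ p) ((shiftAdd₂ ζ ^ r) (jacP l P))
      = (shiftAdd ζ ^ p) ((shiftAdd₂ ζ ^ r) (jacP l P')) := by
  have key : ∀ {P : ℤ → ℤ → E}, AntiFin P →
      (shiftAdd ζ ^ p) ((shiftAdd₂ ζ ^ r) (jacP l P))
        = jacP l ((shiftAdd ζ ^ p) ((shiftAdd₂ ζ ^ r) P)) := by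
    intro P hP
    have h1 := jacP_shiftAdd₂_pow hP ζ l r
    rw [(jacP_shiftAdd_pow h1.1 ζ l p).2, h1.2]
  rw [key hP, key hP', h]

/-- At level `l` only the rows `R j` with `j ≥ l` occur, and `x₂ + ζ` acts on each row separately.
No factor in `x₁` is needed here. -/
theorem jacR_eq_of_pow {R R' : ℤ → ℤ → E} (hR : EvZero atTop R) (hR' : EvZero atTop R') {ζ : ℂ}
    {r : ℕ} {l : ℤ} (h : ∀ j, l ≤ j → (shiftAdd ζ ^ r) (R j) = (shiftAdd ζ ^ r) (R' j)) :
    (shiftAdd₂ ζ ^ r) (jacR R l) = (shiftAdd₂ ζ ^ r) (jacR R' l) := by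
  have key : ∀ {R : ℤ → ℤ → E}, EvZero atTop R → ∀ m n,
      (shiftAdd₂ ζ ^ r) (jacR R l) m n
        = bsum m fun i => (shiftAdd ζ ^ r) (R (l + i)) (m + n - i) := by
    intro R hR m n
    rw [shiftAdd₂_pow_apply]
    have e : ∀ n, jacR R l m n = bsum m (fun (i : ℕ) (n : ℤ) => R (l + i) (n + (m - i))) n := by
      intro n
      have := map_bsum (l := m) (f := fun (i : ℕ) (n : ℤ) => R (l + i) (n + (m - i)))
        ((hR.nat_cast l).mono fun i hi => by funext n; simp [hi])
        (LinearMap.proj n : (ℤ → E) →ₗ[ℂ] E)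
      rw [LinearMap.proj_apply] at this
      rw [this, jacR]
      exact bsum_congr fun i => by
        rw [LinearMap.proj_apply, show m + n - (i : ℤ) = n + (m - i) by ring]
    have hz : EvZero atTop fun (i : ℕ) (n : ℤ) => R (l + i) (n + (m - i)) :=
      (hR.nat_cast l).mono fun i hi => by funext n; simp [hi]
    rw [funext e, map_bsum hz]
    have := map_bsum (l := m) (hz.map (shiftAdd ζ ^ r)) (LinearMap.proj n : (ℤ → E) →ₗ[ℂ] E)
    rw [LinearMap.proj_apply] at this
    rw [this]
    refine bsum_congr fun i => ?_
    rw [LinearMap.proj_apply, shiftAdd_pow_translate,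
      show m + n - (i : ℤ) = n + (m - i) by ring]
  funext m n
  rw [key hR, key hR']
  exact bsum_congr fun i => by rw [h _ (by omega)]

/-- After multiplication by `(x₁ + ζ) ^ p (x₂ + ζ) ^ r` the defect of the Jacobi identity for `P, Q,
R` becomes that for `P', Q', R'`, which is zero; truncation along `F` allows the factors to be
cancelled. The exponents may depend on `l`, because `r` has to serve all rows `R j` with `j ≥ l`. -/
theorem IsJacobi.transfer {F : Filter ℤ} (hF : F = atBot ∨ F = atTop) {P Q R P' Q' R' : ℤ → ℤ → E}
    {ζ : ℂ} (hJ : IsJacobi P' Q' R')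
    (hP' : AntiFin P') (hQ' : AntiFin fun n m => Q' m n) (hR' : EvZero atTop R')
    (hP : AntiFin P) (hQ : AntiFin fun n m => Q m n) (hR : EvZero atTop R)
    (hPt : ∀ l, (∀ n, EvZero F fun m => jacP l P m n) ∧ ∀ m, EvZero F (jacP l P m))
    (hQt : ∀ l, (∀ n, EvZero F fun m => jacQ l Q m n) ∧ ∀ m, EvZero F (jacQ l Q m))
    (hRt : ∀ j, EvZero F (R j))
    (h : ∀ l : ℤ, ∃ p r : ℕ,
      (shiftAdd ζ ^ p) ((shiftAdd₂ ζ ^ r) P) = (shiftAdd ζ ^ p) ((shiftAdd₂ ζ ^ r) P') ∧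
      (shiftAdd ζ ^ p) ((shiftAdd₂ ζ ^ r) Q) = (shiftAdd ζ ^ p) ((shiftAdd₂ ζ ^ r) Q') ∧
      ∀ j, l ≤ j → (shiftAdd ζ ^ r) (R j) = (shiftAdd ζ ^ r) (R' j)) :
    IsJacobi P Q R := by
  intro l
  obtain ⟨p, r, hPP, hQQ, hRR⟩ := h l
  have hRt' := jacR_evZero (F := F) (by
    rcases hF with rfl | rfl
    · exact tendsto_add_atBot
    · exact tendsto_add_atTop) hR hRt l
  have h0 : jacP l P - jacQ l Q - jacR R l = 0 := by
    refine eq_zero_of_pow_pow hF (ζ := ζ) (p := p) (r := r)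
      (fun n => (((hPt l).1 n).sub ((hQt l).1 n)).sub (hRt'.1 n))
      (fun m => (((hPt l).2 m).sub ((hQt l).2 m)).sub (hRt'.2 m)) ?_
    rw [map_sub, map_sub, map_sub, map_sub, jacP_eq_of_pow hP hP' hPP, jacQ_eq_of_pow hQ hQ' hQQ,
      jacR_eq_of_pow hR hR' hRR, ← map_sub, ← map_sub, ← map_sub, ← map_sub]
    have : jacP l P' - jacQ l Q' - jacR R' l = 0 := by
      funext m n; exact sub_eq_zero.2 (hJ l m n)
    rw [this, map_zero, map_zero]
  intro m n
  exact sub_eq_zero.1 (congrFun (congrFun h0 m) n)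

theorem IsJacobi.transfer_atBot {P Q R P' Q' R' : ℤ → ℤ → E}
    {ζ : ℂ} (hJ : IsJacobi P' Q' R')
    (hP' : AntiFin P') (hQ' : AntiFin fun n m => Q' m n) (hR' : EvZero atTop R')
    (hP : BotTrunc P) (hQ : BotTrunc fun n m => Q m n) (hR : EvZero atTop R)
    (hRt : ∀ j, EvZero atBot (R j))
    (h : ∀ l : ℤ, ∃ p r : ℕ,
      (shiftAdd ζ ^ p) ((shiftAdd₂ ζ ^ r) P) = (shiftAdd ζ ^ p) ((shiftAdd₂ ζ ^ r) P') ∧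
      (shiftAdd ζ ^ p) ((shiftAdd₂ ζ ^ r) Q) = (shiftAdd ζ ^ p) ((shiftAdd₂ ζ ^ r) Q') ∧
      ∀ j, l ≤ j → (shiftAdd ζ ^ r) (R j) = (shiftAdd ζ ^ r) (R' j)) :
    IsJacobi P Q R := by
  refine hJ.transfer (.inl rfl) hP' hQ' hR' hP.antiFin hQ.antiFin hR (fun l => ⟨fun n => ?_,
    (hP.jacP l).2⟩) (fun l => ⟨fun n => ?_, fun m => ?_⟩) hRt h
  · exact (hP.jacP l).1.mono fun m hm => congrFun hm n
  · exact ((hQ.jacP l).2 n).smul _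
  · exact EvZero.smul _ ((hQ.jacP l).1.mono fun n hn => congrFun hn m)

theorem IsJacobi.transfer_atTop {P Q R P' Q' R' : ℤ → ℤ → E}
    {ζ : ℂ} (hJ : IsJacobi P' Q' R')
    (hP' : AntiFin P') (hQ' : AntiFin fun n m => Q' m n) (hR' : EvZero atTop R')
    (hP : TopTrunc P) (hQ : TopTrunc fun n m => Q m n) (hR : EvZero atTop R)
    (hRt : ∀ j, EvZero atTop (R j))
    (h : ∀ l : ℤ, ∃ p r : ℕ,
      (shiftAdd ζ ^ p) ((shiftAdd₂ ζ ^ r) P) = (shiftAdd ζ ^ p) ((shiftAdd₂ ζ ^ r) P') ∧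
      (shiftAdd ζ ^ p) ((shiftAdd₂ ζ ^ r) Q) = (shiftAdd ζ ^ p) ((shiftAdd₂ ζ ^ r) Q') ∧
      ∀ j, l ≤ j → (shiftAdd ζ ^ r) (R j) = (shiftAdd ζ ^ r) (R' j)) :
    IsJacobi P Q R := by
  refine hJ.transfer (.inr rfl) hP' hQ' hR' hP.antiFin hQ.antiFin hR (fun l => ⟨(hP.jacP l).2,
    fun m => ?_⟩) (fun l => ⟨fun n => ?_, fun m => ?_⟩) hRt h
  · exact (hP.jacP l).1.mono fun n hn => congrFun hn m
  · exact EvZero.smul _ ((hQ.jacP l).1.mono fun m hm => congrFun hm n)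
  · exact ((hQ.jacP l).2 m).smul _

end JacobiCalculus

/-! ### Invariance of the Jacobi identity under translation of both variables. -/

section Reexpansion

variable {E : Type*} [AddCommGroup E] [Module ℂ E]

@[simp] theorem reexpand_zero (z : ℂ) : reexpand z (0 : ℤ → E) = 0 := by
  funext n
  simp [reexpand]

/-! ### Change of coordinates in two variables -/

/-- Below any point of the plane, the support is bounded. -/
def QuadFin (P : ℤ → ℤ → E) : Prop :=
  ∀ m n : ℤ, ∃ K : ℤ, ∀ m' n' : ℤ, m' ≤ m → n' ≤ n → (m' ≤ K ∨ n' ≤ K) → P m' n' = 0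

theorem BotTrunc.quadFin {P : ℤ → ℤ → E} (hP : BotTrunc P) : QuadFin P := by
  intro m n
  obtain ⟨N, hN⟩ := eventually_atBot.1 hP.1
  obtain ⟨I, hI⟩ : ∃ I : ℕ, m - N ≤ I := ⟨_, Int.self_le_toNat _⟩
  have : ∀ᶠ n' in atBot, ∀ i ∈ Finset.range I, P (m - i) n' = 0 :=
    (Finset.eventually_all _).2 fun i _ => hP.2 (m - i)
  obtain ⟨K, hK⟩ := eventually_atBot.1 this
  refine ⟨min K N, fun m' n' hm hn h => ?_⟩
  by_cases h' : m' ≤ N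
  · rw [hN m' h']; rfl
  · obtain ⟨i, hi⟩ := Int.le.dest hm
    have := hK n' (by omega) i (by simp; omega)
    rwa [show m - (i : ℤ) = m' by omega] at this

theorem QuadFin.swap {P : ℤ → ℤ → E} (hP : QuadFin P) : QuadFin fun n m => P m n := by
  intro n m
  obtain ⟨K, hK⟩ := hP m n
  exact ⟨K, fun n' m' hn hm h => hK m' n' hm hn h.symm⟩

/-- The third term vanishes only when `m + n` is very negative, so it is not truncated in `m`
uniformly in `n`. Hence translation in two variables is set up for `QuadFin` and not for `BotTrunc`.
-/
theorem jacR_quadFin {R : ℤ → ℤ → E} (hR : EvZero atTop R) (hR' : ∀ j, EvZero atBot (R j))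
    (l : ℤ) : QuadFin (jacR R l) := by
  intro m n
  obtain ⟨I, hI⟩ := eventually_atTop.1 (hR.nat_cast l)
  have : ∀ᶠ s in atBot, ∀ i ∈ Finset.range I, R (l + i) s = 0 :=
    (Finset.eventually_all _).2 fun i _ => hR' (l + i)
  obtain ⟨K, hK⟩ := eventually_atBot.1 this
  refine ⟨min (K - m) (K - n), fun m' n' hm hn h => ?_⟩
  rw [jacR, ← bsum_zero_fun (E := E) m']
  refine bsum_congr fun i => ?_
  by_cases hi : i < I
  · exact hK _ (by omega) i (by simpa using hi)
  · exact congrFun (hI i (by omega)) _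

theorem QuadFin.inner {P : ℤ → ℤ → E} (hP : QuadFin P) (m : ℤ) : EvZero atBot (P m) := by
  obtain ⟨K, hK⟩ := hP m 0
  filter_upwards [eventually_le_atBot (min K 0)] with n hn
  exact hK m n le_rfl (by omega) (by omega)

/-- The change of coordinates `y = x - z` in both variables. -/
def reexpand₂ (z : ℂ) (P : ℤ → ℤ → E) (m n : ℤ) : E :=
  bsum m fun i => z ^ i • reexpand z (P (m - i)) n

theorem QuadFin.outer {P : ℤ → ℤ → E} (hP : QuadFin P) (z : ℂ) (m n : ℤ) :
    EvZero atTop fun i : ℕ => reexpand z (P (m - i)) n := by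
  obtain ⟨K, hK⟩ := hP m n
  filter_upwards [eventually_ge_atTop (m - K).toNat] with i hi
  rw [reexpand, ← bsum_zero_fun (E := E) n]
  exact bsum_congr fun j => by rw [hK _ _ (by omega) (by omega) (by omega), smul_zero]

theorem QuadFin.smul {P : ℤ → ℤ → E} (hP : QuadFin P) (c : ℂ) : QuadFin (c • P) := by
  intro m n
  obtain ⟨K, hK⟩ := hP m n
  exact ⟨K, fun m' n' hm hn h => by simp [hK m' n' hm hn h]⟩

theorem reexpand₂_add {z : ℂ} {P Q : ℤ → ℤ → E} (hP : QuadFin P) (hQ : QuadFin Q) :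
    reexpand₂ z (P + Q) = reexpand₂ z P + reexpand₂ z Q := by
  funext m n
  simp only [Pi.add_apply, reexpand₂]
  rw [← bsum_add ((hP.outer z m n).smul _) ((hQ.outer z m n).smul _)]
  refine bsum_congr fun i => ?_
  rw [reexpand_add (hP.inner _) (hQ.inner _), Pi.add_apply, smul_add]

theorem reexpand₂_smul {z : ℂ} {P : ℤ → ℤ → E} (c : ℂ) :
    reexpand₂ z (c • P) = c • reexpand₂ z P := by
  funext m n
  simp only [Pi.smul_apply, reexpand₂]
  rw [← bsum_smul]
  exact bsum_congr fun i => by rw [reexpand_smul, Pi.smul_apply, smul_comm]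

theorem reexpand₂_sub {z : ℂ} {P Q : ℤ → ℤ → E} (hP : QuadFin P) (hQ : QuadFin Q) :
    reexpand₂ z (P - Q) = reexpand₂ z P - reexpand₂ z Q := by
  rw [sub_eq_add_neg, ← neg_one_smul ℂ Q, reexpand₂_add hP (hQ.smul _), reexpand₂_smul,
    neg_one_smul, sub_eq_add_neg]

theorem QuadFin.shiftAdd {P : ℤ → ℤ → E} (hP : QuadFin P) (z : ℂ) : QuadFin (shiftAdd z P) := by
  intro m n
  obtain ⟨K, hK⟩ := hP (m + 1) n
  refine ⟨K - 1, fun m' n' hm hn h => ?_⟩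
  rw [shiftAdd_apply, Pi.add_apply, Pi.smul_apply, hK _ _ (by omega) hn (by omega),
    hK _ _ (by omega) hn (by omega), smul_zero, add_zero]

theorem QuadFin.shiftAdd₂ {P : ℤ → ℤ → E} (hP : QuadFin P) (z : ℂ) : QuadFin (shiftAdd₂ z P) := by
  intro m n
  obtain ⟨K, hK⟩ := hP m (n + 1)
  refine ⟨K - 1, fun m' n' hm hn h => ?_⟩
  rw [shiftAdd₂_apply, hK _ _ (by omega) (by omega) (by omega),
    hK _ _ (by omega) (by omega) (by omega), smul_zero, add_zero]

theorem reexpand₂_shift {z : ℂ} {P : ℤ → ℤ → E} (hP : QuadFin P) (m n : ℤ) :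
    reexpand₂ z P (m + 1) n = reexpand₂ z (shiftAdd z P) m n := by
  have h := hP.outer z (m + 1) n
  rw [reexpand₂, bsum_succ (h.smul _), reexpand₂]
  have e : ∀ i : ℕ, reexpand z (shiftAdd z P (m - i)) n
      = reexpand z (P (m + 1 - i)) n + z • reexpand z (P (m - i)) n := by
    intro i
    have : shiftAdd z P (m - i) = P (m + 1 - i) + z • P (m - i) := by
      rw [shiftAdd_apply, sub_add_eq_add_sub]
    have h2 : EvZero atBot (z • P (m - i)) := (hP.inner _).smul fun _ => z
    rw [this, reexpand_add (hP.inner _) h2, reexpand_smul]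
    rfl
  simp only [e, smul_add]
  rw [bsum_add (h.smul _) (((hP.outer z m n).smul fun _ => z).smul _)]
  congr 1
  exact bsum_congr fun i => by
    rw [pow_succ, mul_smul, show m + 1 - ((i + 1 : ℕ) : ℤ) = m - i by push_cast; ring]

theorem reexpand₂_shift₂ {z : ℂ} {P : ℤ → ℤ → E} (hP : QuadFin P) (m n : ℤ) :
    reexpand₂ z P m (n + 1) = reexpand₂ z (shiftAdd₂ z P) m n :=
  bsum_congr fun i => by rw [reexpand_shift (hP.inner _)]; rfl

/-- The difference of the variables is translation invariant: `y₁ - y₂ = (y₁ + z) - (y₂ + z)`. -/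
theorem reexpand₂_diffShift {z : ℂ} {P : ℤ → ℤ → E} (hP : QuadFin P) :
    reexpand₂ z (diffShift P) = diffShift (reexpand₂ z P) := by
  have e : diffShift P = shiftAdd z P - shiftAdd₂ z P := by
    funext m n
    simp only [diffShift_apply, Pi.sub_apply, shiftAdd_apply, shiftAdd₂_apply, Pi.add_apply,
      Pi.smul_apply]
    abel
  rw [e, reexpand₂_sub (hP.shiftAdd z) (hP.shiftAdd₂ z)]
  funext m n
  rw [diffShift_apply, reexpand₂_shift hP, reexpand₂_shift₂ hP]
  rfl

theorem reexpand₂_swap {z : ℂ} {P : ℤ → ℤ → E} (hP : QuadFin P) (m n : ℤ) :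
    reexpand₂ z (fun n m => P m n) n m = reexpand₂ z P m n := by
  obtain ⟨K, hK⟩ := hP m n
  have h0 : ∀ {i j : ℕ}, ((m - K).toNat ≤ i ∨ (n - K).toNat ≤ j) → P (m - i) (n - j) = 0 :=
    fun h => hK _ _ (by omega) (by omega) (by omega)
  have e1 : ∀ i : ℕ, reexpand z (P (m - i)) n = ∑ j ∈ Finset.range (n - K).toNat,
      ((Ring.choose n j : ℤ) : ℂ) • (z ^ j • P (m - i) (n - j)) := fun i =>
    bsum_eq_sum fun j hj => by rw [h0 (.inr hj), smul_zero]
  have e2 : ∀ j : ℕ, reexpand z (fun m => P m (n - j)) m = ∑ i ∈ Finset.range (m - K).toNat,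
      ((Ring.choose m i : ℤ) : ℂ) • (z ^ i • P (m - i) (n - j)) := fun i =>
    bsum_eq_sum fun j hj => (congrArg (z ^ j • ·) (h0 (.inl hj))).trans (smul_zero _)
  rw [reexpand₂, reexpand₂, bsum_eq_sum (I := (n - K).toNat), bsum_eq_sum (I := (m - K).toNat)]
  · simp only [e1, e2, Finset.smul_sum]
    rw [Finset.sum_comm]
    refine Finset.sum_congr rfl fun i _ => Finset.sum_congr rfl fun j _ => ?_
    simp only [smul_smul]
    congr 1
    ring
  · intro i hi
    rw [e1, Finset.sum_eq_zero, smul_zero]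
    intro j _
    rw [h0 (.inl hi)]; simp
  · intro j hj
    rw [e2, Finset.sum_eq_zero, smul_zero]
    intro i _
    rw [h0 (.inr hj)]; simp

theorem reexpand₂_botTrunc {z : ℂ} {P : ℤ → ℤ → E} (hP : BotTrunc P) :
    BotTrunc (reexpand₂ z P) := by
  constructor
  · obtain ⟨N, hN⟩ := eventually_atBot.1 hP.1
    filter_upwards [eventually_le_atBot N] with m hm
    funext n
    rw [reexpand₂, Pi.zero_apply, ← bsum_zero_fun (E := E) m]
    refine bsum_congr fun i => ?_
    rw [hN _ (by omega), reexpand_zero, Pi.zero_apply, smul_zero]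
  · intro m
    obtain ⟨I, hI⟩ := eventually_atTop.1 (hP.1.sub_nat m)
    have : ∀ᶠ n in atBot, ∀ i ∈ Finset.range I, reexpand z (P (m - i)) n = 0 :=
      (Finset.eventually_all _).2 fun i _ => reexpand_evZero (hP.2 _)
    filter_upwards [this] with n hn
    rw [reexpand₂, ← bsum_zero_fun (E := E) m]
    refine bsum_congr fun i => ?_
    by_cases hi : i < I
    · rw [hn i (by simpa using hi), smul_zero]
    · have h0 : P (m - i) = 0 := hI i (by omega)
      rw [h0, reexpand_zero, Pi.zero_apply, smul_zero]

/-- Two families with `X (l + 1) = (x₁ - x₂) X l` agreeing at one level agree everywhere. -/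
theorem diffShift_family_unique {X Y : ℤ → ℤ → ℤ → E} (hX : ∀ l, X (l + 1) = diffShift (X l))
    (hY : ∀ l, Y (l + 1) = diffShift (Y l))
    (hinj : ∀ l, diffShift (X l - Y l) = 0 → X l - Y l = 0) (l₀ : ℤ) (h : X l₀ = Y l₀) :
    X = Y := by
  funext l
  rcases le_total l₀ l with hl | hl
  · induction l, hl using Int.leInduction with
    | base => exact h
    | succ l _ ih => rw [hX, hY, ih]
  · induction l, hl using Int.leInductionDown with
    | base => exact h
    | pred l _ ih =>
      refine sub_eq_zero.1 (hinj _ ?_)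
      rw [map_sub, ← hX, ← hY, sub_add_cancel, ih, sub_self]

/-- The two sides agree at `l = 0` and satisfy the same recursion in `l`. Truncation in the first
index makes `x₁ - x₂` injective, which carries the equality down to negative `l` without any
binomial convolution. -/
theorem jacP_reexpand₂ {z : ℂ} {P : ℤ → ℤ → E} (hP : BotTrunc P) (l : ℤ) :
    jacP l (reexpand₂ z P) = reexpand₂ z (jacP l P) := by
  have h := reexpand₂_botTrunc (z := z) hP
  refine congrFun (diffShift_family_unique (X := fun l => jacP l (reexpand₂ z P))
    (Y := fun l => reexpand₂ z (jacP l P)) (fun l => jacP_succ h.antiFin l) (fun l => ?_)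
    (fun l h0 => ?_) 0 (by simp)) l
  · rw [← reexpand₂_diffShift (hP.jacP l).quadFin, ← jacP_succ hP.antiFin]
  · exact eq_zero_of_diffShift_atBot h0
      ((h.jacP l).1.sub (reexpand₂_botTrunc (hP.jacP l)).1)

theorem jacR_reexpand {z : ℂ} {R : ℤ → ℤ → E} (hR : EvZero atTop R)
    (hR' : ∀ j, EvZero atBot (R j)) (l : ℤ) :
    jacR (fun j => reexpand z (R j)) l = reexpand₂ z (jacR R l) := by
  have h : EvZero atTop fun j => reexpand z (R j) :=
    hR.mono fun j hj => by simp [hj]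
  obtain ⟨J, hJ⟩ := eventually_atTop.1 hR
  obtain ⟨J', hJ'⟩ := eventually_atTop.1 h
  have z0 : ∀ {R : ℤ → ℤ → E} {J l : ℤ}, (∀ j, J ≤ j → R j = 0) → J ≤ l → jacR R l = 0 := by
    intro R J l h hl
    funext m n
    refine Eq.trans ?_ (bsum_zero_fun (E := E) m)
    exact bsum_congr fun i => by rw [h _ (by omega)]; rfl
  refine congrFun (diffShift_family_unique (X := fun l => jacR (fun j => reexpand z (R j)) l)
    (Y := fun l => reexpand₂ z (jacR R l)) (fun l => jacR_succ h l) (fun l => ?_)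
    (fun l h0 => ?_) (max J J') ?_) l
  · rw [← reexpand₂_diffShift (jacR_quadFin hR hR' l), ← jacR_succ hR]
  -- In the column `m = 0` both sides are `reexpand z (R l)`. The other input, a level at which the
  -- families agree, is any large `l`, where both vanish.
  · refine eq_zero_of_diffShift h0 0 fun n => ?_
    simp only [Pi.sub_apply, jacR_zero_left, reexpand₂, bsum_zero, pow_zero, one_smul]
    rw [show jacR R l (0 - ((0 : ℕ) : ℤ)) = R l from funext fun n => by simp [jacR_zero_left],
      sub_self]
  · rw [z0 hJ' (le_max_right J J'), z0 hJ (le_max_left J J')]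
    simpa using (reexpand₂_smul (z := z) (0 : ℂ) (P := (0 : ℤ → ℤ → E))).symm

theorem IsJacobi.reexpand {P Q R : ℤ → ℤ → E} (hJ : IsJacobi P Q R)
    (hP : BotTrunc P) (hQ : BotTrunc fun n m => Q m n) (hR : EvZero atTop R)
    (hR' : ∀ j, EvZero atBot (R j)) (z : ℂ) :
    IsJacobi (reexpand₂ z P) (reexpand₂ z Q) (fun j => VOATheory.reexpand z (R j)) := by
  intro l m n
  have hq : QuadFin Q := hQ.quadFin.swap
  have e : jacQ l (reexpand₂ z Q) m n = reexpand₂ z (jacQ l Q) m n := by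
    have h2 : jacQ l Q = (-1 : ℂ) ^ l • fun m n => jacP l (fun n m => Q m n) n m := rfl
    rw [jacQ, h2, reexpand₂_smul,
      show (fun n m => reexpand₂ z Q m n) = reexpand₂ z (fun n m => Q m n) from
        funext fun n => funext fun m => (reexpand₂_swap hq m n).symm,
      jacP_reexpand₂ hQ, Pi.smul_apply, Pi.smul_apply,
      reexpand₂_swap (P := jacP l fun n m => Q m n) (hQ.jacP l).quadFin]
  rw [jacP_reexpand₂ hP, e, jacR_reexpand hR hR']
  have hJ' : jacP l P - jacQ l Q = jacR R l := by funext m n; exact hJ l m n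
  have hqf : QuadFin (jacQ l Q) := (QuadFin.swap (hQ.jacP l).quadFin).smul ((-1 : ℂ) ^ l)
  rw [← hJ', reexpand₂_sub (hP.jacP l).quadFin hqf]
  rfl

end Reexpansion

/-! ### From absolutely convergent Laurent series to identities between modes. -/

section Convergence

/-! ### Convergent Laurent series and their modes -/

theorem hasSum_of_eq {ι : Type*} {f g : ι → ℂ} {a b : ℂ} (h : HasSum g b) (hf : ∀ n, f n = g n)
    (ha : a = b) : HasSum f a := by
  rw [funext hf, ha]; exact h

/-- The series with modes `c` converges to `F` in the annulus `0 < |x| < |z|`. -/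
def ConvergesTo (z : ℂ) (c : ℤ → ℂ) (F : ℂ → ℂ) : Prop :=
  ∀ x : ℂ, 0 < ‖x‖ → ‖x‖ < ‖z‖ → HasSum (fun n : ℤ => c (-n - 1) * x ^ n) (F x)

/-- The modes of a polynomial. -/
def polySeq (g : Polynomial ℂ) (n : ℤ) : ℂ := if n < 0 then g.coeff (-n - 1).toNat else 0

theorem ConvergesTo.shiftAdd {z : ℂ} {c : ℤ → ℂ} {F : ℂ → ℂ} (h : ConvergesTo z c F) (ζ : ℂ) :
    ConvergesTo z (shiftAdd ζ c) fun x => (x + ζ) * F x := by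
  intro x hx hxz
  have hx0 : x ≠ 0 := norm_pos_iff.1 hx
  have h1 := h x hx hxz
  have h2 : HasSum (fun n : ℤ => x * (c (-(n - 1) - 1) * x ^ (n - 1))) (x * F x) :=
    ((Equiv.subRight (1 : ℤ)).hasSum_iff.2 h1).mul_left x
  convert h2.add (h1.mul_left ζ) using 1
  · funext n
    rw [shiftAdd_apply, show -(n - 1) - 1 = -n - 1 + 1 by ring, zpow_sub_one₀ hx0]
    simp only [smul_eq_mul]
    field_simp
  · ring

theorem ConvergesTo.shiftAdd_pow {z : ℂ} {c : ℤ → ℂ} {F : ℂ → ℂ} (h : ConvergesTo z c F) (ζ : ℂ)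
    (l : ℕ) : ConvergesTo z ((VOATheory.shiftAdd ζ ^ l) c) fun x => (x + ζ) ^ l * F x := by
  induction l with
  | zero => simpa using h
  | succ l ih =>
    have := ih.shiftAdd ζ
    rw [pow_succ', Module.End.mul_apply]
    simpa only [pow_succ', mul_assoc] using this

theorem convergesTo_polySeq (z : ℂ) (g : Polynomial ℂ) :
    ConvergesTo z (polySeq g) fun x => g.eval x := by
  intro x _ _
  have hinj : Function.Injective (fun n : ℕ => (n : ℤ)) := Nat.cast_injective
  refine (hinj.hasSum_iff ?_).1 ?_
  · intro n hn
    have : n < 0 := by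
      by_contra h
      exact hn ⟨n.toNat, by simp; omega⟩
    rw [polySeq, if_neg (by omega), zero_mul]
  · have : (fun n : ℤ => polySeq g (-n - 1) * x ^ n) ∘ (fun n : ℕ => (n : ℤ))
        = fun n : ℕ => g.coeff n * x ^ n := by
      funext n
      simp only [Function.comp_apply, polySeq, zpow_natCast]
      rw [if_pos (by omega), show (-(-(n : ℤ) - 1) - 1).toNat = n by omega]
    rw [this]
    change HasSum _ (g.eval x)
    rw [Polynomial.eval_eq_sum_range]
    refine hasSum_sum_of_ne_finset_zero fun n hn => ?_
    rw [Polynomial.coeff_eq_zero_of_natDegree_lt (by simpa using hn), zero_mul]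

theorem ConvergesTo.unique {z : ℂ} (hz : z ≠ 0) {c d : ℤ → ℂ} {F : ℂ → ℂ}
    (hc : ConvergesTo z c F) (hd : ConvergesTo z d F) (hc' : EvZero atTop c)
    (hd' : EvZero atTop d) : c = d := by
  obtain ⟨N, hN⟩ := eventually_atTop.1 (hc'.sub hd')
  -- Mode `N - j` belongs to `x ^ (j - N - 1)`. Multiplied by `x ^ (1 + N)`, the difference of the
  -- two series is the power series with coefficients `a`, and it sums to zero near `0`.
  let a : ℕ → ℂ := fun j => (c - d) (N - j)
  have hinj : Function.Injective (fun j : ℕ => (j : ℤ) - 1 - N) := by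
    intro i j h
    simpa using h
  have hsum : ∀ x : ℂ, ‖x‖ < ‖z‖ → HasSum (fun j : ℕ => x ^ j * a j) 0 := by
    intro x hxz
    by_cases hx : x = 0
    · have : (fun j : ℕ => x ^ j * a j) = fun _ => 0 := by
        funext j
        rcases j with _ | j
        · simp [a, sub_eq_zero.1 (hN N le_rfl)]
        · simp [hx]
      rw [this]; exact hasSum_zero
    · have h0 := (hc x (norm_pos_iff.2 hx) hxz).sub (hd x (norm_pos_iff.2 hx) hxz)
      rw [sub_self] at h0
      have h1 := (hinj.hasSum_iff (f := fun n : ℤ => (c - d) (-n - 1) * x ^ n) ?_).2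
        (by simpa [sub_mul] using h0)
      · have h2 := h1.mul_left (x ^ (1 + N))
        rw [mul_zero] at h2
        refine hasSum_of_eq h2 (fun j => ?_) rfl
        simp only [Function.comp_apply, a]
        rw [show -((j : ℤ) - 1 - N) - 1 = N - j by ring, ← zpow_natCast x j, mul_left_comm,
          ← zpow_add₀ hx, mul_comm]
        congr 2
        ring
      · intro n hn
        have h0 : (c - d) (-n - 1) = 0 := hN _ ?_
        · change (c - d) (-n - 1) * x ^ n = 0
          rw [h0, zero_mul]
        by_contra h
        exact hn ⟨(n + 1 + N).toNat, by simp only; omega⟩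
  have hp : HasFPowerSeriesAt 0 (FormalMultilinearSeries.ofScalars ℂ a) (0 : ℂ) := by
    rw [hasFPowerSeriesAt_iff]
    filter_upwards [Metric.ball_mem_nhds (0 : ℂ) (norm_pos_iff.2 hz)] with x hx
    simpa [FormalMultilinearSeries.coeff_ofScalars] using hsum x (by simpa using hx)
  have h0 := hp.eq_zero
  have ha : ∀ j, a j = 0 := fun j => by
    rw [← FormalMultilinearSeries.coeff_ofScalars (𝕜 := ℂ) (p := a) (n := j), h0]
    rfl
  funext n
  by_cases hn : N ≤ n
  · exact sub_eq_zero.1 (hN n hn)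
  · have := ha (N - n).toNat
    simp only [a] at this
    rw [show N - ((N - n).toNat : ℤ) = n by omega] at this
    exact sub_eq_zero.1 this

/-- This is the coefficient of `x ^ n` in `(x + z) c` times the geometric series of `1 / (x + z)`.
The sum telescopes, and its far end vanishes because `c` does. -/
theorem hasSum_geometric_fiber {z : ℂ} {c : ℤ → ℂ} (hz : z ≠ 0) (hc : EvZero atTop c) {x : ℂ}
    (hx0 : x ≠ 0) (n : ℤ) :
    HasSum (fun i : ℕ => VOATheory.shiftAdd z c (-(n - i) - 1) * x ^ (n - i) *
      (z⁻¹ * (-x / z) ^ i)) (c (-n - 1) * x ^ n) := by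
  let t : ℕ → ℂ := fun i => x ^ n * ((-z)⁻¹ ^ i * c (-n - 1 + i))
  obtain ⟨I, hI⟩ := eventually_atTop.1 (hc.nat_cast (-n - 1))
  have ht : ∀ i, I ≤ i → t i = 0 := fun i hi => by
    have : c (-n - 1 + i) = 0 := hI i hi
    simp [t, this]
  have hs : HasSum (fun i => t i - t (i + 1)) (∑ i ∈ Finset.range I, (t i - t (i + 1))) :=
    hasSum_sum_of_ne_finset_zero fun i hi => by
      rw [ht i (by simpa using hi), ht (i + 1) (by simp at hi; omega), sub_zero]
  rw [Finset.sum_range_sub', ht I le_rfl, sub_zero] at hs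
  refine hasSum_of_eq hs (fun i => ?_) (by simp [t, mul_comm])
  have e1 : -(n - (i : ℤ)) - 1 = -n - 1 + i := by ring
  have e2 : -n - 1 + ((i + 1 : ℕ) : ℤ) = -n - 1 + i + 1 := by push_cast; ring
  have e3 : -x / z = x * (-z)⁻¹ := by field_simp
  have hxi : x ^ (n - i) * x ^ i = x ^ n := by rw [← zpow_natCast x i, ← zpow_add₀ hx0]; simp
  simp only [shiftAdd_apply, smul_eq_mul, t, e1, e2, pow_succ, e3, mul_pow, ← hxi]
  have e4 : (-z)⁻¹ = -z⁻¹ := by rw [inv_neg]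
  have e5 : z * z⁻¹ = 1 := mul_inv_cancel₀ hz
  generalize c (-n - 1 + i + 1) = a
  generalize c (-n - 1 + i) = b
  rw [e4]
  linear_combination (x ^ (n - (i : ℤ)) * x ^ i * (-z⁻¹) ^ i * b) * e5

theorem hasSum_mul_prod {ι κ : Type*} {f : ι → ℂ} {g : κ → ℂ} {a b : ℂ} (hf : HasSum f a)
    (hg : HasSum g b) : HasSum (fun p : ι × κ => f p.1 * g p.2) (a * b) := by
  have hs1 := hf.summable.norm
  have hs2 := hg.summable.norm
  exact hf.mul hg (summable_mul_of_summable_norm hs1 hs2)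

/-- The bijection `(n, i) ↦ (n - i, i)`. -/
def shearEquiv : ℤ × ℕ ≃ ℤ × ℕ where
  toFun p := (p.1 - p.2, p.2)
  invFun p := (p.1 + p.2, p.2)
  left_inv p := by simp
  right_inv p := by simp

theorem hasSum_mul_geometric {a : ℤ → ℂ} {F r y : ℂ} (ha : HasSum a F) (hr : ‖r‖ < 1) :
    HasSum (fun p : ℤ × ℕ => a (p.1 - p.2) * (y * r ^ p.2)) (F * (y * (1 - r)⁻¹)) := by
  have hg : HasSum (fun i : ℕ => y * r ^ i) (y * (1 - r)⁻¹) :=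
    (hasSum_geometric_of_norm_lt_one hr).mul_left y
  exact shearEquiv.hasSum_iff.2 (hasSum_mul_prod ha hg)

/-- The given series and the geometric series of `1 / (x + z)` both converge absolutely for `0 < |x|
< |z|`. Their product may therefore be summed along the fibres of `(n, i) ↦ n` after the shear, so
the convergence of `c` itself comes for free. -/
theorem ConvergesTo.of_shiftAdd {z : ℂ} {c : ℤ → ℂ} {F : ℂ → ℂ} (hz : z ≠ 0)
    (hc : EvZero atTop c) (h : ConvergesTo z (VOATheory.shiftAdd z c) F) :
    ConvergesTo z c fun x => F x / (x + z) := by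
  intro x hx hxz
  have hx0 : x ≠ 0 := norm_pos_iff.1 hx
  have hr : ‖-x / z‖ < 1 := by
    rw [norm_div, norm_neg, div_lt_one (norm_pos_iff.2 hz)]; exact hxz
  have hne : x + z ≠ 0 := by
    intro h0
    rw [eq_neg_of_add_eq_zero_left h0, norm_neg] at hxz
    exact lt_irrefl _ hxz
  have e : F x / (x + z) = F x * (z⁻¹ * (1 - -x / z)⁻¹) := by
    have : 1 - -x / z = (x + z) / z := by field_simp; ring
    rw [this]
    field_simp
  change HasSum _ (F x / (x + z))
  rw [e]
  exact (hasSum_mul_geometric (h x hx hxz) hr).prod_fiberwise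
    fun n => hasSum_geometric_fiber hz hc hx0 n

theorem ConvergesTo.of_shiftAdd_pow {z : ℂ} {c : ℤ → ℂ} {F : ℂ → ℂ} (hz : z ≠ 0) {l : ℕ}
    (hc : EvZero atTop c) (h : ConvergesTo z ((VOATheory.shiftAdd z ^ l) c) F) :
    ConvergesTo z c fun x => F x / (x + z) ^ l := by
  induction l generalizing F with
  | zero => simpa using h
  | succ l ih =>
    rw [pow_succ', Module.End.mul_apply] at h
    have := ih (h.of_shiftAdd hz (hc.shiftAdd_pow tendsto_add_atTop z l))
    simpa only [div_div, pow_succ'] using this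

theorem ConvergesTo.of_shiftAdd_zero_pow {z : ℂ} {c : ℤ → ℂ} {F : ℂ → ℂ} {k : ℕ}
    (h : ConvergesTo z ((VOATheory.shiftAdd 0 ^ k) c) F) :
    ConvergesTo z c fun x => F x / x ^ k := by
  intro x hx hxz
  have hx0 : x ≠ 0 := norm_pos_iff.1 hx
  have h1 := ((Equiv.addRight (k : ℤ)).hasSum_iff.2 (h x hx hxz)).mul_right (x ^ k)⁻¹
  refine hasSum_of_eq h1 (fun n => ?_) (div_eq_mul_inv _ _)
  simp only [Function.comp_apply, Equiv.coe_addRight, shiftAdd_zero_pow, zpow_add₀ hx0,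
    zpow_natCast]
  rw [show -(n + (k : ℤ)) - 1 + k = -n - 1 by ring]
  field_simp

/-- The bridge from analysis to algebra. Forward, the denominators are cleared and coefficients are
compared; backward, `(x + z) ^ l` and `x ^ k` are divided out again. -/
theorem convergesTo_iff {z : ℂ} (hz : z ≠ 0) {c : ℤ → ℂ} (hc : EvZero atTop c) (k l : ℕ)
    (g : Polynomial ℂ) :
    ConvergesTo z c (fun x => g.eval x / (x ^ k * (x + z) ^ l)) ↔
      (shiftAdd 0 ^ k) ((shiftAdd z ^ l) c) = polySeq g := by
  constructor
  · intro h
    refine ConvergesTo.unique hz (F := fun x => g.eval x) (fun x hx hxz => ?_)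
      (convergesTo_polySeq z g) ?_ ?_
    · have hx0 : x ≠ 0 := norm_pos_iff.1 hx
      have hne : x + z ≠ 0 := by
        intro h0
        rw [eq_neg_of_add_eq_zero_left h0, norm_neg] at hxz
        exact lt_irrefl _ hxz
      have := (h.shiftAdd_pow z l).shiftAdd_pow 0 k x hx hxz
      refine hasSum_of_eq this (fun _ => rfl) ?_
      simp only [add_zero]
      field_simp
    · exact (hc.shiftAdd_pow tendsto_add_atTop z l).shiftAdd_pow tendsto_add_atTop 0 k
    · filter_upwards [eventually_ge_atTop 0] with n hn
      rw [polySeq, if_neg (by omega)]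
  · intro h
    have h1 : ConvergesTo z ((shiftAdd 0 ^ k) ((shiftAdd z ^ l) c)) fun x => g.eval x := by
      rw [h]; exact convergesTo_polySeq z g
    have h2 := h1.of_shiftAdd_zero_pow.of_shiftAdd_pow hz hc
    simpa only [div_div] using h2

end Convergence

/-! ### The algebraic criterion for `Q(z)`-linear functionals. -/

section Membership

variable {V W : Type*} [AddCommGroup V] [Module ℂ V] [AddCommGroup W] [Module ℂ W]

/-- The transposes of the modes of `v`, applied to `α`. -/
def dualSeq (Y : FieldMap V W) (v : V) (α : Module.Dual ℂ W) (n : ℤ) : Module.Dual ℂ W :=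
  (Y v n).dualMap α

theorem dualSeq_apply (Y : FieldMap V W) (v : V) (α : Module.Dual ℂ W) (n : ℤ) (w : W) :
    dualSeq Y v α n w = α (Y v n w) := rfl

/-- Evaluation at `w`. -/
def evalAt (w : W) : Module.Dual ℂ W →ₗ[ℂ] ℂ := Module.Dual.eval ℂ W w

@[simp] theorem evalAt_apply (w : W) (α : Module.Dual ℂ W) : evalAt w α = α w := rfl

theorem dualSeq_evZero {Y : FieldMap V W} (hY : Truncation Y) (v : V) (w : W) :
    ∃ N : ℤ, ∀ (α : Module.Dual ℂ W) (n : ℤ), N ≤ n → dualSeq Y v α n w = 0 := by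
  obtain ⟨N, hN⟩ := hY v w
  exact ⟨N, fun α n hn => by rw [dualSeq_apply, hN n hn, map_zero]⟩

theorem shiftAdd_pow_dual (ζ : ℂ) (l : ℕ) (c : ℤ → Module.Dual ℂ W) (w : W) :
    (shiftAdd ζ ^ l) (fun n => c n w) = fun n => (shiftAdd ζ ^ l) c n w :=
  shiftAdd_pow_map ζ l (evalAt w) c

theorem polySeq_exists {p : ℤ → ℂ} {M : ℕ} (hp : ∀ n, 0 ≤ n → p n = 0)
    (hp' : ∀ n : ℤ, n < -M → p n = 0) : ∃ g : Polynomial ℂ, g.natDegree ≤ M ∧ p = polySeq g := by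
  have hc : ∀ j : ℕ, (∑ j ∈ Finset.range M, Polynomial.C (p (-j - 1)) * Polynomial.X ^ j).coeff j
      = p (-j - 1) := by
    intro j
    rw [Polynomial.finsetSum_coeff]
    simp only [Polynomial.coeff_C_mul, Polynomial.coeff_X_pow]
    by_cases hj : j < M
    · simp [hj]
    · simp [hj, hp' (-(j : ℤ) - 1) (by omega)]
  refine ⟨∑ j ∈ Finset.range M, Polynomial.C (p (-j - 1)) * Polynomial.X ^ j, ?_, ?_⟩
  · rw [Polynomial.natDegree_le_iff_coeff_eq_zero]
    intro j hj
    rw [hc, hp' _ (by omega)]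
  · funext n
    rw [polySeq]
    split_ifs with h
    · rw [hc, show -((-n - 1).toNat : ℤ) - 1 = n by omega]
    · exact hp n (by omega)

/-- The bound on the pole at infinity is uniform in `w`, which is what makes the modes vanish near
`-∞` as functionals and not merely on each `w`. The exponent of `x` may depend on `w`: it is
supplied by the truncation of `Y(v, x) w`. -/
theorem mem_DQ_iff {Y : FieldMap V W} (hY : Truncation Y) {z : ℂ} (hz : z ≠ 0)
    {α : Module.Dual ℂ W} :
    α ∈ DQ Y z ↔ ∀ v : V, ∃ l : ℕ, Regular z l (dualSeq Y v α) := by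
  have hev : ∀ v w, EvZero atTop fun n => dualSeq Y v α n w := fun v w => by
    obtain ⟨N, hN⟩ := dualSeq_evZero hY v w
    exact eventually_atTop.2 ⟨N, fun n hn => hN α n hn⟩
  change IsQLinear Y z α ↔ _
  refine forall_congr' fun v => ?_
  constructor
  · rintro ⟨l, m, h⟩
    -- The degree bound leaves in `(x + z) ^ l f` only powers of `x` up to `l + m`, and mode `n`
    -- belongs to the power `-n - 1`.
    refine ⟨l, eventually_atBot.2 ⟨-l - m - 2, fun n hn => LinearMap.ext fun w => ?_⟩⟩
    obtain ⟨k, g, hg, hs⟩ := h w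
    have hcv : ConvergesTo z (fun n => dualSeq Y v α n w)
        fun x => g.eval x / (x ^ k * (x + z) ^ l) := hs
    rw [convergesTo_iff hz (hev v w), shiftAdd_pow_dual] at hcv
    have := congrFun hcv (n - k)
    rw [shiftAdd_zero_pow, sub_add_cancel] at this
    rw [this, polySeq, if_pos (by omega), Polynomial.coeff_eq_zero_of_natDegree_lt (by omega)]
    rfl
  · rintro ⟨l, hl⟩
    obtain ⟨N, hN⟩ := eventually_atBot.1 hl
    refine ⟨l, (-N).toNat, fun w => ?_⟩
    have h1 : EvZero atTop fun n => (shiftAdd z ^ l) (dualSeq Y v α) n w := by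
      rw [← shiftAdd_pow_dual]
      exact (hev v w).shiftAdd_pow tendsto_add_atTop z l
    obtain ⟨T, hT⟩ := eventually_atTop.1 h1
    -- Paired with `w`, the series times `(x + z) ^ l` is bounded on both sides; the factor `x ^ T`
    -- turns it into a polynomial.
    obtain ⟨g, hg, he⟩ := polySeq_exists
      (p := fun n => (shiftAdd z ^ l) (dualSeq Y v α) (n + T.toNat) w)
      (M := T.toNat + l + (-N).toNat) (fun n hn => hT _ (by omega))
      (fun n hn => by rw [hN _ (by omega)]; rfl)
    refine ⟨T.toNat, g, hg, ?_⟩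
    refine (convergesTo_iff hz (hev v w) T.toNat l g).2 ?_
    rw [← he, shiftAdd_pow_dual]
    funext n
    rw [shiftAdd_zero_pow]

end Membership

/-! ### The expansion at `x = 0` through the residue theorem. -/

section ZeroExpansion

variable {W : Type*} [AddCommGroup W] [Module ℂ W]

/-! ### Expansion at `x = 0` -/

/-- Every functional in the family is locally bounded above. -/
def LocBounded (c : ℤ → Module.Dual ℂ W) : Prop := ∀ w, EvZero atTop fun n => c n w

/-- Modes in `x` of the difference of two expansions of a series in `y = x - z`. -/
def expDiff (z : ℂ) (e c : ℤ → Module.Dual ℂ W) (n : ℤ) (w : W) : ℂ :=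
  reexpand z e n w - reexpandZero z (fun k => c k w) n

/-- Modes in `x`, paired with `w`, of the expansion at `x = 0` of the function of `y = x - z`
represented by `c`. -/
def zeroVal (z : ℂ) (c : ℤ → Module.Dual ℂ W) (n : ℤ) (w : W) : ℂ :=
  expDiff z (inftyExp z c) c n w

theorem LocBounded.add {c d : ℤ → Module.Dual ℂ W} (hc : LocBounded c) (hd : LocBounded d) :
    LocBounded (c + d) := fun w => EvZero.add (hc w) (hd w)

theorem LocBounded.smul {c : ℤ → Module.Dual ℂ W} (hc : LocBounded c) (a : ℂ) :
    LocBounded (a • c) := fun w => EvZero.smul (fun _ => a) (hc w)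

theorem LocBounded.translate {c : ℤ → Module.Dual ℂ W} (hc : LocBounded c) (k : ℤ) :
    LocBounded fun n => c (n + k) := fun w => (tendsto_add_atTop k).eventually (hc w)

theorem reexpand_eval {z : ℂ} {e : ℤ → Module.Dual ℂ W} (he : EvZero atBot e) (n : ℤ) (w : W) :
    reexpand z e n w = reexpand z (fun k => e k w) n :=
  (congrFun (reexpand_map he (evalAt w)) n).symm

theorem expDiff_shift {z : ℂ} (hz : z ≠ 0) {e c : ℤ → Module.Dual ℂ W} (he : EvZero atBot e)
    (hc : LocBounded c) (n : ℤ) (w : W) :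
    expDiff z e c (n + 1) w = expDiff z (shiftAdd z e) (shiftAdd z c) n w := by
  rw [expDiff, reexpand_shift he, reexpandZero_shift hz (hc w)]
  rfl

theorem expDiff_shift_pow {z : ℂ} (hz : z ≠ 0) {e c : ℤ → Module.Dual ℂ W} (he : EvZero atBot e)
    (hc : LocBounded c) (l : ℕ) (n : ℤ) (w : W) :
    expDiff z e c (n + l) w = expDiff z ((shiftAdd z ^ l) e) ((shiftAdd z ^ l) c) n w := by
  induction l generalizing e c with
  | zero => simp
  | succ l ih =>
    have hc' : LocBounded (shiftAdd z c) := (hc.translate 1).add (hc.smul z)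
    rw [Nat.cast_succ, ← add_assoc, expDiff_shift hz he hc, ih (he.shiftAdd tendsto_add_atBot z) hc',
      shiftAdd_pow_succ', shiftAdd_pow_succ']

/-- The pole at `x = 0` has order at most `l`. Moving `l` factors `x = y + z` from the mode into the
series replaces `c` by `(y + z) ^ l c`, which paired with `w` is a finite series; for the remaining
nonnegative mode the residue on a large circle equals the residue at `y = 0`. -/
theorem zeroVal_eq_zero {z : ℂ} (hz : z ≠ 0) {c : ℤ → Module.Dual ℂ W} {l : ℕ}
    (hr : Regular z l c) (hc : LocBounded c) {n : ℤ} (hn : l ≤ n) (w : W) :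
    zeroVal z c n w = 0 := by
  obtain ⟨k, rfl⟩ := Int.le.dest hn
  have hP : EvZero atTop fun n => (shiftAdd z ^ l) c n w := by
    rw [← shiftAdd_pow_dual]
    exact (hc w).shiftAdd_pow tendsto_add_atTop z l
  rw [zeroVal, add_comm, expDiff_shift_pow hz hr.inftyExp.1 hc, hr.inftyExp.2, expDiff,
    reexpand_eval hr, sub_eq_zero]
  exact reexpand_eq_reexpandZero hz (EvZero.map hr (evalAt w)) hP k

theorem zeroVal_add {z : ℂ} {c d : ℤ → Module.Dual ℂ W} {l m : ℕ} (hc : Regular z l c)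
    (hd : Regular z m d) (hc' : LocBounded c) (hd' : LocBounded d) (n : ℤ) (w : W) :
    zeroVal z (c + d) n w = zeroVal z c n w + zeroVal z d n w := by
  rw [zeroVal, expDiff, inftyExp_add hc hd, reexpand_add hc.inftyExp.1 hd.inftyExp.1]
  have := congrFun (reexpandZero_add (z := z) (hc' w) (hd' w)) n
  have e : (fun k => (c + d) k w) = (fun k => c k w) + fun k => d k w := rfl
  rw [e, this]
  simp only [zeroVal, expDiff, Pi.add_apply, LinearMap.add_apply]
  ring

theorem zeroVal_smul {z : ℂ} {c : ℤ → Module.Dual ℂ W} {l : ℕ} (hc : Regular z l c) (a : ℂ)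
    (n : ℤ) (w : W) : zeroVal z (a • c) n w = a * zeroVal z c n w := by
  rw [zeroVal, expDiff, inftyExp_smul hc, reexpand_smul]
  have := congrFun (reexpandZero_smul (z := z) (c := fun k => c k w) a) n
  have e : (fun k => (a • c) k w) = a • fun k => c k w := rfl
  rw [e, this]
  simp only [zeroVal, expDiff, Pi.smul_apply, LinearMap.smul_apply, smul_eq_mul]
  ring

theorem zeroVal_zero (z : ℂ) (n : ℤ) (w : W) : zeroVal z (0 : ℤ → Module.Dual ℂ W) n w = 0 := by
  simpa using zeroVal_smul (z := z) (l := 0) Regular.zero (0 : ℂ) n w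
    (c := (0 : ℤ → Module.Dual ℂ W))

theorem zeroVal_sum {ι : Type*} {z : ℂ} {c : ι → ℤ → Module.Dual ℂ W} {l : ℕ} (s : Finset ι)
    (hc : ∀ i ∈ s, Regular z l (c i)) (hc' : ∀ i, LocBounded (c i)) (n : ℤ) (w : W) :
    LocBounded (∑ i ∈ s, c i) ∧
      zeroVal z (∑ i ∈ s, c i) n w = ∑ i ∈ s, zeroVal z (c i) n w := by
  classical
  induction s using Finset.induction_on with
  | empty => exact ⟨fun w => Eventually.of_forall fun _ => rfl, zeroVal_zero z n w⟩
  | insert a s ha ih =>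
    have hs := fun i hi => hc i (Finset.mem_insert_of_mem hi)
    rw [Finset.sum_insert ha, Finset.sum_insert ha, ← (ih hs).2]
    exact ⟨(hc' a).add (ih hs).1,
      zeroVal_add (hc a (by simp)) (Regular.sum s hs) (hc' a) (ih hs).1 n w⟩

theorem zeroVal_add_vec {z : ℂ} {c : ℤ → Module.Dual ℂ W} (hc : LocBounded c) (n : ℤ) (w w' : W) :
    zeroVal z c n (w + w') = zeroVal z c n w + zeroVal z c n w' := by
  have := congrFun (reexpandZero_add (z := z) (hc w) (hc w')) n
  have e : (fun k => c k (w + w')) = (fun k => c k w) + fun k => c k w' := by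
    funext k; simp
  rw [Pi.add_apply] at this
  rw [zeroVal, expDiff, e, this, map_add]
  simp only [zeroVal, expDiff]
  ring

theorem zeroVal_smul_vec {z : ℂ} {c : ℤ → Module.Dual ℂ W} (n : ℤ) (a : ℂ) (w : W) :
    zeroVal z c n (a • w) = a * zeroVal z c n w := by
  have := congrFun (reexpandZero_smul (z := z) (c := fun k => c k w) a) n
  have e : (fun k => c k (a • w)) = a • fun k => c k w := by
    funext k; simp
  rw [Pi.smul_apply] at this
  rw [zeroVal, expDiff, e, this, map_smul]
  simp only [zeroVal, expDiff, smul_eq_mul]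
  ring

/-- Translating the modes by one multiplies the function by `y = x - z`. -/
theorem zeroVal_translate {z : ℂ} (hz : z ≠ 0) {c : ℤ → Module.Dual ℂ W} {l : ℕ}
    (hr : Regular z l c) (hc : LocBounded c) (n : ℤ) (w : W) :
    zeroVal z (fun k => c (k + 1)) n w = zeroVal z c (n + 1) w - z * zeroVal z c n w := by
  have hi := hr.inftyExp.1
  have h1 : reexpand z (inftyExp z c) (n + 1)
      = reexpand z (fun k => inftyExp z c (k + 1)) n + z • reexpand z (inftyExp z c) n := by
    rw [reexpand_shift hi]
    have e : shiftAdd z (inftyExp z c) = (fun k => inftyExp z c (k + 1)) + z • inftyExp z c := rfl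
    rw [e, reexpand_add ((tendsto_add_atBot 1).eventually hi) (hi.const_smul z), reexpand_smul]
    rfl
  have h2 : reexpandZero z (fun k => c k w) (n + 1)
      = reexpandZero z (fun k => c (k + 1) w) n + z • reexpandZero z (fun k => c k w) n := by
    rw [reexpandZero_shift hz (hc w)]
    have e : shiftAdd z (fun k => c k w) = (fun k => c (k + 1) w) + z • fun k => c k w := rfl
    rw [e, reexpandZero_add (hc.translate 1 w) ((hc w).const_smul z), reexpandZero_smul]
    rfl
  rw [zeroVal, expDiff, inftyExp_translate hr, zeroVal, expDiff, zeroVal, expDiff, h1, h2]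
  simp only [LinearMap.add_apply, LinearMap.smul_apply, smul_eq_mul]
  ring

theorem zeroVal_comp {z : ℂ} {c : ℤ → Module.Dual ℂ W} {l : ℕ} (hr : Regular z l c)
    (T : Module.End ℂ W) (n : ℤ) (w : W) :
    zeroVal z (fun k => T.dualMap (c k)) n w = zeroVal z c n (T w) := by
  rw [zeroVal, expDiff, inftyExp_map hr T.dualMap, reexpand_map hr.inftyExp.1 T.dualMap]
  rfl

/-- The residue term is a combination of derivatives of the formal delta function at `x = z`, one
for each pole order at `y = 0`. Every factor `x - z = y` shifts `c` by one, so `q` of them kill it.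
-/
theorem shiftAdd_neg_pow_reexpandZero {z : ℂ} (hz : z ≠ 0) {c : ℤ → ℂ} {q : ℕ}
    (hq : ∀ n : ℤ, q ≤ n → c n = 0) : (shiftAdd (-z) ^ q) (reexpandZero z c) = 0 := by
  induction q generalizing c with
  | zero =>
    funext n
    change reexpandZero z c n = 0
    rw [reexpandZero, ← bsum_zero_fun (E := ℂ) n]
    exact bsum_congr fun i => by rw [hq _ (by omega), smul_zero]
  | succ q ih =>
    have hc : EvZero atTop c := eventually_atTop.2 ⟨_, hq⟩
    have : shiftAdd (-z) (reexpandZero z c) = reexpandZero z fun n => c (n + 1) := by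
      funext n
      have e : shiftAdd z c = (fun k => c (k + 1)) + z • c := rfl
      rw [shiftAdd_apply, reexpandZero_shift hz hc, e,
        reexpandZero_add ((tendsto_add_atTop 1).eventually hc) (hc.const_smul z),
        reexpandZero_smul]
      simp
    rw [shiftAdd_pow_succ', this]
    exact ih fun n hn => hq _ (by push_cast; omega)

/-- The expansions at `x = 0` and `x = ∞` agree after multiplication by a power of `x - z`. -/
theorem shiftAdd_neg_pow_zeroVal {z : ℂ} (hz : z ≠ 0) {c : ℤ → Module.Dual ℂ W} {q : ℕ} {w : W}
    (hq : ∀ n : ℤ, q ≤ n → c n w = 0) :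
    (shiftAdd (-z) ^ q) (fun n => zeroVal z c n w)
      = (shiftAdd (-z) ^ q) fun n => reexpand z (inftyExp z c) n w := by
  have e : (fun n => zeroVal z c n w) = (fun n => reexpand z (inftyExp z c) n w)
      - reexpandZero z fun k => c k w := rfl
  rw [e, map_sub, shiftAdd_neg_pow_reexpandZero hz hq, sub_zero]

/-- These are the correction terms of the commutator formula, as functions of `m`: up to the factor
`1 / i!` the multiplier is the `i`-th derivative of `y ^ m`. By Pascal's rule, one application of `S
+ z` in `m` either contributes a factor `y + z = x`, raising `n` by one, or lowers `i` by one. After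
`L` applications every mode lies at or beyond the pole order `l` at `x = 0`. -/
theorem shiftAdd_pow_choose_zeroVal {z : ℂ} (hz : z ≠ 0) {c : ℤ → Module.Dual ℂ W} {l : ℕ}
    (hr : Regular z l c) (hc : LocBounded c) (w : W) (L i : ℕ) (n : ℤ) (h : l + i ≤ n + L) :
    (shiftAdd z ^ L) (fun m : ℤ => ((Ring.choose m i : ℤ) : ℂ) *
      zeroVal z (fun k => c (k + (m - i))) n w) = 0 := by
  induction L generalizing i n with
  | zero =>
    funext m
    change ((Ring.choose m i : ℤ) : ℂ) * zeroVal z (fun k => c (k + (m - i))) n w = 0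
    rw [zeroVal_eq_zero hz (hr.translate _) (hc.translate _) (by push_cast at h; omega), mul_zero]
  | succ L ih =>
    rw [shiftAdd_pow_succ']
    have ht : ∀ (j n : ℤ), zeroVal z (fun k => c (k + (j + 1))) n w
        = zeroVal z (fun k => c (k + j)) (n + 1) w - z * zeroVal z (fun k => c (k + j)) n w := by
      intro j n
      rw [← zeroVal_translate hz (hr.translate j) (hc.translate j)]
      congr 1
      funext k
      congr 1
      ring
    rcases i with _ | i
    · have e : shiftAdd z (fun m : ℤ => ((Ring.choose m 0 : ℤ) : ℂ) *
          zeroVal z (fun k => c (k + (m - (0 : ℕ)))) n w)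
          = fun m : ℤ => ((Ring.choose m 0 : ℤ) : ℂ) *
          zeroVal z (fun k => c (k + (m - (0 : ℕ)))) (n + 1) w := by
        funext m
        simp only [shiftAdd_apply, Ring.choose_zero_right, Int.cast_one, one_mul, Nat.cast_zero,
          sub_zero, smul_eq_mul]
        rw [ht]; ring
      rw [e]
      exact ih 0 (n + 1) (by push_cast at h ⊢; omega)
    · have e : shiftAdd z (fun m : ℤ => ((Ring.choose m (i + 1) : ℤ) : ℂ) *
          zeroVal z (fun k => c (k + (m - (i + 1 : ℕ)))) n w)
          = (fun m : ℤ => ((Ring.choose m (i + 1) : ℤ) : ℂ) *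
          zeroVal z (fun k => c (k + (m - (i + 1 : ℕ)))) (n + 1) w) +
          fun m : ℤ => ((Ring.choose m i : ℤ) : ℂ) *
          zeroVal z (fun k => c (k + (m - i))) n w := by
        funext m
        have h1 := ht (m - (i + 1 : ℕ)) n
        have e1 : m - ((i + 1 : ℕ) : ℤ) + 1 = m - i := by push_cast; ring
        have e2 : m + 1 - ((i + 1 : ℕ) : ℤ) = m - i := by push_cast; ring
        simp only [e1] at h1
        simp only [shiftAdd_apply, Pi.add_apply, Ring.choose_succ_succ, e2, h1, smul_eq_mul]
        push_cast
        ring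
      rw [e, map_add, ih (i + 1) (n + 1) (by push_cast at h ⊢; omega),
        ih i n (by push_cast at h ⊢; omega), add_zero]

end ZeroExpansion

/-! ### The Jacobi identity for fields, expressed through double sequences. -/

section Operators

variable {V M : Type*} [AddCommGroup V] [Module ℂ V] [AddCommGroup M] [Module ℂ M]

theorem jacobi_iff {Yv : FieldMap V V} {G : FieldMap V M} :
    Jacobi Yv G ↔ ∀ (u v : V) (w : M), IsJacobi (fun m n => G u m (G v n w))
      (fun m n => G v n (G u m w)) (fun j n => G (Yv u j v) n w) := by
  have e1 : ∀ (u v : V) (w : M) (l m n : ℤ), jacP l (fun m n => G u m (G v n w)) m n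
      = ∑ᶠ i : ℕ, ((-1 : ℂ) ^ i * (Ring.choose l i : ℤ)) • G u (l + m - i) (G v (n + i) w) := by
    intro u v w l m n
    simp only [jacP, bsum, smul_smul, mul_comm]
  have e2 : ∀ (u v : V) (w : M) (l m n : ℤ), jacQ l (fun m n => G v n (G u m w)) m n
      = ∑ᶠ i : ℕ, ((-1 : ℂ) ^ l * (-1 : ℂ) ^ i * (Ring.choose l i : ℤ)) •
          G v (l + n - i) (G u (m + i) w) := by
    intro u v w l m n
    simp only [jacQ, jacP, bsum, smul_finsum, smul_smul]
    exact finsum_congr fun i => by rw [mul_comm ((Ring.choose l i : ℤ) : ℂ), mul_assoc]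
  simp only [Jacobi, IsJacobi, e1, e2]
  rfl

theorem IsJacobi.map {E E' : Type*} [AddCommGroup E] [Module ℂ E] [AddCommGroup E'] [Module ℂ E']
    {P Q R : ℤ → ℤ → E} (h : IsJacobi P Q R) (hP : AntiFin P) (hQ : AntiFin fun n m => Q m n)
    (hR : EvZero atTop R) (φ : E →ₗ[ℂ] E') :
    IsJacobi (fun m n => φ (P m n)) (fun m n => φ (Q m n)) (fun j n => φ (R j n)) := by
  intro l m n
  have h1 := congrArg φ (h l m n)
  have hR' : EvZero atTop fun i : ℕ => R (l + i) (m + n - i) :=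
    (hR.nat_cast l).mono fun i hi => congrFun hi _
  rw [map_sub, jacP, map_bsum (hP.jacP_fin l m n), jacQ, map_smul, jacP,
    map_bsum (hQ.jacP_fin l n m), jacR, map_bsum hR'] at h1
  simp only [map_smul] at h1
  exact h1

theorem truncation_topTrunc {G H : FieldMap V M} (hG : Truncation G) (hH : Truncation H) (u v : V)
    (w : M) : TopTrunc fun m n => G u m (H v n w) := by
  obtain ⟨N, hN⟩ := hH v w
  constructor
  · filter_upwards [eventually_ge_atTop N] with n hn
    funext m
    simp [hN n hn]
  · intro n
    obtain ⟨N', hN'⟩ := hG u (H v n w)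
    exact eventually_atTop.2 ⟨N', hN'⟩

theorem truncation_evZero {Yv : FieldMap V V} (hYv : Truncation Yv) (u v : V) :
    EvZero atTop fun j => Yv u j v := by
  obtain ⟨N, hN⟩ := hYv u v
  exact eventually_atTop.2 ⟨N, hN⟩

theorem truncation_evZero_iterate {Yv : FieldMap V V} (hYv : Truncation Yv) (G : FieldMap V M)
    (u v : V) (w : M) : EvZero atTop fun j n => G (Yv u j v) n w := by
  filter_upwards [truncation_evZero hYv u v] with j hj
  funext n
  simp [hj]

/-- The commutator formula. -/
theorem Jacobi.commutator {Yv : FieldMap V V} {G : FieldMap V M} (hJ : Jacobi Yv G) (u v : V)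
    (w : M) (m n : ℤ) :
    G u m (G v n w) = G v n (G u m w) + bsum m fun i => G (Yv u i v) (m + n - i) w := by
  have := jacobi_iff.1 hJ u v w 0 m n
  rw [jacP_zero, jacQ_zero, jacR, sub_eq_iff_eq_add, add_comm] at this
  simpa using this

end Operators

/-- A vertex-algebraic setting for the `Q(z)`-linear functionals. -/
structure QSetting {V W : Type*} [AddCommGroup V] [Module ℂ V] [AddCommGroup W] [Module ℂ W]
    (Yv : FieldMap V V) (Y : FieldMap V W) (z : ℂ) : Prop where
  truncV : Truncation Yv
  truncW : Truncation Y
  jacobi : Jacobi Yv Y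
  ne_zero : z ≠ 0

/-! ### The left and right modes on `DQ Y z`, and their commutation. -/

namespace QSetting

variable {V W : Type*} [AddCommGroup V] [Module ℂ V] [AddCommGroup W] [Module ℂ W]
  {Yv : FieldMap V V} {Y : FieldMap V W} {z : ℂ} (S : QSetting Yv Y z)
include S

theorem locBounded (v : V) (α : Module.Dual ℂ W) : LocBounded (dualSeq Y v α) := fun w => by
  obtain ⟨N, hN⟩ := dualSeq_evZero S.truncW v w
  exact eventually_atTop.2 ⟨N, fun n hn => hN α n hn⟩

theorem mem_iff {α : Module.Dual ℂ W} :
    α ∈ DQ Y z ↔ ∀ v : V, ∃ l : ℕ, Regular z l (dualSeq Y v α) :=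
  mem_DQ_iff S.truncW S.ne_zero

/-- The transposed commutator formula. The number of correction terms depends on `u` and `v` alone,
which gives bounds uniform in `m` and `α`. -/
theorem dualSeq_dualMap (u v : V) : ∃ I : ℕ, ∀ (α : Module.Dual ℂ W) (m : ℤ),
    dualSeq Y v ((Y u m).dualMap α) = (fun n => (Y u m).dualMap (dualSeq Y v α n))
      + ∑ i ∈ Finset.range I, ((Ring.choose m i : ℤ) : ℂ) •
        fun n => dualSeq Y (Yv u i v) α (n + (m - i)) := by
  obtain ⟨I, hI⟩ := eventually_atTop.1 ((truncation_evZero S.truncV u v).nat_cast 0)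
  refine ⟨I, fun α m => funext fun n => LinearMap.ext fun w => ?_⟩
  have hz : ∀ i : ℕ, I ≤ i → Y (Yv u i v) (m + n - i) w = 0 := fun i hi => by
    have : Yv u (0 + i) v = 0 := hI i hi
    rw [zero_add] at this
    simp [this]
  have h := congrArg α (S.jacobi.commutator u v w m n)
  rw [map_add, map_bsum (eventually_atTop.2 ⟨I, hz⟩),
    bsum_eq_sum (I := I) fun i hi => by rw [hz i hi, map_zero]] at h
  change α (Y u m (Y v n w)) = _
  rw [h]
  simp only [Pi.add_apply, LinearMap.add_apply, Finset.sum_apply, LinearMap.sum_apply,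
    Pi.smul_apply, LinearMap.smul_apply, dualSeq_apply, LinearMap.dualMap_apply]
  congr 1
  refine Finset.sum_congr rfl fun i _ => ?_
  rw [show m + n - (i : ℤ) = n + (m - i) by ring]

/-- One exponent must serve all `m`, because in the transfer of the Jacobi identity a single power
of `x₂ + z` multiplies the whole double series. -/
theorem regular_dualMap {α : Module.Dual ℂ W} (hα : α ∈ DQ Y z) (u v : V) :
    ∃ l : ℕ, ∀ m : ℤ, Regular z l (dualSeq Y v ((Y u m).dualMap α)) := by
  obtain ⟨I, hI⟩ := S.dualSeq_dualMap u v
  choose f hf using S.mem_iff.1 hα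
  refine ⟨f v + ∑ i ∈ Finset.range I, f (Yv u i v), fun m => ?_⟩
  rw [hI]
  refine Regular.add' (((hf v).map _).mono (Nat.le_add_right _ _)) (Regular.sum _ fun i hi => ?_)
  refine (((hf _).translate (m - i)).smul _).mono (le_trans ?_ (Nat.le_add_left _ _))
  exact Finset.single_le_sum (f := fun i : ℕ => f (Yv u i v)) (fun _ _ => Nat.zero_le _) hi

theorem dualMap_mem {α : Module.Dual ℂ W} (hα : α ∈ DQ Y z) (u : V) (m : ℤ) :
    (Y u m).dualMap α ∈ DQ Y z :=
  S.mem_iff.2 fun v => by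
    obtain ⟨l, hl⟩ := S.regular_dualMap hα u v
    exact ⟨l, hl m⟩

/-- The transposed modes on the space of `Q(z)`-linear functionals, as a sequence. -/
def seq (v : V) : DQ Y z →ₗ[ℂ] (ℤ → DQ Y z) :=
  LinearMap.pi fun n => ((Y v n).dualMap).restrict fun _ hα => S.dualMap_mem hα v n

theorem coe_seq (v : V) (α : DQ Y z) (n : ℤ) :
    (S.seq v α n : Module.Dual ℂ W) = dualSeq Y v α n := rfl

theorem seq_apply_apply (v : V) (α : DQ Y z) (n : ℤ) (w : W) :
    (S.seq v α n : Module.Dual ℂ W) w = (α : Module.Dual ℂ W) (Y v n w) := rfl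

theorem regular_coe {l : ℕ} {c : ℤ → DQ Y z} :
    Regular z l (fun n => (c n : Module.Dual ℂ W)) ↔ Regular z l c := by
  have := shiftAdd_pow_map z l (DQ Y z).subtype c
  simp only [Submodule.subtype_apply] at this
  rw [Regular, this, Regular]
  exact eventually_congr (Eventually.of_forall fun n => by simp)

theorem exists_regular (v : V) (α : DQ Y z) : ∃ l : ℕ, Regular z l (S.seq v α) := by
  obtain ⟨l, hl⟩ := S.mem_iff.1 α.2 v
  exact ⟨l, S.regular_coe.1 hl⟩

theorem exists_regular_uniform (u v : V) (α : DQ Y z) :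
    ∃ l : ℕ, ∀ m : ℤ, Regular z l (S.seq v (S.seq u α m)) := by
  obtain ⟨l, hl⟩ := S.regular_dualMap α.2 u v
  exact ⟨l, fun m => S.regular_coe.1 (hl m)⟩

theorem seq_add (u v : V) (α : DQ Y z) : S.seq (u + v) α = S.seq u α + S.seq v α := by
  funext n
  refine Subtype.ext (LinearMap.ext fun w => ?_)
  simp [seq_apply_apply]

theorem seq_smul (c : ℂ) (v : V) (α : DQ Y z) : S.seq (c • v) α = c • S.seq v α := by
  funext n
  refine Subtype.ext (LinearMap.ext fun w => ?_)
  simp [seq_apply_apply]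

/-- The expansion at `y = ∞` of the function represented by `seq v α`. -/
def inftyField : FieldMap V (DQ Y z) where
  toFun v n :=
    { toFun := fun α => inftyExp z (S.seq v α) n
      map_add' := fun α β => by
        obtain ⟨l, hl⟩ := S.exists_regular v α
        obtain ⟨m, hm⟩ := S.exists_regular v β
        rw [map_add, inftyExp_add hl hm]; rfl
      map_smul' := fun c α => by
        obtain ⟨l, hl⟩ := S.exists_regular v α
        rw [map_smul, inftyExp_smul hl]; rfl }
  map_add' u v := by
    funext n
    refine LinearMap.ext fun α => ?_
    obtain ⟨l, hl⟩ := S.exists_regular u α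
    obtain ⟨m, hm⟩ := S.exists_regular v α
    change inftyExp z (S.seq (u + v) α) n = _
    rw [S.seq_add, inftyExp_add hl hm]; rfl
  map_smul' c v := by
    funext n
    refine LinearMap.ext fun α => ?_
    obtain ⟨l, hl⟩ := S.exists_regular v α
    change inftyExp z (S.seq (c • v) α) n = _
    rw [S.seq_smul, inftyExp_smul hl]; rfl

theorem inftyField_evZero (v : V) (α : DQ Y z) : EvZero atBot fun n => S.inftyField v n α := by
  obtain ⟨l, hl⟩ := S.exists_regular v α
  exact hl.inftyExp.1

theorem shiftAdd_pow_inftyField {l : ℕ} {v : V} {α : DQ Y z} (h : Regular z l (S.seq v α)) :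
    (shiftAdd z ^ l) (fun n => S.inftyField v n α) = (shiftAdd z ^ l) (S.seq v α) :=
  h.inftyExp.2

/-- The expansion at `x = ∞` of the function of `y = x - z` represented by `seq v α`. -/
def leftField : FieldMap V (DQ Y z) where
  toFun v n :=
    { toFun := fun α => reexpand z (fun k => S.inftyField v k α) n
      map_add' := fun α β => by
        rw [← Pi.add_apply, ← reexpand_add (S.inftyField_evZero v α) (S.inftyField_evZero v β)]
        congr 1
        funext k
        simp
      map_smul' := fun c α => by
        rw [RingHom.id_apply, ← Pi.smul_apply, ← reexpand_smul]
        congr 1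
        funext k
        simp }
  map_add' u v := by
    funext n
    refine LinearMap.ext fun α => ?_
    change reexpand z (fun k => S.inftyField (u + v) k α) n =
      reexpand z (fun k => S.inftyField u k α) n + reexpand z (fun k => S.inftyField v k α) n
    rw [← Pi.add_apply, ← reexpand_add (S.inftyField_evZero u α) (S.inftyField_evZero v α)]
    congr 1
    funext k
    simp
  map_smul' c v := by
    funext n
    refine LinearMap.ext fun α => ?_
    change reexpand z (fun k => S.inftyField (c • v) k α) n =
      c • reexpand z (fun k => S.inftyField v k α) n
    rw [← Pi.smul_apply, ← reexpand_smul]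
    congr 1
    funext k
    simp

theorem leftField_apply (v : V) (n : ℤ) (α : DQ Y z) :
    S.leftField v n α = reexpand z (fun n => S.inftyField v n α) n := rfl

theorem leftField_evZero (v : V) (α : DQ Y z) : EvZero atBot fun n => S.leftField v n α :=
  reexpand_evZero (S.inftyField_evZero v α)

theorem coe_leftField (v : V) (α : DQ Y z) (n : ℤ) :
    (S.leftField v n α : Module.Dual ℂ W) = reexpand z (inftyExp z (dualSeq Y v α)) n := by
  obtain ⟨l, hl⟩ := S.exists_regular v α
  have h1 := reexpand_map (z := z) (S.inftyField_evZero v α) (DQ Y z).subtype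
  have h2 := inftyExp_map hl (DQ Y z).subtype
  simp only [Submodule.subtype_apply, coe_seq] at h1 h2
  rw [S.leftField_apply, ← congrFun h1 n]
  congr 1
  exact h2.symm

/-- The expansion at `x = 0`, as a functional. -/
def rightVal (v : V) (n : ℤ) : DQ Y z →ₗ[ℂ] Module.Dual ℂ W where
  toFun α :=
    { toFun := fun w => zeroVal z (dualSeq Y v α) n w
      map_add' := fun w w' => zeroVal_add_vec (S.locBounded v α) n w w'
      map_smul' := fun a w => zeroVal_smul_vec n a w }
  map_add' α β := by
    obtain ⟨l, hl⟩ := S.mem_iff.1 α.2 v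
    obtain ⟨m, hm⟩ := S.mem_iff.1 β.2 v
    refine LinearMap.ext fun w => ?_
    have e : dualSeq Y v ((α + β : DQ Y z) : Module.Dual ℂ W)
      = dualSeq Y v (α : Module.Dual ℂ W) + dualSeq Y v (β : Module.Dual ℂ W) := by
      funext n; simp [dualSeq]
    change zeroVal z (dualSeq Y v ((α + β : DQ Y z) : Module.Dual ℂ W)) n w = _
    rw [e, zeroVal_add hl hm (S.locBounded v α) (S.locBounded v β)]
    rfl
  map_smul' c α := by
    obtain ⟨l, hl⟩ := S.mem_iff.1 α.2 v
    refine LinearMap.ext fun w => ?_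
    have e : dualSeq Y v ((c • α : DQ Y z) : Module.Dual ℂ W)
      = c • dualSeq Y v (α : Module.Dual ℂ W) := by
      funext n; simp [dualSeq]
    change zeroVal z (dualSeq Y v ((c • α : DQ Y z) : Module.Dual ℂ W)) n w = _
    rw [e, zeroVal_smul hl]
    rfl

theorem rightVal_apply (v : V) (n : ℤ) (α : DQ Y z) (w : W) :
    S.rightVal v n α w = zeroVal z (dualSeq Y v α) n w := rfl

/-- This is the step that makes the right action possible. The values are taken in the full dual,
since it is from this lemma that their membership in `DQ Y z` will follow. -/
theorem shiftAdd_pow_rightVal_commutator (u v : V) (n : ℤ) (α : DQ Y z) : ∃ L : ℕ,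
    (shiftAdd z ^ L) (fun m => S.rightVal v n (S.seq u α m))
      = (shiftAdd z ^ L) (dualSeq Y u (S.rightVal v n α)) := by
  obtain ⟨I, hI⟩ := S.dualSeq_dualMap u v
  choose f hf using S.mem_iff.1 α.2
  -- Forming `zeroVal` is linear in the series and natural in `w`, so the transposed commutator
  -- formula passes through it term by term.
  have key : ∀ m w, S.rightVal v n (S.seq u α m) w = dualSeq Y u (S.rightVal v n α) m w
      + ∑ i ∈ Finset.range I, ((Ring.choose m i : ℤ) : ℂ) *
        zeroVal z (fun k => dualSeq Y (Yv u i v) α (k + (m - i))) n w := by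
    intro m w
    let l := ∑ i ∈ Finset.range I, f (Yv u i v)
    have hr : ∀ i ∈ Finset.range I, Regular z l (((Ring.choose m i : ℤ) : ℂ) •
        fun n => dualSeq Y (Yv u i v) (α : Module.Dual ℂ W) (n + (m - i))) := fun i hi =>
      (((hf _).translate (m - i)).smul _).mono
        (Finset.single_le_sum (f := fun i : ℕ => f (Yv u i v)) (fun _ _ => Nat.zero_le _) hi)
    have hs := zeroVal_sum (z := z) (Finset.range I) hr
      (fun i => ((S.locBounded _ _).translate _).smul _) n w
    rw [rightVal_apply, show ((S.seq u α m : DQ Y z) : Module.Dual ℂ W) = (Y u m).dualMap α from rfl,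
      hI, zeroVal_add ((hf v).map _) (Regular.sum _ hr) (fun w => S.locBounded v α (Y u m w)) hs.1,
      zeroVal_comp (hf v), hs.2]
    congr 1
    refine Finset.sum_congr rfl fun i _ => ?_
    rw [zeroVal_smul ((hf _).translate _)]
  -- `L` makes up for a negative `n` and dominates pole order plus derivative order for every
  -- correction term.
  obtain ⟨L, hL⟩ : ∃ L : ℕ, ∀ i ∈ Finset.range I, (f (Yv u i v) : ℤ) + i ≤ n + L := by
    refine ⟨(-n).toNat + ∑ i ∈ Finset.range I, (f (Yv u i v) + i), fun i hi => ?_⟩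
    have := Finset.single_le_sum (f := fun i : ℕ => f (Yv u i v) + i) (fun _ _ => Nat.zero_le _) hi
    have h2 := Int.self_le_toNat (-n)
    have h3 : ((f (Yv u i v) + i : ℕ) : ℤ) ≤ ((∑ i ∈ Finset.range I, (f (Yv u i v) + i) : ℕ) : ℤ) :=
      by exact_mod_cast this
    push_cast at h3 ⊢
    omega
  refine ⟨L, ?_⟩
  funext m
  refine LinearMap.ext fun w => ?_
  rw [← sub_eq_zero, ← LinearMap.sub_apply, ← Pi.sub_apply, ← map_sub,
    show ∀ c : ℤ → Module.Dual ℂ W, (shiftAdd z ^ L) c m w = (shiftAdd z ^ L) (fun n => c n w) m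
      from fun c => (congrFun (shiftAdd_pow_dual z L c w) m).symm]
  have e : (fun m => ((fun m => S.rightVal v n (S.seq u α m)) - dualSeq Y u (S.rightVal v n α)) m w)
      = ∑ i ∈ Finset.range I, fun m => ((Ring.choose m i : ℤ) : ℂ) *
        zeroVal z (fun k => dualSeq Y (Yv u i v) α (k + (m - i))) n w := by
    funext m
    rw [Finset.sum_apply, Pi.sub_apply, LinearMap.sub_apply, key, add_sub_cancel_left]
  rw [e, map_sum, Finset.sum_eq_zero]
  · rfl
  · intro i hi
    exact shiftAdd_pow_choose_zeroVal S.ne_zero (hf _) (S.locBounded _ _) w L i n (hL i hi)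

/-- After multiplication by a power of `y + z`, the series to be tested is the image under one fixed
linear map of the series of `α`, which is regular. -/
theorem rightVal_mem (v : V) (n : ℤ) (α : DQ Y z) : S.rightVal v n α ∈ DQ Y z := by
  refine S.mem_iff.2 fun u => ?_
  obtain ⟨L, hL⟩ := S.shiftAdd_pow_rightVal_commutator u v n α
  obtain ⟨l, hl⟩ := S.exists_regular u α
  have h1 : Regular z l fun m => S.rightVal v n (S.seq u α m) := hl.map (S.rightVal v n)
  refine ⟨max l L, ?_⟩
  rw [Regular, ← shiftAdd_pow_eq_of_le (le_max_right l L) hL]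
  exact h1.mono (le_max_left l L)

/-- The expansion at `x = 0` of the function of `y = x - z` represented by `seq v α`. -/
def rightField : FieldMap V (DQ Y z) where
  toFun v n := (S.rightVal v n).codRestrict (DQ Y z) (S.rightVal_mem v n)
  map_add' u v := by
    funext n
    refine LinearMap.ext fun α => Subtype.ext (LinearMap.ext fun w => ?_)
    obtain ⟨l, hl⟩ := S.mem_iff.1 α.2 u
    obtain ⟨m, hm⟩ := S.mem_iff.1 α.2 v
    have e : dualSeq Y (u + v) (α : Module.Dual ℂ W)
      = dualSeq Y u (α : Module.Dual ℂ W) + dualSeq Y v (α : Module.Dual ℂ W) := by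
      funext n; refine LinearMap.ext fun w => ?_; simp [dualSeq]
    change zeroVal z (dualSeq Y (u + v) (α : Module.Dual ℂ W)) n w = _
    rw [e, zeroVal_add hl hm (S.locBounded u α) (S.locBounded v α)]
    rfl
  map_smul' c v := by
    funext n
    refine LinearMap.ext fun α => Subtype.ext (LinearMap.ext fun w => ?_)
    obtain ⟨l, hl⟩ := S.mem_iff.1 α.2 v
    have e : dualSeq Y (c • v) (α : Module.Dual ℂ W) = c • dualSeq Y v (α : Module.Dual ℂ W) := by
      funext n; refine LinearMap.ext fun w => ?_; simp [dualSeq]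
    change zeroVal z (dualSeq Y (c • v) (α : Module.Dual ℂ W)) n w = _
    rw [e, zeroVal_smul hl]
    rfl

theorem rightField_apply_apply (v : V) (n : ℤ) (α : DQ Y z) (w : W) :
    (S.rightField v n α : Module.Dual ℂ W) w = zeroVal z (dualSeq Y v α) n w := rfl

theorem rightField_truncation : Truncation S.rightField := by
  intro v α
  obtain ⟨l, hl⟩ := S.mem_iff.1 α.2 v
  exact ⟨l, fun n hn => Subtype.ext (LinearMap.ext fun w =>
    zeroVal_eq_zero S.ne_zero hl (S.locBounded v α) hn w)⟩

theorem shiftAdd_pow_commutator (u v : V) (n : ℤ) (α : DQ Y z) : ∃ L : ℕ,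
    (shiftAdd z ^ L) (fun m => S.rightField v n (S.seq u α m))
      = (shiftAdd z ^ L) (S.seq u (S.rightField v n α)) := by
  obtain ⟨L, hL⟩ := S.shiftAdd_pow_rightVal_commutator u v n α
  refine ⟨L, funext fun m => Subtype.ext ?_⟩
  have h1 := congrFun (shiftAdd_pow_map z L (DQ Y z).subtype
    (fun m => S.rightField v n (S.seq u α m))) m
  have h2 := congrFun (shiftAdd_pow_map z L (DQ Y z).subtype (S.seq u (S.rightField v n α))) m
  simp only [Submodule.subtype_apply] at h1 h2
  rw [← h1, ← h2]
  exact congrFun hL m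

/-- Applying the fixed operator `rightField v n` to the expansion at infinity of `seq u α` gives a
series with finitely many positive powers. It represents `seq u (rightField v n α)` up to a power of
`y + z`, so it is the expansion at infinity of the latter. -/
theorem inftyField_comm_rightField (u v : V) (m n : ℤ) (α : DQ Y z) :
    S.inftyField u m (S.rightField v n α) = S.rightField v n (S.inftyField u m α) := by
  obtain ⟨L, hL⟩ := S.shiftAdd_pow_commutator u v n α
  obtain ⟨l, hl⟩ := S.exists_regular u α
  have : inftyExp z (S.seq u (S.rightField v n α))
      = fun m => S.rightField v n (S.inftyField u m α) := by
    refine inftyExp_eq (l := max l L) ((S.inftyField_evZero u α).map (S.rightField v n)) ?_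
    rw [← shiftAdd_pow_eq_of_le (le_max_right l L) hL, shiftAdd_pow_map,
      shiftAdd_pow_map (s := S.seq u α), S.shiftAdd_pow_inftyField (hl.mono (le_max_left l L))]
  exact congrFun this m

theorem leftField_comm_rightField (u v : V) (m n : ℤ) (α : DQ Y z) :
    S.leftField u m (S.rightField v n α) = S.rightField v n (S.leftField u m α) := by
  rw [leftField_apply, leftField_apply,
    ← congrFun (reexpand_map (S.inftyField_evZero u α) (S.rightField v n)) m]
  congr 1
  funext k
  exact S.inftyField_comm_rightField u v k n α

end QSetting

/-! ### Comparison of double sequences, and Jacobi identities in reversed order. -/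

section

variable {E E' : Type*} [AddCommGroup E] [Module ℂ E] [AddCommGroup E'] [Module ℂ E']

/-- Used with evaluations at vectors: the comparison exponents may depend on the vector, so the
transfer has to be made after pairing. -/
theorem IsJacobi.of_map {ι : Type*} {P Q R : ℤ → ℤ → E} (hP : AntiFin P)
    (hQ : AntiFin fun n m => Q m n) (hR : EvZero atTop R) (φ : ι → E →ₗ[ℂ] E')
    (hφ : ∀ x, (∀ i, φ i x = 0) → x = 0)
    (h : ∀ i, IsJacobi (fun m n => φ i (P m n)) (fun m n => φ i (Q m n))
      (fun j n => φ i (R j n))) : IsJacobi P Q R := by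
  intro l m n
  have hR' : EvZero atTop fun i : ℕ => R (l + i) (m + n - i) :=
    (hR.nat_cast l).mono fun i hi => congrFun hi _
  rw [← sub_eq_zero]
  refine hφ _ fun i => ?_
  rw [map_sub, map_sub, sub_eq_zero, jacP, map_bsum (hP.jacP_fin l m n), jacQ, map_smul, jacP,
    map_bsum (hQ.jacP_fin l n m), jacR, map_bsum hR']
  simp only [map_smul]
  exact h i l m n

theorem shiftAdd_pow_pow_map (ζ : ℂ) (p r : ℕ) (φ : E →ₗ[ℂ] E') (P : ℤ → ℤ → E) (m n : ℤ) :
    (shiftAdd ζ ^ p) ((shiftAdd₂ ζ ^ r) fun m n => φ (P m n)) m n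
      = φ ((shiftAdd ζ ^ p) ((shiftAdd₂ ζ ^ r) P) m n) := by
  have e : (fun m => (shiftAdd₂ ζ ^ r) (fun m n => φ (P m n)) m n)
      = fun m => φ ((shiftAdd₂ ζ ^ r) P m n) := by
    funext m
    rw [shiftAdd₂_pow_apply, shiftAdd₂_pow_apply, shiftAdd_pow_map]
  rw [shiftAdd_pow_apply₂, shiftAdd_pow_apply₂, e, shiftAdd_pow_map]

theorem shiftAdd_pow_pow_comm (ζ : ℂ) (p r : ℕ) (P : ℤ → ℤ → E) :
    (shiftAdd ζ ^ p) ((shiftAdd₂ ζ ^ r) P) = (shiftAdd₂ ζ ^ r) ((shiftAdd ζ ^ p) P) :=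
  (LinearMap.congr_fun ((shiftAdd₂_commute ζ).pow_pow r p).eq P).symm

/-- Comparison of double sequences one variable at a time. -/
theorem shiftAdd_pow_pow_eq {ζ : ℂ} {p r : ℕ} {P P₁ P₂ : ℤ → ℤ → E}
    (h₁ : ∀ n, (shiftAdd ζ ^ p) (fun m => P m n) = (shiftAdd ζ ^ p) fun m => P₁ m n)
    (h₂ : ∀ m, (shiftAdd ζ ^ r) (P₁ m) = (shiftAdd ζ ^ r) (P₂ m)) :
    (shiftAdd ζ ^ p) ((shiftAdd₂ ζ ^ r) P) = (shiftAdd ζ ^ p) ((shiftAdd₂ ζ ^ r) P₂) := by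
  have e1 : (shiftAdd ζ ^ p) P = (shiftAdd ζ ^ p) P₁ := by
    funext m n
    rw [shiftAdd_pow_apply₂, shiftAdd_pow_apply₂, h₁]
  have e2 : (shiftAdd₂ ζ ^ r) P₁ = (shiftAdd₂ ζ ^ r) P₂ := by
    funext m
    rw [shiftAdd₂_pow_apply, shiftAdd₂_pow_apply, h₂]
  rw [shiftAdd_pow_pow_comm, e1, ← shiftAdd_pow_pow_comm, e2]

theorem shiftAdd_pow_pow_eq' {ζ : ℂ} {p r : ℕ} {P P₁ P₂ : ℤ → ℤ → E}
    (h₂ : ∀ m, (shiftAdd ζ ^ r) (P m) = (shiftAdd ζ ^ r) (P₁ m))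
    (h₁ : ∀ n, (shiftAdd ζ ^ p) (fun m => P₁ m n) = (shiftAdd ζ ^ p) fun m => P₂ m n) :
    (shiftAdd ζ ^ p) ((shiftAdd₂ ζ ^ r) P) = (shiftAdd ζ ^ p) ((shiftAdd₂ ζ ^ r) P₂) := by
  have e1 : (shiftAdd ζ ^ p) P₁ = (shiftAdd ζ ^ p) P₂ := by
    funext m n
    rw [shiftAdd_pow_apply₂, shiftAdd_pow_apply₂, h₁]
  have e2 : (shiftAdd₂ ζ ^ r) P = (shiftAdd₂ ζ ^ r) P₁ := by
    funext m
    rw [shiftAdd₂_pow_apply, shiftAdd₂_pow_apply, h₂]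
  rw [e2, shiftAdd_pow_pow_comm, e1, ← shiftAdd_pow_pow_comm]

variable {V M : Type*} [AddCommGroup V] [Module ℂ V] [AddCommGroup M] [Module ℂ M]

/-- `A(v, x) a` involves finitely many positive powers of `x`. -/
def OppTruncation (A : FieldMap V M) : Prop := ∀ v a, EvZero atBot fun n => A v n a

/-- The Jacobi identity with the order of the operators reversed. -/
def OppJacobi (Yv : FieldMap V V) (A : FieldMap V M) : Prop :=
  ∀ (u v : V) (a : M), IsJacobi (fun m n => A v n (A u m a)) (fun m n => A u m (A v n a))
    (fun j n => A (Yv u j v) n a)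

theorem OppTruncation.botTrunc {A : FieldMap V M} (hA : OppTruncation A) (u v : V) (a : M) :
    BotTrunc fun m n => A v n (A u m a) := by
  refine ⟨?_, fun m => hA v (A u m a)⟩
  filter_upwards [hA u a] with m hm
  funext n
  simp [hm]

end

/-! ### Jacobi identities for the left and the right modes. -/

namespace QSetting

variable {V W : Type*} [AddCommGroup V] [Module ℂ V] [AddCommGroup W] [Module ℂ W]
  {Yv : FieldMap V V} {Y : FieldMap V W} {z : ℂ} (S : QSetting Yv Y z)
include S

theorem inftyField_oppTruncation : OppTruncation S.inftyField := S.inftyField_evZero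

theorem leftField_oppTruncation : OppTruncation S.leftField := S.leftField_evZero

theorem bound_iterate (f : V → ℕ) (u v : V) (l : ℤ) :
    ∃ r : ℕ, ∀ j, l ≤ j → f (Yv u j v) ≤ r := by
  obtain ⟨I, hI⟩ := eventually_atTop.1 ((truncation_evZero S.truncV u v).nat_cast l)
  refine ⟨f 0 + ∑ i ∈ Finset.range I, f (Yv u (l + i) v), fun j hj => ?_⟩
  obtain ⟨i, rfl⟩ := Int.le.dest hj
  by_cases hi : i < I
  · exact (Finset.single_le_sum (f := fun i : ℕ => f (Yv u (l + i) v)) (fun _ _ => Nat.zero_le _)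
      (Finset.mem_range.2 hi)).trans (Nat.le_add_left _ _)
  · have : Yv u (l + i) v = 0 := hI i (not_lt.1 hi)
    rw [this]
    exact Nat.le_add_right _ _

/-- Applying `α` to the Jacobi identity on `W` gives the reversed identity for transposed modes.
Expansions at infinity agree with these after multiplication by powers of `x₁ + z` and `x₂ + z`, so
the transfer applies along `atBot`. -/
theorem inftyField_oppJacobi : OppJacobi Yv S.inftyField := by
  intro u v α
  have hA := S.inftyField_oppTruncation
  have hR := truncation_evZero_iterate S.truncV S.inftyField u v α
  refine IsJacobi.of_map (hA.botTrunc u v α).antiFin (hA.botTrunc v u α).antiFin hR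
    (fun w : W => (evalAt w).comp (DQ Y z).subtype)
    (fun x hx => Subtype.ext (LinearMap.ext fun w => hx w)) fun w => ?_
  have hW := truncation_topTrunc S.truncW S.truncW
  have hJ := (jacobi_iff.1 S.jacobi u v w).map (hW u v w).antiFin (hW v u w).antiFin
    (truncation_evZero_iterate S.truncV Y u v w) (α : Module.Dual ℂ W)
  choose f hf using fun v => S.exists_regular v α
  obtain ⟨l₁, hl₁⟩ := S.exists_regular_uniform u v α
  obtain ⟨l₂, hl₂⟩ := S.exists_regular_uniform v u α
  refine hJ.transfer_atBot (ζ := z) ?_ ?_ ?_ ?_ ?_ ?_ ?_ fun l => ?_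
  · exact fun m n => ((hW u v w).antiFin m n).map (α : Module.Dual ℂ W)
  · exact fun m n => ((hW v u w).antiFin m n).map (α : Module.Dual ℂ W)
  · filter_upwards [truncation_evZero_iterate S.truncV Y u v w] with j hj
    funext n
    exact (congrArg (α : Module.Dual ℂ W) (congrFun hj n)).trans (map_zero _)
  · refine ⟨(hA.botTrunc u v α).1.mono fun m hm => funext fun n => ?_,
      fun m => ((hA.botTrunc u v α).2 m).map _⟩
    exact (congrArg ((evalAt w).comp (DQ Y z).subtype) (congrFun hm n)).trans (map_zero _)
  · refine ⟨(hA.botTrunc v u α).1.mono fun m hm => funext fun n => ?_,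
      fun m => ((hA.botTrunc v u α).2 m).map _⟩
    exact (congrArg ((evalAt w).comp (DQ Y z).subtype) (congrFun hm n)).trans (map_zero _)
  · filter_upwards [hR] with j hj
    funext n
    exact (congrArg ((evalAt w).comp (DQ Y z).subtype) (congrFun hj n)).trans (map_zero _)
  · exact fun j => (hA _ α).map _
  · obtain ⟨r, hr⟩ := S.bound_iterate f u v l
    have hreg : ∀ {v : V} {β : DQ Y z} {k : ℕ}, Regular z k (S.seq v β) →
        (shiftAdd z ^ k) (fun n => S.inftyField v n β) = (shiftAdd z ^ k) (S.seq v β) :=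
      fun h => S.shiftAdd_pow_inftyField h
    -- In the first product `f u` clears the inner field and `l₁` the outer one for all inner modes
    -- at once; in the second product `f v` and `l₂` do so. The bound `r` covers the iterates `Yv u
    -- j v` with `j ≥ l`.
    refine ⟨max (f u) l₂, max (max (f v) l₁) r, ?_, ?_, fun j hj => ?_⟩
    · have := shiftAdd_pow_pow_eq (ζ := z) (p := max (f u) l₂) (r := max (max (f v) l₁) r)
        (P := fun m n => S.inftyField v n (S.inftyField u m α))
        (P₁ := fun m n => S.inftyField v n (S.seq u α m))
        (P₂ := fun m n => S.seq v (S.seq u α m) n) (fun n => ?_) (fun m => ?_)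
      · funext m n
        rw [shiftAdd_pow_pow_map, this, ← shiftAdd_pow_pow_map]
        rfl
      · rw [shiftAdd_pow_map, shiftAdd_pow_map (s := S.seq u α), hreg ((hf u).mono (by simp))]
      · exact hreg ((hl₁ m).mono (by simp))
    · have := shiftAdd_pow_pow_eq' (ζ := z) (p := max (f u) l₂) (r := max (max (f v) l₁) r)
        (P := fun m n => S.inftyField u m (S.inftyField v n α))
        (P₁ := fun m n => S.inftyField u m (S.seq v α n))
        (P₂ := fun m n => S.seq u (S.seq v α n) m) (fun m => ?_) (fun n => ?_)
      · funext m n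
        rw [shiftAdd_pow_pow_map, this, ← shiftAdd_pow_pow_map]
        rfl
      · rw [shiftAdd_pow_map, shiftAdd_pow_map (s := S.seq v α), hreg ((hf v).mono (by simp))]
      · exact hreg ((hl₂ n).mono (by simp))
    · rw [shiftAdd_pow_map, hreg ((hf _).mono ((hr j hj).trans (le_max_right _ _))),
        ← shiftAdd_pow_map]
      rfl

theorem leftField_oppJacobi : OppJacobi Yv S.leftField := by
  intro u v α
  have hA := S.inftyField_oppTruncation
  have h := (S.inftyField_oppJacobi u v α).reexpand (hA.botTrunc u v α) (hA.botTrunc v u α)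
    (truncation_evZero_iterate S.truncV S.inftyField u v α) (fun j => hA _ α) z
  have key : ∀ u v : V, reexpand₂ z (fun m n => S.inftyField v n (S.inftyField u m α))
      = fun m n => S.leftField v n (S.leftField u m α) := by
    intro u v
    funext m n
    rw [S.leftField_apply u, reexpand, map_bsum (((S.inftyField_evZero u α).sub_nat m).smul _),
      reexpand₂]
    exact bsum_congr fun i => by rw [map_smul]; rfl
  have key' : reexpand₂ z (fun m n => S.inftyField u m (S.inftyField v n α))
      = fun m n => S.leftField u m (S.leftField v n α) := by
    funext m n
    rw [← reexpand₂_swap (hA.botTrunc v u α).quadFin.swap, key v u]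
  rw [key, key'] at h
  exact h

/-- The exponent is the order of the pole at `y = 0`, and by truncation of `Y(v, y) w` it depends on
`v` and `w` only. Independence of `α` matters because the lemma is applied to functionals that are
themselves modes of other fields. -/
theorem shiftAdd_neg_pow_rightField (v : V) (w : W) : ∃ q : ℕ, ∀ (k : ℕ), q ≤ k → ∀ α : DQ Y z,
    (shiftAdd (-z) ^ k) (fun n => (S.rightField v n α : Module.Dual ℂ W) w)
      = (shiftAdd (-z) ^ k) fun n => (S.leftField v n α : Module.Dual ℂ W) w := by
  obtain ⟨N, hN⟩ := dualSeq_evZero S.truncW v w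
  refine ⟨N.toNat, fun k hk α => ?_⟩
  have := shiftAdd_neg_pow_zeroVal S.ne_zero (c := dualSeq Y v α) (q := k) (w := w)
    fun n hn => hN α n (by omega)
  simp only [S.coe_leftField]
  exact this

/-- Write `B` for right and `A` for left modes. Up to a power of `x₁ - z`, `B(u) B(v)` agrees with
`A(u) B(v)`; this equals `B(v) A(u)` by commutation, and up to a power of `x₂ - z` agrees with `A(v)
A(u)`. Hence the reversed identity for `A` transfers along `atTop` to the identity in the usual
order for `B`. -/
theorem rightField_jacobi : Jacobi Yv S.rightField := by
  refine jacobi_iff.2 fun u v α => ?_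
  have hB := truncation_topTrunc S.rightField_truncation S.rightField_truncation
  have hA := S.leftField_oppTruncation
  have hR := truncation_evZero_iterate S.truncV S.rightField u v α
  have hR' := truncation_evZero_iterate S.truncV S.leftField u v α
  refine IsJacobi.of_map (hB u v α).antiFin (hB v u α).antiFin hR
    (fun w : W => (evalAt w).comp (DQ Y z).subtype)
    (fun x hx => Subtype.ext (LinearMap.ext fun w => hx w)) fun w => ?_
  have hJ := (S.leftField_oppJacobi u v α).map (hA.botTrunc u v α).antiFin
    (hA.botTrunc v u α).antiFin hR' ((evalAt w).comp (DQ Y z).subtype)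
  choose q hq using fun v => S.shiftAdd_neg_pow_rightField v w
  refine hJ.transfer_atTop (ζ := -z) ?_ ?_ ?_ ?_ ?_ ?_ ?_ fun l => ?_
  · exact fun m n => ((hA.botTrunc u v α).antiFin m n).map _
  · exact fun m n => ((hA.botTrunc v u α).antiFin m n).map _
  · filter_upwards [hR'] with j hj
    funext n
    exact (congrArg ((evalAt w).comp (DQ Y z).subtype) (congrFun hj n)).trans (map_zero _)
  · refine ⟨(hB u v α).1.mono fun n hn => funext fun m => ?_, fun n => ((hB u v α).2 n).map _⟩
    exact (congrArg ((evalAt w).comp (DQ Y z).subtype) (congrFun hn m)).trans (map_zero _)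
  · refine ⟨(hB v u α).1.mono fun n hn => funext fun m => ?_, fun n => ((hB v u α).2 n).map _⟩
    exact (congrArg ((evalAt w).comp (DQ Y z).subtype) (congrFun hn m)).trans (map_zero _)
  · filter_upwards [hR] with j hj
    funext n
    exact (congrArg ((evalAt w).comp (DQ Y z).subtype) (congrFun hj n)).trans (map_zero _)
  · intro j
    obtain ⟨N, hN⟩ := S.rightField_truncation (Yv u j v) α
    exact EvZero.map (eventually_atTop.2 ⟨N, hN⟩) _
  · obtain ⟨r, hr⟩ := S.bound_iterate q u v l
    refine ⟨q u, max (q v) r, ?_, ?_, fun j hj => ?_⟩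
    · refine shiftAdd_pow_pow_eq
        (P₁ := fun m n => (S.leftField u m (S.rightField v n α) : Module.Dual ℂ W) w)
        (fun n => hq u _ le_rfl _) fun m => ?_
      simp only [S.leftField_comm_rightField]
      exact hq v _ (le_max_left _ _) _
    · refine shiftAdd_pow_pow_eq'
        (P₁ := fun m n => (S.leftField v n (S.rightField u m α) : Module.Dual ℂ W) w)
        (fun m => hq v _ (le_max_left _ _) _) fun n => ?_
      simp only [S.leftField_comm_rightField]
      exact hq u _ le_rfl _
    · exact hq _ _ ((hr j hj).trans (le_max_right _ _)) _

end QSetting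

/-! ### Expansions of rational functions compared with operations on modes. -/

section Rational

/-- The expansions of rational functions, as sequences of modes. -/
structure IsExpansion (T : RatFunc ℂ → ℤ → ℂ) : Prop where
  add : ∀ f g, T (f + g) = T f + T g
  X_mul : ∀ f, T (RatFunc.X * f) = shiftAdd 0 (T f)
  C_mul : ∀ c f, T (RatFunc.C c * f) = c • T f
  one : T 1 = fun n => if n = -1 then 1 else 0

theorem polySeq_add (g h : Polynomial ℂ) : polySeq (g + h) = polySeq g + polySeq h := by
  funext n
  simp only [polySeq, Pi.add_apply]
  split_ifs <;> simp

theorem polySeq_C_mul (c : ℂ) (g : Polynomial ℂ) :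
    polySeq (Polynomial.C c * g) = c • polySeq g := by
  funext n
  simp only [polySeq, Pi.smul_apply]
  split_ifs <;> simp

theorem polySeq_X_mul (g : Polynomial ℂ) : polySeq (Polynomial.X * g) = shiftAdd 0 (polySeq g) := by
  funext n
  simp only [polySeq, shiftAdd_apply, zero_smul, add_zero]
  rcases lt_trichotomy n (-1) with h | rfl | h
  · rw [if_pos (by omega), if_pos (by omega),
      show (-n - 1).toNat = (-(n + 1) - 1).toNat + 1 by omega, Polynomial.coeff_X_mul]
  · simp
  · rw [if_neg (by omega), if_neg (by omega)]

theorem polySeq_one : polySeq 1 = fun n => if n = -1 then 1 else 0 := by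
  funext n
  simp only [polySeq, Polynomial.coeff_one]
  split_ifs <;> first | rfl | omega

theorem polySeq_X_add_C_mul (ζ : ℂ) (g : Polynomial ℂ) :
    polySeq ((Polynomial.X + Polynomial.C ζ) * g) = shiftAdd ζ (polySeq g) := by
  rw [add_mul, polySeq_add, polySeq_X_mul, polySeq_C_mul]
  funext n
  simp [shiftAdd_apply]

theorem polySeq_evZero_atBot (g : Polynomial ℂ) : EvZero atBot (polySeq g) := by
  filter_upwards [eventually_lt_atBot (-(g.natDegree : ℤ) - 1)] with n hn
  rw [polySeq, if_pos (by omega), Polynomial.coeff_eq_zero_of_natDegree_lt (by omega)]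

theorem IsExpansion.algebraMap {T : RatFunc ℂ → ℤ → ℂ} (hT : IsExpansion T) (g : Polynomial ℂ) :
    T (algebraMap _ _ g) = polySeq g := by
  induction g using Polynomial.induction_on with
  | C a =>
    rw [RatFunc.algebraMap_C, ← mul_one (RatFunc.C a), hT.C_mul, hT.one,
      ← mul_one (Polynomial.C a), polySeq_C_mul, polySeq_one]
  | add p q hp hq => rw [map_add, hT.add, hp, hq, polySeq_add]
  | monomial n a h =>
    rw [pow_succ', mul_left_comm, map_mul, RatFunc.algebraMap_X, hT.X_mul, h, polySeq_X_mul]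

theorem IsExpansion.X_add_C_mul {T : RatFunc ℂ → ℤ → ℂ} (hT : IsExpansion T) (ζ : ℂ)
    (f : RatFunc ℂ) : T ((RatFunc.X + RatFunc.C ζ) * f) = shiftAdd ζ (T f) := by
  rw [add_mul, hT.add, hT.X_mul, hT.C_mul]
  funext n
  simp [shiftAdd_apply]

theorem IsExpansion.X_add_C_pow_mul {T : RatFunc ℂ → ℤ → ℂ} (hT : IsExpansion T) (ζ : ℂ) (k : ℕ)
    (f : RatFunc ℂ) : T ((RatFunc.X + RatFunc.C ζ) ^ k * f) = (shiftAdd ζ ^ k) (T f) := by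
  induction k with
  | zero => simp
  | succ k ih => rw [pow_succ', mul_assoc, hT.X_add_C_mul, ih, pow_succ']; rfl

theorem iotaZero_isExpansion : IsExpansion fun f n => iotaZero f (-n - 1) where
  add f g := by funext n; simp [iotaZero]
  X_mul f := by
    funext n
    simp only [iotaZero, map_mul, RatFunc.coe_X, HahnSeries.coeff_single_mul, shiftAdd_apply,
      one_mul, zero_smul, add_zero]
    congr 1
    ring
  C_mul c f := by
    funext n
    have : ((RatFunc.C c : RatFunc ℂ) : LaurentSeries ℂ) = HahnSeries.single 0 c := by
      rw [← RatFunc.algebraMap_C, ← IsScalarTower.algebraMap_apply]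
      simp
    simp only [iotaZero, map_mul, this, HahnSeries.coeff_single_mul, sub_zero, Pi.smul_apply,
      smul_eq_mul]
  one := by
    funext n
    simp only [iotaZero, map_one, HahnSeries.coeff_one]
    congr 1
    exact propext ⟨fun h => by omega, fun h => by omega⟩

theorem iotaZero_evZero (f : RatFunc ℂ) : EvZero atTop fun n => iotaZero f (-n - 1) := by
  filter_upwards [eventually_gt_atTop (-(f : LaurentSeries ℂ).order - 1)] with n hn
  exact HahnSeries.coeff_eq_zero_of_lt_order (by omega)

theorem iotaZero_injective : Function.Injective iotaZero := fun _ _ h =>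
  RingHom.injective _ (HahnSeries.ext h)

/-- `RatFunc.eval` is additive and multiplicative only where denominators do not vanish; that is
automatic at the transcendental element `X⁻¹`, and in `eval₂_sub_C_ne_zero` at `X - z`. -/
theorem eval₂_inv_X_ne_zero {p : Polynomial ℂ} (hp : p ≠ 0) :
    p.eval₂ (algebraMap ℂ (RatFunc ℂ)) (RatFunc.X)⁻¹ ≠ 0 := by
  intro h
  have : IsAlgebraic ℂ (RatFunc.X : RatFunc ℂ)⁻¹ := ⟨p, hp, h⟩
  exact RatFunc.transcendental_X (by simpa using this.inv)

theorem eval₂_sub_C (z : ℂ) (p : Polynomial ℂ) :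
    p.eval₂ (algebraMap ℂ (RatFunc ℂ)) (RatFunc.X - RatFunc.C z)
      = algebraMap _ _ (p.comp (Polynomial.X - Polynomial.C z)) := by
  rw [Polynomial.comp, Polynomial.hom_eval₂, map_sub, RatFunc.algebraMap_X, RatFunc.algebraMap_C,
    RatFunc.algebraMap_comp_C]
  rfl

theorem eval₂_sub_C_ne_zero (z : ℂ) {p : Polynomial ℂ} (hp : p ≠ 0) :
    p.eval₂ (algebraMap ℂ (RatFunc ℂ)) (RatFunc.X - RatFunc.C z) ≠ 0 := by
  rw [eval₂_sub_C]
  refine (map_ne_zero_iff _ (RatFunc.algebraMap_injective ℂ)).2 ?_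
  intro h
  have h2 := congrArg (fun q : Polynomial ℂ => q.comp (Polynomial.X + Polynomial.C z)) h
  rw [Polynomial.comp_assoc] at h2
  simp at h2
  exact hp h2

theorem eval_mul_of_ne_zero {a : RatFunc ℂ}
    (ha : ∀ p : Polynomial ℂ, p ≠ 0 → p.eval₂ (algebraMap ℂ (RatFunc ℂ)) a ≠ 0) (f g : RatFunc ℂ) :
    RatFunc.eval (algebraMap ℂ (RatFunc ℂ)) a (f * g) = RatFunc.eval (algebraMap ℂ (RatFunc ℂ)) a f *
      RatFunc.eval (algebraMap ℂ (RatFunc ℂ)) a g :=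
  RatFunc.eval_mul _ _ (ha _ (RatFunc.denom_ne_zero f)) (ha _ (RatFunc.denom_ne_zero g))

theorem iotaInfty_isExpansion : IsExpansion fun f n => iotaInfty f (-n - 1) where
  add f g := by
    funext n
    simp only [iotaInfty]
    rw [RatFunc.eval_add _ _ (eval₂_inv_X_ne_zero (RatFunc.denom_ne_zero f))
      (eval₂_inv_X_ne_zero (RatFunc.denom_ne_zero g))]
    simp [iotaZero]
  X_mul f := by
    funext n
    simp only [iotaInfty, shiftAdd_apply, zero_smul, add_zero]
    rw [eval_mul_of_ne_zero (fun p hp => eval₂_inv_X_ne_zero hp), RatFunc.eval_X]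
    set F := RatFunc.eval (algebraMap ℂ (RatFunc ℂ)) (RatFunc.X)⁻¹ f
    have h := congrFun (iotaZero_isExpansion.X_mul (RatFunc.X⁻¹ * F)) (-(n + 1) - 1 - 1)
    rw [mul_inv_cancel_left₀ RatFunc.X_ne_zero] at h
    simp only [shiftAdd_apply, zero_smul, add_zero] at h
    rw [show -(-n - 1) = -(-(n + 1) - 1 - 1 + 1) - 1 by ring, ← h]
    congr 1
    ring
  C_mul c f := by
    funext n
    simp only [iotaInfty]
    rw [eval_mul_of_ne_zero (fun p hp => eval₂_inv_X_ne_zero hp), RatFunc.eval_C]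
    have h := congrFun (iotaZero_isExpansion.C_mul c
      (RatFunc.eval (algebraMap ℂ (RatFunc ℂ)) (RatFunc.X)⁻¹ f)) (-n - 2)
    simp only [Pi.smul_apply, show -(-n - 2) - 1 = -(-n - 1) by ring] at h
    exact h
  one := by
    funext n
    have h := congrFun iotaZero_isExpansion.one (-n - 2)
    simp only [iotaInfty, RatFunc.eval_one]
    rw [show -(-n - 1) = -(-n - 2) - 1 by ring, h]
    congr 1
    exact propext ⟨fun h => by omega, fun h => by omega⟩

theorem iotaInfty_evZero (f : RatFunc ℂ) : EvZero atBot fun n => iotaInfty f (-n - 1) := by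
  obtain ⟨N, hN⟩ := eventually_atTop.1
    (iotaZero_evZero (RatFunc.eval (algebraMap ℂ (RatFunc ℂ)) (RatFunc.X)⁻¹ f))
  filter_upwards [eventually_le_atBot (-N - 2)] with n hn
  have := hN (-n - 2) (by omega)
  simp only [show -(-n - 2) - 1 = -(-n - 1) by ring] at this
  exact this

/-- The rational function represented by a convergent series. -/
theorem exists_ratFunc {z : ℂ} {c : ℤ → ℂ} (hc : EvZero atTop c) {k l : ℕ} {g : Polynomial ℂ}
    (h : (shiftAdd 0 ^ k) ((shiftAdd z ^ l) c) = polySeq g) :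
    ∃ f : RatFunc ℂ, (fun n => iotaZero f (-n - 1)) = c ∧
      (RatFunc.X - RatFunc.C z) ^ k * (RatFunc.X ^ l * shift z f)
        = algebraMap _ _ (g.comp (Polynomial.X - Polynomial.C z)) := by
  have hX : (RatFunc.X : RatFunc ℂ) ≠ 0 := RatFunc.X_ne_zero
  have hXz : (RatFunc.X + RatFunc.C z : RatFunc ℂ) ≠ 0 := by
    rw [← RatFunc.algebraMap_X, ← RatFunc.algebraMap_C, ← map_add]
    exact (map_ne_zero_iff _ (RatFunc.algebraMap_injective ℂ)).2 (Polynomial.X_add_C_ne_zero z)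
  refine ⟨algebraMap _ _ g / (RatFunc.X ^ k * (RatFunc.X + RatFunc.C z) ^ l), ?_, ?_⟩
  · have e := iotaZero_isExpansion.X_add_C_pow_mul 0 k ((RatFunc.X + RatFunc.C z) ^ l *
      (algebraMap _ _ g / (RatFunc.X ^ k * (RatFunc.X + RatFunc.C z) ^ l)))
    have e4 := iotaZero_isExpansion.X_add_C_pow_mul z l
      (algebraMap _ _ g / (RatFunc.X ^ k * (RatFunc.X + RatFunc.C z) ^ l))
    rw [map_zero, add_zero, e4] at e
    have e2 : RatFunc.X ^ k * ((RatFunc.X + RatFunc.C z) ^ l *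
      (algebraMap _ _ g / (RatFunc.X ^ k * (RatFunc.X + RatFunc.C z) ^ l)))
        = algebraMap (Polynomial ℂ) (RatFunc ℂ) g := by field_simp
    have e3 := iotaZero_isExpansion.algebraMap g
    rw [e2, e3, ← h] at e
    have ev := iotaZero_evZero (algebraMap _ _ g / (RatFunc.X ^ k * (RatFunc.X + RatFunc.C z) ^ l))
    rw [← sub_eq_zero, ← map_sub, ← map_sub] at e
    have h0 := eq_zero_of_pow_atTop ((hc.sub ev).shiftAdd_pow tendsto_add_atTop z l) e
    exact (sub_eq_zero.1 (eq_zero_of_pow_atTop (hc.sub ev) h0)).symm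
  · set f : RatFunc ℂ := algebraMap _ _ g / (RatFunc.X ^ k * (RatFunc.X + RatFunc.C z) ^ l)
    have e2 : algebraMap _ _ ((Polynomial.X) ^ k * (Polynomial.X + Polynomial.C z) ^ l) * f
        = algebraMap (Polynomial ℂ) (RatFunc ℂ) g := by
      simp only [map_mul, map_pow, map_add, RatFunc.algebraMap_X, RatFunc.algebraMap_C, f]
      field_simp
    have e3 := congrArg (shift z) e2
    rw [shift, shift, eval_mul_of_ne_zero (fun p hp => eval₂_sub_C_ne_zero z hp),
      RatFunc.eval_algebraMap, RatFunc.eval_algebraMap] at e3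
    simp only [Algebra.algebraMap_self, RingHom.id_apply, eval₂_sub_C] at e3
    rw [← e3, Polynomial.mul_comp, Polynomial.pow_comp, Polynomial.pow_comp]
    simp only [Polynomial.X_comp, Polynomial.add_comp, Polynomial.C_comp, sub_add_cancel, map_mul,
      map_pow, map_sub, RatFunc.algebraMap_X, RatFunc.algebraMap_C]
    rw [mul_assoc]
    rfl

theorem reexpand_shiftAdd_zero {z : ℂ} {e : ℤ → ℂ} (he : EvZero atBot e) (k : ℕ) :
    reexpand z ((shiftAdd 0 ^ k) e) = (shiftAdd (-z) ^ k) (reexpand z e) := by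
  induction k generalizing e with
  | zero => rfl
  | succ k ih =>
    rw [shiftAdd_pow_succ', shiftAdd_pow_succ', ih (he.shiftAdd tendsto_add_atBot 0)]
    congr 1
    funext n
    have e1 : shiftAdd z e = shiftAdd 0 e + z • e := by
      funext n; simp [shiftAdd_apply]
    rw [shiftAdd_apply, reexpand_shift he, e1,
      reexpand_add (he.shiftAdd tendsto_add_atBot 0) (he.const_smul z), reexpand_smul]
    simp

theorem reexpand_shiftAdd_pow {z : ℂ} {e : ℤ → ℂ} (he : EvZero atBot e) (k : ℕ) :
    reexpand z ((shiftAdd z ^ k) e) = (shiftAdd 0 ^ k) (reexpand z e) := by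
  induction k generalizing e with
  | zero => rfl
  | succ k ih =>
    rw [shiftAdd_pow_succ', shiftAdd_pow_succ', ih (he.shiftAdd tendsto_add_atBot z)]
    congr 1
    funext n
    rw [shiftAdd_apply, reexpand_shift he]
    simp

theorem reexpandZero_shiftAdd_zero {z : ℂ} (hz : z ≠ 0) {e : ℤ → ℂ} (he : EvZero atTop e) (k : ℕ) :
    reexpandZero z ((shiftAdd 0 ^ k) e) = (shiftAdd (-z) ^ k) (reexpandZero z e) := by
  induction k generalizing e with
  | zero => rfl
  | succ k ih =>
    rw [shiftAdd_pow_succ', shiftAdd_pow_succ', ih (he.shiftAdd tendsto_add_atTop 0)]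
    congr 1
    funext n
    have e1 : shiftAdd z e = shiftAdd 0 e + z • e := by
      funext n; simp [shiftAdd_apply]
    rw [shiftAdd_apply, reexpandZero_shift hz he, e1,
      reexpandZero_add (he.shiftAdd tendsto_add_atTop 0) (he.const_smul z), reexpandZero_smul]
    simp

theorem reexpandZero_shiftAdd_pow {z : ℂ} (hz : z ≠ 0) {e : ℤ → ℂ} (he : EvZero atTop e) (k : ℕ) :
    reexpandZero z ((shiftAdd z ^ k) e) = (shiftAdd 0 ^ k) (reexpandZero z e) := by
  induction k generalizing e with
  | zero => rfl
  | succ k ih =>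
    rw [shiftAdd_pow_succ', shiftAdd_pow_succ', ih (he.shiftAdd tendsto_add_atTop z)]
    congr 1
    funext n
    rw [shiftAdd_apply, reexpandZero_shift hz he]
    simp

theorem reexpandZero_polySeq (z : ℂ) (g : Polynomial ℂ) : reexpandZero z (polySeq g) = 0 := by
  funext n
  rw [reexpandZero, Pi.zero_apply, ← bsum_zero_fun (E := ℂ) n]
  refine bsum_congr fun i => ?_
  rw [polySeq, if_neg (by omega), smul_zero]

theorem reexpand_polySeq_one (z : ℂ) : reexpand z (polySeq 1) = polySeq 1 := by
  rw [polySeq_one]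
  funext n
  rw [reexpand]
  by_cases hn : n < 0
  · rw [bsum_eq_sum (I := 1) fun i hi => by rw [if_neg (by omega), smul_zero]]
    simp
  · obtain ⟨k, rfl⟩ := Int.eq_ofNat_of_zero_le (not_lt.1 hn)
    rw [if_neg (by omega), bsum, finsum_eq_zero_of_forall_eq_zero]
    intro i
    -- The mode `-1` of the constant series is reached only for `i = k + 1`, where the binomial
    -- coefficient is zero.
    by_cases hi : i = k + 1
    · subst hi
      have : Ring.choose (k : ℤ) (k + 1) = 0 := by
        rw [Ring.choose_natCast, Nat.choose_eq_zero_of_lt (Nat.lt_succ_self k), Nat.cast_zero]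
      rw [this]; simp
    · rw [if_neg (by omega), smul_zero, smul_zero]

theorem reexpand_polySeq (z : ℂ) (g : Polynomial ℂ) :
    reexpand z (polySeq g) = polySeq (g.comp (Polynomial.X - Polynomial.C z)) := by
  have hC : ∀ a : ℂ, reexpand z (polySeq (Polynomial.C a)) = polySeq (Polynomial.C a) := by
    intro a
    rw [← mul_one (Polynomial.C a), polySeq_C_mul, reexpand_smul, reexpand_polySeq_one]
  induction g using Polynomial.induction_on with
  | C a => rw [hC, Polynomial.C_comp]
  | add p q hp hq =>
    rw [polySeq_add, reexpand_add (polySeq_evZero_atBot p) (polySeq_evZero_atBot q), hp, hq,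
      Polynomial.add_comp, polySeq_add]
  | monomial n a h =>
    have := reexpand_shiftAdd_zero (z := z)
      (polySeq_evZero_atBot (Polynomial.C a * Polynomial.X ^ n)) 1
    rw [pow_one, pow_one, ← polySeq_X_mul, h] at this
    rw [pow_succ', mul_left_comm, this, Polynomial.mul_comp Polynomial.X, Polynomial.X_comp,
      ← polySeq_X_add_C_mul, Polynomial.C_neg, ← sub_eq_add_neg]

/-- Multiplied by `(x - z) ^ k x ^ l`, both sides become the same polynomial, and the factor can be
cancelled among series with finitely many positive powers. -/
theorem iotaInfty_shift {z : ℂ} {c : ℤ → ℂ} {k l : ℕ}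
    {g : Polynomial ℂ} (h : (shiftAdd 0 ^ k) ((shiftAdd z ^ l) c) = polySeq g) {f : RatFunc ℂ}
    (hf : (RatFunc.X - RatFunc.C z) ^ k * (RatFunc.X ^ l * shift z f)
        = algebraMap _ _ (g.comp (Polynomial.X - Polynomial.C z))) :
    (fun n => iotaInfty (shift z f) (-n - 1)) = reexpand z (inftyExp z c) := by
  have hreg : Regular z l c := by
    have h1 := polySeq_evZero_atBot g
    rw [← h] at h1
    filter_upwards [(tendsto_add_atBot (-k : ℤ)).eventually h1] with n hn
    rw [shiftAdd_zero_pow] at hn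
    simpa using hn
  have hi := hreg.inftyExp
  have e1 : (shiftAdd (-z) ^ k) ((shiftAdd 0 ^ l) (reexpand z (inftyExp z c)))
      = polySeq (g.comp (Polynomial.X - Polynomial.C z)) := by
    rw [← reexpand_shiftAdd_pow hi.1, ← reexpand_shiftAdd_zero
      (hi.1.shiftAdd_pow tendsto_add_atBot z l), hi.2, h, reexpand_polySeq]
  have e2 := iotaInfty_isExpansion.X_add_C_pow_mul (-z) k (RatFunc.X ^ l * shift z f)
  have e3 := iotaInfty_isExpansion.X_add_C_pow_mul 0 l (shift z f)
  rw [map_zero, add_zero] at e3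
  rw [map_neg, ← sub_eq_add_neg, hf, e3] at e2
  have e4 := iotaInfty_isExpansion.algebraMap (g.comp (Polynomial.X - Polynomial.C z))
  rw [e4, ← e1, ← sub_eq_zero, ← map_sub, ← map_sub] at e2
  have ev := (reexpand_evZero (z := z) hi.1).sub (iotaInfty_evZero (shift z f))
  have h0 := eq_zero_of_pow_atBot (ev.shiftAdd_pow tendsto_add_atBot 0 l) e2
  exact (sub_eq_zero.1 (eq_zero_of_pow_atBot ev h0)).symm

/-- The same cancellation among series with finitely many negative powers. A polynomial has no
residue at `y = 0`, so `reexpandZero` contributes nothing after clearing denominators; `hb` is the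
truncation that permits cancelling. -/
theorem iotaZero_shift {z : ℂ} (hz : z ≠ 0) {c : ℤ → ℂ} (hc : EvZero atTop c) {k l : ℕ}
    {g : Polynomial ℂ} (h : (shiftAdd 0 ^ k) ((shiftAdd z ^ l) c) = polySeq g) {f : RatFunc ℂ}
    (hf : (RatFunc.X - RatFunc.C z) ^ k * (RatFunc.X ^ l * shift z f)
        = algebraMap _ _ (g.comp (Polynomial.X - Polynomial.C z)))
    (hb : EvZero atTop (reexpand z (inftyExp z c) - reexpandZero z c)) :
    (fun n => iotaZero (shift z f) (-n - 1))
      = reexpand z (inftyExp z c) - reexpandZero z c := by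
  have hreg : Regular z l c := by
    have h1 := polySeq_evZero_atBot g
    rw [← h] at h1
    filter_upwards [(tendsto_add_atBot (-k : ℤ)).eventually h1] with n hn
    rw [shiftAdd_zero_pow] at hn
    simpa using hn
  have hi := hreg.inftyExp
  have e1 : (shiftAdd (-z) ^ k) ((shiftAdd 0 ^ l) (reexpand z (inftyExp z c) - reexpandZero z c))
      = polySeq (g.comp (Polynomial.X - Polynomial.C z)) := by
    rw [map_sub, map_sub, ← reexpand_shiftAdd_pow hi.1, ← reexpand_shiftAdd_zero
      (hi.1.shiftAdd_pow tendsto_add_atBot z l), hi.2, h, reexpand_polySeq,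
      ← reexpandZero_shiftAdd_pow hz hc, ← reexpandZero_shiftAdd_zero hz
      (hc.shiftAdd_pow tendsto_add_atTop z l), h, reexpandZero_polySeq, sub_zero]
  have e2 := iotaZero_isExpansion.X_add_C_pow_mul (-z) k (RatFunc.X ^ l * shift z f)
  have e3 := iotaZero_isExpansion.X_add_C_pow_mul 0 l (shift z f)
  rw [map_zero, add_zero] at e3
  rw [map_neg, ← sub_eq_add_neg, hf, e3] at e2
  have e4 := iotaZero_isExpansion.algebraMap (g.comp (Polynomial.X - Polynomial.C z))
  rw [e4, ← e1, ← sub_eq_zero, ← map_sub, ← map_sub] at e2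
  have ev := hb.sub (iotaZero_evZero (shift z f))
  have h0 := eq_zero_of_pow_atTop (ev.shiftAdd_pow tendsto_add_atTop 0 l) e2
  exact (sub_eq_zero.1 (eq_zero_of_pow_atTop ev h0)).symm

end Rational

/-! ### The fields on `DQ Y z` are the expansions that occur in the definition of the actions. -/

namespace QSetting

variable {V W : Type*} [AddCommGroup V] [Module ℂ V] [AddCommGroup W] [Module ℂ W]
  {Yv : FieldMap V V} {Y : FieldMap V W} {z : ℂ} (S : QSetting Yv Y z)
include S

theorem exists_ratFunc (v : V) (α : DQ Y z) (w : W) : ∃ (k l : ℕ) (g : Polynomial ℂ)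
    (f : RatFunc ℂ), (shiftAdd 0 ^ k) ((shiftAdd z ^ l) fun n => dualSeq Y v α n w) = polySeq g ∧
      iotaZeroInv (pairing Y α v w) = f ∧
      (RatFunc.X - RatFunc.C z) ^ k * (RatFunc.X ^ l * shift z f)
        = algebraMap _ _ (g.comp (Polynomial.X - Polynomial.C z)) := by
  obtain ⟨l, m, h⟩ := α.2 v
  obtain ⟨k, g, -, hs⟩ := h w
  have hcv : ConvergesTo z (fun n => dualSeq Y v α n w)
      fun x => g.eval x / (x ^ k * (x + z) ^ l) := hs
  rw [convergesTo_iff S.ne_zero (S.locBounded v α w)] at hcv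
  obtain ⟨f, hf, hf'⟩ := VOATheory.exists_ratFunc (S.locBounded v α w) hcv
  refine ⟨k, l, g, f, hcv, ?_, hf'⟩
  have : pairing Y α v w = iotaZero f := by
    funext j
    have := congrFun hf (-j - 1)
    simp only [show -(-j - 1) - 1 = j by ring] at this
    rw [this]
    rfl
  rw [iotaZeroInv, this]
  exact Function.leftInverse_invFun iotaZero_injective f

theorem leftField_eq_iotaInfty (v : V) (n : ℤ) (α : DQ Y z) (w : W) :
    (S.leftField v n α : Module.Dual ℂ W) w
      = iotaInfty (shift z (iotaZeroInv (pairing Y (α : Module.Dual ℂ W) v w))) (-n - 1) := by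
  obtain ⟨k, l, g, f, h1, h2, h3⟩ := S.exists_ratFunc v α w
  obtain ⟨r, hr⟩ := S.mem_iff.1 α.2 v
  rw [h2, congrFun (iotaInfty_shift h1 h3) n, S.coe_leftField,
    reexpand_eval hr.inftyExp.1]
  have := inftyExp_map hr (evalAt w)
  simp only [evalAt_apply] at this
  rw [this]

theorem rightField_eq_iotaZero (v : V) (n : ℤ) (α : DQ Y z) (w : W) :
    (S.rightField v n α : Module.Dual ℂ W) w
      = iotaZero (shift z (iotaZeroInv (pairing Y (α : Module.Dual ℂ W) v w))) (-n - 1) := by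
  obtain ⟨k, l, g, f, h1, h2, h3⟩ := S.exists_ratFunc v α w
  obtain ⟨r, hr⟩ := S.mem_iff.1 α.2 v
  have e : (fun n => (S.rightField v n α : Module.Dual ℂ W) w)
      = reexpand z (inftyExp z fun n => dualSeq Y v α n w)
        - reexpandZero z fun n => dualSeq Y v α n w := by
    have := inftyExp_map hr (evalAt w)
    simp only [evalAt_apply] at this
    funext n
    rw [S.rightField_apply_apply, zeroVal, expDiff, reexpand_eval hr.inftyExp.1, this]
    rfl
  have hb : EvZero atTop fun n => (S.rightField v n α : Module.Dual ℂ W) w := by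
    obtain ⟨N, hN⟩ := S.rightField_truncation v α
    exact eventually_atTop.2 ⟨N, fun n hn => by simp [hN n hn]⟩
  have := iotaZero_shift S.ne_zero (S.locBounded v α w) h1 h3 (e ▸ hb)
  rw [h2, congrFun this n, ← e]

end QSetting

section

variable {E : Type*} [AddCommGroup E] [Module ℂ E]

theorem bsum_natCast (m : ℕ) (f : ℕ → E) :
    bsum m f = ∑ i ∈ Finset.range (m + 1), ((m.choose i : ℕ) : ℂ) • f i := by
  have : bsum m f = ∑ i ∈ Finset.range (m + 1), ((Ring.choose (m : ℤ) i : ℤ) : ℂ) • f i := by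
    refine finsum_eq_sum_of_support_subset _ fun i hi => ?_
    simp only [Finset.coe_range, Set.mem_Iio]
    by_contra h
    refine hi ?_
    simp only [Ring.choose_natCast, Nat.choose_eq_zero_of_lt (show m < i by omega)]
    simp
  rw [this]
  simp only [Ring.choose_natCast, Int.cast_natCast]

theorem bsum_one (f : ℕ → E) : bsum 1 f = f 0 + f 1 := by
  have := bsum_natCast 1 f
  simpa [Finset.sum_range_succ] using this

theorem bsum_two (f : ℕ → E) : bsum 2 f = f 0 + (2 : ℂ) • f 1 + f 2 := by
  have := bsum_natCast 2 f
  simpa [Finset.sum_range_succ] using this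

end

/-! ### Weights and the divided powers of `L(1)`. -/

section Grading

variable {V : Type*} [AddCommGroup V] [Module ℂ V] (A : VertexOperatorAlgebra V)

/-- The projection to the homogeneous subspace of weight `h`. -/
def componentMap (h : ℤ) : V →ₗ[ℂ] V :=
  (A.grade h).subtype ∘ₗ DirectSum.component ℂ ℤ (fun i => A.grade i) h ∘ₗ
    ((LinearEquiv.ofBijective (DirectSum.coeLinearMap A.grade) A.isInternal).symm : V →ₗ[ℂ] _)

theorem componentMap_apply (h : ℤ) (v : V) : componentMap A h v = component A h v := rfl

variable {A}

theorem component_of_mem {h : ℤ} {v : V} (hv : v ∈ A.grade h) (k : ℤ) :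
    component A k v = if k = h then v else 0 := by
  have : (LinearEquiv.ofBijective (DirectSum.coeLinearMap A.grade) A.isInternal).symm v
      = DirectSum.lof ℂ ℤ (fun i => A.grade i) h ⟨v, hv⟩ :=
    (LinearEquiv.symm_apply_eq _).2 (DirectSum.coeLinearMap_lof A.grade h ⟨v, hv⟩).symm
  rw [component, this]
  split_ifs with hk
  · subst hk
    rw [DirectSum.lof_apply]
  · rw [DirectSum.lof_eq_of, DirectSum.of_eq_of_ne _ _ _ hk]
    rfl

theorem component_finite (v : V) : (Function.support fun h => component A h v).Finite :=
  (DirectSum.hasFiniteSupport (fun i => A.grade i)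
    ((LinearEquiv.ofBijective (DirectSum.coeLinearMap A.grade) A.isInternal).symm v)).subset
    fun _ hh h0 => hh h0

theorem component_mem (h : ℤ) (v : V) : component A h v ∈ A.grade h := Subtype.mem _

theorem homogeneous_induction {p : V → Prop} (mem : ∀ h v, v ∈ A.grade h → p v) (zero : p 0)
    (add : ∀ u v, p u → p v → p (u + v)) (v : V) : p v := by
  have hv : v ∈ ⨆ h, A.grade h := by rw [A.isInternal.submodule_iSup_eq_top]; trivial
  exact Submodule.iSup_induction A.grade (motive := p) hv mem zero add

theorem sum_component (v : V) : ∑ᶠ h, component A h v = v := by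
  induction v using homogeneous_induction (A := A) with
  | mem k v hk =>
    rw [finsum_eq_single _ k fun h hh => by rw [component_of_mem hk, if_neg hh],
      component_of_mem hk, if_pos rfl]
  | zero => simp [← componentMap_apply]
  | add u v hu hv =>
    have : ∀ h, component A h (u + v) = component A h u + component A h v := fun h =>
      map_add (componentMap A h) u v
    simp only [this]
    rw [finsum_add_distrib (component_finite u) (component_finite v), hu, hv]

/-- Eigenvectors of `L(0)` are homogeneous. -/
theorem mem_grade_of_weight {n : ℤ} {v : V} (hv : A.Y A.omega 1 v = (n : ℂ) • v) :
    v ∈ A.grade n := by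
  have key : ∀ h, component A h (A.Y A.omega 1 v) = (h : ℂ) • component A h v := by
    intro h
    simp only [← componentMap_apply]
    clear hv
    induction v using homogeneous_induction (A := A) with
    | mem k v hk =>
      rw [A.weight k v hk, map_smul, componentMap_apply, component_of_mem hk]
      split_ifs with e
      · rw [e]
      · simp
    | zero => simp
    | add u v hu hv => simp only [map_add, hu, hv, smul_add]
  rw [← sum_component (A := A) v]
  have h0 : ∀ h, h ≠ n → component A h v = 0 := by
    intro h hn
    have h1 := key h
    rw [hv, ← componentMap_apply, map_smul, componentMap_apply, ← sub_eq_zero, ← sub_smul] at h1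
    refine (smul_eq_zero.1 h1).resolve_left ?_
    refine sub_ne_zero.2 ?_
    exact_mod_cast hn.symm
  rw [finsum_eq_single _ n h0]
  exact component_mem n v

theorem weight_mode {hu hv : ℤ} {u v : V} (hu' : u ∈ A.grade hu) (hv' : v ∈ A.grade hv) (n : ℤ) :
    A.Y u n v ∈ A.grade (hu + hv - n - 1) := by
  refine mem_grade_of_weight ?_
  rw [A.adjoint.jacobi.commutator A.omega u v 1 n, bsum_one, Nat.cast_zero, Nat.cast_one,
    A.weight hv v hv', A.weight hu u hu', A.adjoint.derivative]
  simp only [LinearMap.smul_apply, map_smul, Pi.smul_apply]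
  rw [show 1 + n - 1 = n by ring, show 1 + n - 0 - 1 = n by ring, ← add_smul, ← add_smul]
  congr 1
  push_cast
  ring

theorem L1_mem {h : ℤ} {v : V} (hv : v ∈ A.grade h) : A.Y A.omega 2 v ∈ A.grade (h - 1) := by
  have := weight_mode A.omega_mem hv 2
  rwa [show 2 + h - 2 - 1 = h - 1 by ring] at this

/-- The commutator of `L(1) = ω_2` with `u_n`: the terms `i = 0, 1, 2` involve `L(-1) u`, `L(0) u =
h u` and `L(1) u`, and the first is rewritten by the derivative property. -/
theorem L1_mode {h : ℤ} {u : V} (hu : u ∈ A.grade h) (n : ℤ) (v : V) :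
    A.Y A.omega 2 (A.Y u n v) = A.Y u n (A.Y A.omega 2 v) + A.Y (A.Y A.omega 2 u) n v
      + ((2 * h - n - 2 : ℤ) : ℂ) • A.Y u (n + 1) v := by
  rw [A.adjoint.jacobi.commutator A.omega u v 2 n, bsum_two, Nat.cast_zero, Nat.cast_one,
    A.weight h u hu, A.adjoint.derivative]
  simp only [LinearMap.smul_apply, map_smul, Pi.smul_apply, Nat.cast_ofNat]
  rw [show 2 + n - 1 = n + 1 by ring, show 2 + n - 0 - 1 = n + 1 by ring,
    show 2 + n - 2 = n by ring]
  push_cast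
  module

variable (A)

/-- The divided powers of `L(1)`. -/
def lowering (j : ℕ) : Module.End ℂ V := ((Nat.factorial j : ℂ))⁻¹ • (A.Y A.omega 2) ^ j

variable {A}

@[simp] theorem lowering_zero : lowering A 0 = 1 := by simp [lowering]

theorem L1_lowering (j : ℕ) (v : V) :
    A.Y A.omega 2 (lowering A j v) = ((j : ℂ) + 1) • lowering A (j + 1) v := by
  have h1 : ((j.factorial : ℕ) : ℂ) ≠ 0 := by exact_mod_cast j.factorial_ne_zero
  have h2 : (j : ℂ) + 1 ≠ 0 := by exact_mod_cast j.succ_ne_zero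
  simp only [lowering, LinearMap.smul_apply, map_smul, smul_smul, pow_succ', Module.End.mul_apply]
  congr 1
  rw [Nat.factorial_succ]
  push_cast
  field_simp

theorem lowering_lowering (j k : ℕ) (v : V) :
    lowering A j (lowering A k v) = (((j + k).choose k : ℕ) : ℂ) • lowering A (j + k) v := by
  have h1 : ((j.factorial : ℕ) : ℂ) ≠ 0 := by exact_mod_cast j.factorial_ne_zero
  have h2 : ((k.factorial : ℕ) : ℂ) ≠ 0 := by exact_mod_cast k.factorial_ne_zero
  have h3 : (((j + k).factorial : ℕ) : ℂ) ≠ 0 := by exact_mod_cast (j + k).factorial_ne_zero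
  have h4 : (((j + k).choose k : ℕ) : ℂ) * (k.factorial) * (j.factorial) = (j + k).factorial := by
    have := Nat.choose_mul_factorial_mul_factorial (Nat.le_add_left k j)
    rw [Nat.add_sub_cancel] at this
    exact_mod_cast this
  simp only [lowering, LinearMap.smul_apply, map_smul, smul_smul, pow_add, Module.End.mul_apply]
  congr 1
  have h5 : (((j + k).choose k : ℕ) : ℂ) ≠ 0 := by
    rintro h0
    rw [h0, zero_mul, zero_mul] at h4
    exact h3 h4.symm
  rw [← h4]
  field_simp

theorem lowering_mem {h : ℤ} {v : V} (hv : v ∈ A.grade h) (j : ℕ) :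
    lowering A j v ∈ A.grade (h - j) := by
  induction j with
  | zero => simpa using hv
  | succ j ih =>
    have h2 : (j : ℂ) + 1 ≠ 0 := by exact_mod_cast j.succ_ne_zero
    have := L1_mem ih
    rw [L1_lowering] at this
    have := Submodule.smul_mem _ ((j : ℂ) + 1)⁻¹ this
    rw [inv_smul_smul₀ h2] at this
    rwa [show h - ((j + 1 : ℕ) : ℤ) = h - j - 1 by push_cast; ring]

theorem lowering_nilpotent (v : V) : ∃ J : ℕ, ∀ j, J ≤ j → lowering A j v = 0 := by
  obtain ⟨N, hN⟩ := A.grade_lower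
  induction v using homogeneous_induction (A := A) with
  | mem h v hv =>
    refine ⟨(h - N + 1).toNat, fun j hj => ?_⟩
    have := lowering_mem hv j
    rwa [hN _ (by omega), Submodule.mem_bot] at this
  | zero => exact ⟨0, fun j _ => map_zero _⟩
  | add u v hu hv =>
    obtain ⟨J, hJ⟩ := hu
    obtain ⟨K, hK⟩ := hv
    exact ⟨max J K, fun j hj => by
      rw [map_add, hJ j (le_trans (le_max_left _ _) hj), hK j (le_trans (le_max_right _ _) hj),
        add_zero]⟩

end Grading

/-! ### The opposite operators and their involutivity. -/

section Opposite

variable {V M : Type*} [AddCommGroup V] [Module ℂ V] [AddCommGroup M] [Module ℂ M]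
  {A : VertexOperatorAlgebra V}

theorem opposite_eq (G : FieldMap V M) (v : V) (n : ℤ) :
    opposite A G v n = ∑ᶠ h : ℤ, ∑ᶠ j : ℕ,
      (-1 : ℂ) ^ h • G (lowering A j (componentMap A h v)) (2 * h - j - n - 2) := by
  refine finsum_congr fun h => finsum_congr fun j => ?_
  rw [lowering, LinearMap.smul_apply, map_smul, Pi.smul_apply, smul_smul, div_eq_mul_inv]
  rfl

theorem opposite_inner_finite (G : FieldMap V M) (v : V) (n h : ℤ) :
    (Function.support fun j : ℕ =>
      (-1 : ℂ) ^ h • G (lowering A j (componentMap A h v)) (2 * h - j - n - 2)).Finite := by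
  obtain ⟨J, hJ⟩ := lowering_nilpotent (A := A) (componentMap A h v)
  exact (show EvZero atTop _ from eventually_atTop.2
    ⟨J, fun j hj => by rw [hJ j hj]; simp⟩).finite_support

theorem opposite_outer_finite (G : FieldMap V M) (v : V) (n : ℤ) :
    (Function.support fun h : ℤ => ∑ᶠ j : ℕ,
      (-1 : ℂ) ^ h • G (lowering A j (componentMap A h v)) (2 * h - j - n - 2)).Finite := by
  refine (component_finite (A := A) v).subset fun h hh h0 => hh ?_
  change ∑ᶠ j : ℕ, _ = _
  rw [componentMap_apply, show component A h v = 0 from h0]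
  simp

variable (A)

/-- The opposite operators, as a linear map. -/
def oppositeField (G : FieldMap V M) : FieldMap V M where
  toFun v n := opposite A G v n
  map_add' u v := by
    funext n
    rw [Pi.add_apply]
    simp only [opposite_eq]
    rw [← finsum_add_distrib (opposite_outer_finite G u n) (opposite_outer_finite G v n)]
    refine finsum_congr fun h => ?_
    rw [← finsum_add_distrib (opposite_inner_finite G u n h) (opposite_inner_finite G v n h)]
    refine finsum_congr fun j => ?_
    rw [map_add, map_add, map_add, Pi.add_apply, smul_add]
  map_smul' c v := by
    funext n
    rw [Pi.smul_apply]
    simp only [opposite_eq, smul_finsum, RingHom.id_apply]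
    refine finsum_congr fun h => finsum_congr fun j => ?_
    rw [map_smul, map_smul, map_smul, Pi.smul_apply, smul_comm]

variable {A}

theorem oppositeField_apply (G : FieldMap V M) (v : V) (n : ℤ) :
    oppositeField A G v n = opposite A G v n := rfl

theorem oppositeField_of_mem (G : FieldMap V M) {h : ℤ} {v : V} (hv : v ∈ A.grade h) {J : ℕ}
    (hJ : ∀ j, J ≤ j → lowering A j v = 0) (n : ℤ) :
    oppositeField A G v n = (-1 : ℂ) ^ h •
      ∑ j ∈ Finset.range J, G (lowering A j v) (2 * h - j - n - 2) := by
  rw [oppositeField_apply, opposite_eq, finsum_eq_single _ h]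
  · simp only [componentMap_apply, component_of_mem hv, if_true]
    rw [Finset.smul_sum]
    refine finsum_eq_sum_of_support_subset _ fun j hj => ?_
    simp only [Finset.coe_range, Set.mem_Iio]
    by_contra h'
    exact hj (by simp [hJ j (not_lt.1 h')])
  · intro k hk
    simp [componentMap_apply, component_of_mem hv, hk]

/-- Summation over the antidiagonals of a rectangle. -/
theorem sum_antidiagonal_rectangle {E : Type*} [AddCommMonoid E] {f : ℕ → ℕ → E} {J K : ℕ}
    (hJ : ∀ j k, J ≤ j → f j k = 0) (hK : ∀ j k, K ≤ k → f j k = 0) :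
    ∑ p ∈ Finset.range (J + K), ∑ x ∈ Finset.HasAntidiagonal.antidiagonal p, f x.1 x.2
      = ∑ j ∈ Finset.range J, ∑ k ∈ Finset.range K, f j k := by
  rw [← Finset.sum_product' (Finset.range J) (Finset.range K) f,
    ← Finset.sum_fiberwise_of_maps_to (t := Finset.range (J + K)) (g := fun x : ℕ × ℕ => x.1 + x.2)]
  · refine Finset.sum_congr rfl fun p _ => (Finset.sum_subset (fun x hx => ?_) fun x hx hx' => ?_).symm
    · simpa using (Finset.mem_filter.1 hx).2
    · simp only [Finset.mem_filter, Finset.mem_product, Finset.mem_range,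
        Finset.HasAntidiagonal.mem_antidiagonal] at hx hx'
      by_cases h : J ≤ x.1
      · exact hJ _ _ h
      · by_cases h' : K ≤ x.2
        · exact hK _ _ h'
        · exact absurd ⟨⟨not_le.1 h, not_le.1 h'⟩, hx⟩ hx'
  · intro x hx
    simp only [Finset.mem_product, Finset.mem_range] at hx ⊢
    omega

theorem sum_antidiagonal_alternating (p : ℕ) :
    ∑ x ∈ Finset.HasAntidiagonal.antidiagonal p, (-1 : ℂ) ^ x.2 * ((x.1 + x.2).choose x.2 : ℕ)
      = if p = 0 then 1 else 0 := by
  have h := (Commute.one_left (-1 : ℂ)).add_pow' p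
  have h2 : ∑ x ∈ Finset.HasAntidiagonal.antidiagonal p, (-1 : ℂ) ^ x.2 * ((x.1 + x.2).choose x.2 : ℕ)
      = (1 + -1 : ℂ) ^ p := by
    rw [h]
    refine Finset.sum_congr rfl fun x hx => ?_
    have hx' := Finset.HasAntidiagonal.mem_antidiagonal.1 hx
    rw [← hx', Nat.choose_symm_add, nsmul_eq_mul, one_pow, one_mul, mul_comm]
  rw [h2, add_neg_cancel, zero_pow_eq]

/-- Since `L(1)` lowers the weight by one, moving `(-1) ^ L(0)` past the exponential of `L(1)`
inverts the exponential. The terms of total degree `p` then carry the alternating sum of the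
binomial coefficients of `p`, which vanishes for `p > 0`. -/
theorem oppositeField_involutive (G : FieldMap V M) : oppositeField A (oppositeField A G) = G := by
  refine LinearMap.ext fun v => ?_
  induction v using homogeneous_induction (A := A) with
  | zero => simp
  | add u v hu hv => rw [map_add, map_add, hu, hv]
  | mem h v hv =>
    funext n
    obtain ⟨J, hJ⟩ := lowering_nilpotent (A := A) v
    have hJ' : ∀ k j, J ≤ j → lowering A j (lowering A k v) = 0 := fun k j hj => by
      rw [lowering_lowering, hJ _ (by omega), smul_zero]
    rw [oppositeField_of_mem _ hv hJ]
    have e : ∀ k : ℕ, oppositeField A G (lowering A k v) (2 * h - k - n - 2)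
        = (-1 : ℂ) ^ h • ∑ j ∈ Finset.range J, ((-1 : ℂ) ^ k * ((j + k).choose k : ℕ)) •
          G (lowering A (j + k) v) (n - ((j + k : ℕ) : ℤ)) := by
      intro k
      rw [oppositeField_of_mem G (lowering_mem hv k) (hJ' k), zpow_sub₀ (by norm_num), zpow_natCast,
        div_eq_mul_inv, mul_smul, Finset.smul_sum]
      congr 1
      refine Finset.sum_congr rfl fun j _ => ?_
      rw [lowering_lowering, map_smul, Pi.smul_apply, smul_smul, ← inv_pow, inv_neg, inv_one]
      congr 2
      push_cast
      ring_nf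
    simp only [e]
    rw [← Finset.smul_sum, smul_smul, ← mul_zpow, neg_one_mul, neg_neg, one_zpow, one_smul,
      Finset.sum_comm]
    have h3 := sum_antidiagonal_rectangle (f := fun j k => ((-1 : ℂ) ^ k * ((j + k).choose k : ℕ)) •
          G (lowering A (j + k) v) (n - ((j + k : ℕ) : ℤ))) (J := J) (K := J)
      (fun j k hj => by rw [hJ _ (by omega)]; simp) (fun j k hj => by rw [hJ _ (by omega)]; simp)
    rw [← h3]
    have h4 : ∀ p : ℕ, ∑ x ∈ Finset.HasAntidiagonal.antidiagonal p, ((-1 : ℂ) ^ x.2 * ((x.1 + x.2).choose x.2 : ℕ)) •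
          G (lowering A (x.1 + x.2) v) (n - ((x.1 + x.2 : ℕ) : ℤ))
          = if p = 0 then G v n else 0 := by
      intro p
      have : ∀ x ∈ Finset.HasAntidiagonal.antidiagonal p, ((-1 : ℂ) ^ x.2 * ((x.1 + x.2).choose x.2 : ℕ)) •
          G (lowering A (x.1 + x.2) v) (n - ((x.1 + x.2 : ℕ) : ℤ))
          = ((-1 : ℂ) ^ x.2 * ((x.1 + x.2).choose x.2 : ℕ)) • G (lowering A p v) (n - p) := by
        intro x hx
        rw [Finset.HasAntidiagonal.mem_antidiagonal.1 hx]
      rw [Finset.sum_congr rfl this, ← Finset.sum_smul, sum_antidiagonal_alternating]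
      split_ifs with hp
      · subst hp; simp
      · simp
    simp only [h4]
    rw [Finset.sum_ite_eq']
    split_ifs with hJ0
    · rfl
    -- The value `J = 0` forces `v = lowering A 0 v = 0`, so both sides vanish.
    · have : J = 0 := by simpa using hJ0
      have := hJ 0 (by omega)
      simp only [lowering_zero, Module.End.one_apply] at this
      simp [this]

theorem oppositeField_truncation {G : FieldMap V M} (hG : OppTruncation G) :
    Truncation (oppositeField A G) := by
  intro v a
  induction v using homogeneous_induction (A := A) with
  | zero => exact ⟨0, by simp⟩
  | add u v hu hv =>
    obtain ⟨N, hN⟩ := hu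
    obtain ⟨N', hN'⟩ := hv
    exact ⟨max N N', fun n hn => by
      simp [hN n (le_trans (le_max_left _ _) hn), hN' n (le_trans (le_max_right _ _) hn)]⟩
  | mem h v hv =>
    obtain ⟨J, hJ⟩ := lowering_nilpotent (A := A) v
    have : ∀ᶠ n in atBot, ∀ j ∈ Finset.range J, G (lowering A j v) n a = 0 :=
      (Finset.eventually_all _).2 fun j _ => hG _ a
    obtain ⟨K, hK⟩ := eventually_atBot.1 this
    refine ⟨2 * h - 2 - K, fun n hn => ?_⟩
    rw [oppositeField_of_mem G hv hJ, LinearMap.smul_apply, LinearMap.sum_apply,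
      Finset.sum_eq_zero, smul_zero]
    intro j hj
    exact hK _ (by omega) j hj

end Opposite

/-! ### Binomial coefficients, triple sums, and `L(1)` acting on products of vectors. -/

section Binomial

theorem succ_mul_choose_succ (N : ℤ) (i : ℕ) :
    ((i : ℤ) + 1) * Ring.choose N (i + 1) = (N - i) * Ring.choose N i := by
  have h1 := Ring.descPochhammer_eq_factorial_smul_choose N i
  have h2 := Ring.descPochhammer_eq_factorial_smul_choose N (i + 1)
  rw [descPochhammer_succ_right, Polynomial.smeval_mul, h1] at h2
  simp only [Polynomial.smeval_sub, Polynomial.smeval_X, pow_one, Polynomial.smeval_natCast,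
    pow_zero, nsmul_eq_mul, mul_one, Nat.factorial_succ] at h2
  have h3 : ((i.factorial : ℕ) : ℤ) ≠ 0 := by exact_mod_cast i.factorial_ne_zero
  refine mul_left_cancel₀ h3 ?_
  push_cast at h2
  linear_combination -h2

end Binomial

section TripleSum

variable {E E' : Type*} [AddCommGroup E] [Module ℂ E] [AddCommGroup E'] [Module ℂ E']

/-- The sum of `F j i k` over `j + i + k = p`. -/
def tripleSum (p : ℕ) (F : ℕ → ℕ → ℕ → E) : E :=
  ∑ x ∈ Finset.HasAntidiagonal.antidiagonal p,
    ∑ y ∈ Finset.HasAntidiagonal.antidiagonal x.2, F x.1 y.1 y.2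

theorem tripleSum_congr {p : ℕ} {F F' : ℕ → ℕ → ℕ → E}
    (h : ∀ j i k, j + i + k = p → F j i k = F' j i k) : tripleSum p F = tripleSum p F' := by
  refine Finset.sum_congr rfl fun x hx => Finset.sum_congr rfl fun y hy => h _ _ _ ?_
  rw [Finset.HasAntidiagonal.mem_antidiagonal] at hx hy
  omega

theorem tripleSum_add (p : ℕ) (F F' : ℕ → ℕ → ℕ → E) :
    tripleSum p (fun j i k => F j i k + F' j i k) = tripleSum p F + tripleSum p F' := by
  simp only [tripleSum, Finset.sum_add_distrib]

theorem map_tripleSum (p : ℕ) (F : ℕ → ℕ → ℕ → E) (φ : E →ₗ[ℂ] E') :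
    φ (tripleSum p F) = tripleSum p fun j i k => φ (F j i k) := by
  simp only [tripleSum, map_sum]

theorem tripleSum_zero (F : ℕ → ℕ → ℕ → E) : tripleSum 0 F = F 0 0 0 := by
  simp [tripleSum]

theorem tripleSum_succ₁ (p : ℕ) {F : ℕ → ℕ → ℕ → E} (h : ∀ i k, F 0 i k = 0) :
    tripleSum (p + 1) F = tripleSum p fun j i k => F (j + 1) i k := by
  rw [tripleSum, Finset.Nat.sum_antidiagonal_succ]
  simp [h, tripleSum]

theorem tripleSum_succ₂ (p : ℕ) {F : ℕ → ℕ → ℕ → E} (h : ∀ j k, F j 0 k = 0) :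
    tripleSum (p + 1) F = tripleSum p fun j i k => F j (i + 1) k := by
  rw [tripleSum, Finset.Nat.sum_antidiagonal_succ']
  simp only [Finset.Nat.sum_antidiagonal_succ, h, zero_add, Finset.Nat.antidiagonal_zero,
    Finset.sum_singleton, tripleSum]

theorem tripleSum_succ₃ (p : ℕ) {F : ℕ → ℕ → ℕ → E} (h : ∀ j i, F j i 0 = 0) :
    tripleSum (p + 1) F = tripleSum p fun j i k => F j i (k + 1) := by
  rw [tripleSum, Finset.Nat.sum_antidiagonal_succ']
  simp only [Finset.Nat.sum_antidiagonal_succ', h, zero_add, Finset.Nat.antidiagonal_zero,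
    Finset.sum_singleton, tripleSum]

theorem sum_tripleSum {F : ℕ → ℕ → ℕ → E} {J I K : ℕ} (hJ : ∀ j i k, J ≤ j → F j i k = 0)
    (hI : ∀ j i k, I ≤ i → F j i k = 0) (hK : ∀ j i k, K ≤ k → F j i k = 0) :
    ∑ p ∈ Finset.range (J + (I + K)), tripleSum p F
      = ∑ j ∈ Finset.range J, ∑ i ∈ Finset.range I, ∑ k ∈ Finset.range K, F j i k := by
  have h := sum_antidiagonal_rectangle (J := J) (K := I + K)
    (f := fun j q => ∑ y ∈ Finset.HasAntidiagonal.antidiagonal q, F j y.1 y.2)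
    (fun j q hj => Finset.sum_eq_zero fun y _ => hJ _ _ _ hj)
    (fun j q hq => Finset.sum_eq_zero fun y hy => by
      rw [Finset.HasAntidiagonal.mem_antidiagonal] at hy
      by_cases h : I ≤ y.1
      · exact hI _ _ _ h
      · exact hK _ _ _ (by omega))
  rw [show ∑ p ∈ Finset.range (J + (I + K)), tripleSum p F = _ from h]
  exact Finset.sum_congr rfl fun j _ =>
    sum_antidiagonal_rectangle (fun i k => hI j i k) (fun i k => hK j i k)

end TripleSum

section LoweringMode

variable {V : Type*} [AddCommGroup V] [Module ℂ V] {A : VertexOperatorAlgebra V}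

/-- The action of the divided powers of `L(1)` on products. -/
theorem lowering_mode {h : ℤ} {u : V} (hu : u ∈ A.grade h) (l : ℤ) (v : V) (p : ℕ) :
    lowering A p (A.Y u l v) = tripleSum p fun j i k =>
      ((Ring.choose (2 * h - j - l - 2) i : ℤ) : ℂ) •
        A.Y (lowering A j u) (l + i) (lowering A k v) := by
  induction p with
  | zero => simp [tripleSum_zero]
  | succ p ih =>
    let X : ℕ → ℕ → ℕ → V := fun j i k => A.Y (lowering A j u) (l + i) (lowering A k v)
    let c : ℕ → ℕ → ℂ := fun j i => ((Ring.choose (2 * h - j - l - 2) i : ℤ) : ℂ)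
    have hp : (p : ℂ) + 1 ≠ 0 := by exact_mod_cast p.succ_ne_zero
    have h1 : ((p : ℂ) + 1) • lowering A (p + 1) (A.Y u l v)
        = tripleSum p fun j i k => c j i • A.Y A.omega 2 (X j i k) := by
      rw [← L1_lowering, ih, map_tripleSum]
      simp only [map_smul, X, c]
    -- The factor `p + 1 = j + i + k` is distributed over three families matching the three terms of
    -- `L1_mode`. Lowering `j` by one raises the upper entry of the binomial by one; the Pascal
    -- correction for this is taken from `FA` and given to `FB`.
    let FA : ℕ → ℕ → ℕ → V := fun j i k => ((i : ℂ) * c j i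
      - (j : ℂ) * (((Ring.choose (2 * h - j - l - 2 + 1) i : ℤ) : ℂ) - c j i)) • X j i k
    let FB : ℕ → ℕ → ℕ → V := fun j i k =>
      ((j : ℂ) * ((Ring.choose (2 * h - j - l - 2 + 1) i : ℤ) : ℂ)) • X j i k
    let FC : ℕ → ℕ → ℕ → V := fun j i k => ((k : ℂ) * c j i) • X j i k
    have h2 : ((p : ℂ) + 1) • tripleSum (p + 1) (fun j i k => c j i • X j i k)
        = tripleSum (p + 1) FA + tripleSum (p + 1) FB + tripleSum (p + 1) FC := by
      have h3 := map_tripleSum (p + 1) (fun j i k => c j i • X j i k)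
        (((p : ℂ) + 1) • (LinearMap.id : V →ₗ[ℂ] V))
      rw [LinearMap.smul_apply, LinearMap.id_apply] at h3
      rw [h3, ← tripleSum_add, ← tripleSum_add]
      refine tripleSum_congr fun j i k hjk => ?_
      have : (p : ℂ) + 1 = j + i + k := by exact_mod_cast hjk.symm
      rw [LinearMap.smul_apply, LinearMap.id_apply, this]
      simp only [FA, FB, FC]
      module
    rw [tripleSum_succ₂ p (F := FA) (fun j k => by simp [FA, c]),
      tripleSum_succ₁ p (F := FB) (fun i k => by simp [FB]),
      tripleSum_succ₃ p (F := FC) (fun j i => by simp [FC]), ← tripleSum_add, ← tripleSum_add] at h2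
    refine smul_right_injective V hp ?_
    change ((p : ℂ) + 1) • _ = ((p : ℂ) + 1) • tripleSum (p + 1) (fun j i k => c j i • X j i k)
    rw [h1, h2]
    refine tripleSum_congr fun j i k _ => ?_
    simp only [X, c, FA, FB, FC]
    rw [L1_mode (lowering_mem hu j), L1_lowering, L1_lowering, map_smul, map_smul, Pi.smul_apply,
      LinearMap.smul_apply]
    have e2 : 2 * h - ((j + 1 : ℕ) : ℤ) - l - 2 + 1 = 2 * h - j - l - 2 := by push_cast; ring
    have e3 := succ_mul_choose_succ (2 * h - j - l - 2) i
    have e4 : ((i : ℂ) + 1) * ((Ring.choose (2 * h - j - l - 2) (i + 1) : ℤ) : ℂ)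
        = ((2 * h - j - l - 2 - i : ℤ) : ℂ) * ((Ring.choose (2 * h - j - l - 2) i : ℤ) : ℂ) := by
      exact_mod_cast e3
    have e5 : l + (i : ℤ) + 1 = l + ((i + 1 : ℕ) : ℤ) := by push_cast; ring
    rw [e2, Ring.choose_succ_succ, e5]
    generalize A.Y (lowering A j u) (l + i) (lowering A (k + 1) v) = x1
    generalize A.Y (lowering A (j + 1) u) (l + i) (lowering A k v) = x2
    generalize A.Y (lowering A j u) (l + ((i + 1 : ℕ) : ℤ)) (lowering A k v) = x3
    push_cast at e4 ⊢
    rw [show ((i : ℂ) + 1) * ((Ring.choose (2 * h - j - l - 2) (i + 1) : ℤ) : ℂ)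
      - j * (((Ring.choose (2 * h - j - l - 2) i : ℤ) : ℂ)
        + ((Ring.choose (2 * h - j - l - 2) (i + 1) : ℤ) : ℂ)
        - ((Ring.choose (2 * h - j - l - 2) (i + 1) : ℤ) : ℂ))
      = ((Ring.choose (2 * h - j - l - 2) i : ℤ) : ℂ) * (2 * (h - j) - (l + i) - 2) by
        rw [show ∀ a b : ℂ, a + b - b = a from fun a b => add_sub_cancel_right a b, e4]; ring]
    module

end LoweringMode

/-! ### Linearity of the Jacobi terms and their behaviour under inversion of the variables. -/

section Linear

variable {E : Type*} [AddCommGroup E] [Module ℂ E]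

theorem jacP_add {P P' : ℤ → ℤ → E} (hP : AntiFin P) (hP' : AntiFin P') (l : ℤ) :
    jacP l (P + P') = jacP l P + jacP l P' := by
  funext m n
  simp only [jacP, Pi.add_apply, smul_add]
  exact bsum_add (hP.jacP_fin l m n) (hP'.jacP_fin l m n)

theorem jacP_smul (c : ℂ) (P : ℤ → ℤ → E) (l : ℤ) : jacP l (c • P) = c • jacP l P := by
  funext m n
  simp only [jacP, Pi.smul_apply, smul_comm _ c]
  exact bsum_smul c

theorem AntiFin.zero : AntiFin (0 : ℤ → ℤ → E) := fun _ _ => Eventually.of_forall fun _ => rfl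

theorem jacP_zero_fun (l : ℤ) : jacP l (0 : ℤ → ℤ → E) = 0 := by
  simpa using jacP_smul 0 (0 : ℤ → ℤ → E) l

theorem AntiFin.sum {ι : Type*} (s : Finset ι) {P : ι → ℤ → ℤ → E} (hP : ∀ i, AntiFin (P i)) (l : ℤ) :
    AntiFin (∑ i ∈ s, P i) ∧ jacP l (∑ i ∈ s, P i) = ∑ i ∈ s, jacP l (P i) := by
  classical
  induction s using Finset.induction_on with
  | empty => exact ⟨AntiFin.zero, jacP_zero_fun l⟩
  | insert a s ha ih =>
    rw [Finset.sum_insert ha, Finset.sum_insert ha, ← ih.2]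
    exact ⟨(hP a).add ih.1, jacP_add (hP a) ih.1 l⟩

theorem jacQ_sum {ι : Type*} (s : Finset ι) {Q : ι → ℤ → ℤ → E}
    (hQ : ∀ i, AntiFin fun n m => Q i m n) (l : ℤ) :
    jacQ l (∑ i ∈ s, Q i) = ∑ i ∈ s, jacQ l (Q i) := by
  funext m n
  simp only [Finset.sum_apply, jacQ]
  have e' : (fun n m => ∑ i ∈ s, Q i m n) = ∑ i ∈ s, fun n m => Q i m n := by
    funext n m
    simp only [Finset.sum_apply]
  rw [e', (AntiFin.sum s hQ l).2, ← Finset.smul_sum]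
  simp only [Finset.sum_apply]

theorem jacQ_smul (c : ℂ) (Q : ℤ → ℤ → E) (l : ℤ) : jacQ l (c • Q) = c • jacQ l Q := by
  funext m n
  have := congrFun (congrFun (jacP_smul c (fun n m => Q m n) l) n) m
  simp only [Pi.smul_apply, jacQ]
  rw [smul_comm]
  exact congrArg _ this

theorem IsJacobi.add {P Q R P' Q' R' : ℤ → ℤ → E} (h : IsJacobi P Q R) (h' : IsJacobi P' Q' R')
    (hP : AntiFin P) (hP' : AntiFin P') (hQ : AntiFin fun n m => Q m n)
    (hQ' : AntiFin fun n m => Q' m n) (hR : EvZero atTop R) (hR' : EvZero atTop R') :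
    IsJacobi (P + P') (Q + Q') (R + R') := by
  intro l m n
  have e1 : jacR (R + R') l m n = jacR R l m n + jacR R' l m n :=
    bsum_add ((hR.nat_cast l).mono fun i hi => congrFun hi _)
      ((hR'.nat_cast l).mono fun i hi => congrFun hi _)
  have e2 : jacQ l (Q + Q') m n = jacQ l Q m n + jacQ l Q' m n := by
    have := congrFun (congrFun (jacP_add hQ hQ' l) n) m
    rw [jacQ, jacQ, jacQ, ← smul_add]
    exact congrArg _ this
  rw [e1, e2, jacP_add hP hP', Pi.add_apply, Pi.add_apply, ← h, ← h']
  abel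

theorem AntiFin.reflect {Q : ℤ → ℤ → E} (hQ : AntiFin fun n m => Q m n) (c d : ℤ) :
    AntiFin fun m n => Q (c - m) (d - n) := by
  intro m n
  refine (hQ (d - n) (c - m)).mono fun i hi => ?_
  simp only [show c - (m - (i : ℤ)) = c - m + i by ring,
    show d - (n + (i : ℤ)) = d - n - i by ring]
  exact hi

theorem neg_one_zpow_mul_self (l : ℤ) : (-1 : ℂ) ^ l * (-1 : ℂ) ^ l = 1 := by
  rw [← mul_zpow]; simp

/-- Inversion exchanges the two directions of expansion, and `x₁⁻¹ - x₂⁻¹ = -(x₁ - x₂) / (x₁ x₂)`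
accounts for the sign `(-1) ^ l` and for the shift of both indices by `l`. -/
theorem jacP_reflect (Q : ℤ → ℤ → E) (c d l m n : ℤ) :
    jacP l (fun m n => Q (c - m) (d - n)) m n
      = (-1 : ℂ) ^ l • jacQ l Q (c - m - l) (d - n - l) := by
  rw [jacQ, smul_smul, neg_one_zpow_mul_self, one_smul]
  refine bsum_congr fun i => ?_
  simp only [show c - (l + m - (i : ℤ)) = c - m - l + i by ring,
    show d - (n + (i : ℤ)) = l + (d - n - l) - i by ring]

theorem jacQ_reflect (P : ℤ → ℤ → E) (c d l m n : ℤ) :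
    jacQ l (fun m n => P (c - m) (d - n)) m n
      = (-1 : ℂ) ^ l • jacP l P (c - m - l) (d - n - l) := by
  rw [jacQ, jacP_reflect (fun n m => P m n) d c, jacQ, smul_smul (_ ^ l) (_ ^ l),
    neg_one_zpow_mul_self, one_smul]

theorem IsJacobi.reflect {P Q R : ℤ → ℤ → E} (h : IsJacobi P Q R) (c d l m n : ℤ) :
    jacP l (fun m n => Q (c - m) (d - n)) m n - jacQ l (fun m n => P (c - m) (d - n)) m n
      = -((-1 : ℂ) ^ l • jacR R l (c - m - l) (d - n - l)) := by
  rw [jacP_reflect, jacQ_reflect, ← smul_sub, ← h, ← smul_neg, neg_sub]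

theorem jacR_reflect_succ {R : ℤ → ℤ → E} (hR : EvZero atTop R) (c d l m n : ℤ) :
    (-1 : ℂ) ^ (l + 1) • jacR R (l + 1) (c - m - (l + 1)) (d - n - (l + 1))
      = (-1 : ℂ) ^ l • jacR R l (c - (m + 1) - l) (d - n - l)
        - (-1 : ℂ) ^ l • jacR R l (c - m - l) (d - (n + 1) - l) := by
  rw [jacR_succ hR, diffShift_apply, zpow_add_one₀ (by norm_num), mul_neg, mul_one, neg_smul,
    smul_sub, neg_sub, show c - m - (l + 1) + 1 = c - m - l by ring,
    show d - n - (l + 1) + 1 = d - n - l by ring, show c - m - (l + 1) = c - (m + 1) - l by ring,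
    show d - n - (l + 1) = d - (n + 1) - l by ring]

theorem exists_jacR_eq_zero {R : ℤ → ℤ → E} (hR : EvZero atTop R) :
    ∃ L : ℤ, ∀ l, L ≤ l → jacR R l = 0 := by
  obtain ⟨L, hL⟩ := eventually_atTop.1 hR
  refine ⟨L, fun l hl => funext fun m => funext fun n => ?_⟩
  rw [jacR, Pi.zero_apply, Pi.zero_apply, ← bsum_zero_fun (E := E) m]
  exact bsum_congr fun i => by rw [hL _ (by omega)]; rfl

end Linear

/-! ### The Jacobi identity for the opposite operators. -/

section OppositeJacobi

variable {V M : Type*} [AddCommGroup V] [Module ℂ V] [AddCommGroup M] [Module ℂ M]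
  {A : VertexOperatorAlgebra V} {G : FieldMap V M}

/-- The value at `m = 0` of the third term of the Jacobi identity for the opposite operators. -/
theorem oppositeField_mode {hu hv : ℤ} {u v : V} (hu' : u ∈ A.grade hu) (hv' : v ∈ A.grade hv)
    {J K : ℕ} (hJ : ∀ j, J ≤ j → lowering A j u = 0) (hK : ∀ k, K ≤ k → lowering A k v = 0)
    (l n : ℤ) (a : M) :
    oppositeField A G (A.Y u l v) n a = ((-1 : ℂ) ^ hu * (-1 : ℂ) ^ hv) •
      ∑ j ∈ Finset.range J, ∑ k ∈ Finset.range K, -((-1 : ℂ) ^ l •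
        jacR (fun r n => G (A.Y (lowering A j u) r (lowering A k v)) n a) l
          (2 * hu - j - 2 - 0 - l) (2 * hv - k - 2 - n - l)) := by
  have hfin : ∀ᶠ i : ℕ in atTop, ∀ j ∈ Finset.range J, ∀ k ∈ Finset.range K,
      A.Y (lowering A j u) (l + i) (lowering A k v) = 0 :=
    (Finset.eventually_all _).2 fun j _ => (Finset.eventually_all _).2 fun k _ =>
      (truncation_evZero A.adjoint.truncation _ _).nat_cast l
  obtain ⟨I, hI⟩ := eventually_atTop.1 hfin
  let X : ℕ → ℕ → ℕ → V := fun j i k => ((Ring.choose (2 * hu - j - l - 2) i : ℤ) : ℂ) •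
    A.Y (lowering A j u) (l + i) (lowering A k v)
  have hX1 : ∀ j i k, J ≤ j → X j i k = 0 := fun j i k h => by simp [X, hJ j h]
  have hX3 : ∀ j i k, K ≤ k → X j i k = 0 := fun j i k h => by simp [X, hK k h]
  have hX2 : ∀ j i k, I ≤ i → X j i k = 0 := fun j i k h => by
    by_cases h1 : J ≤ j
    · exact hX1 j i k h1
    by_cases h3 : K ≤ k
    · exact hX3 j i k h3
    simp only [X]
    rw [hI i h j (by simpa using h1) k (by simpa using h3), smul_zero]
  have hlow : ∀ p, lowering A p (A.Y u l v) = tripleSum p X := lowering_mode hu' l v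
  have hnil : ∀ p, J + (I + K) ≤ p → lowering A p (A.Y u l v) = 0 := by
    intro p hp
    rw [hlow]
    refine Finset.sum_eq_zero fun x hx => Finset.sum_eq_zero fun y hy => ?_
    rw [Finset.HasAntidiagonal.mem_antidiagonal] at hx hy
    by_cases h1 : J ≤ x.1
    · exact hX1 _ _ _ h1
    by_cases h2 : I ≤ y.1
    · exact hX2 _ _ _ h2
    exact hX3 _ _ _ (by omega)
  rw [oppositeField_of_mem G (weight_mode hu' hv' l) hnil, LinearMap.smul_apply,
    LinearMap.sum_apply]
  let F : ℕ → ℕ → ℕ → M := fun j i k =>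
    G (X j i k) (2 * (hu + hv - l - 1) - ((j + i + k : ℕ) : ℤ) - n - 2) a
  have e1 : ∀ p : ℕ, G (lowering A p (A.Y u l v)) (2 * (hu + hv - l - 1) - p - n - 2) a
      = tripleSum p F := by
    intro p
    rw [hlow]
    refine (map_tripleSum p X ((LinearMap.applyₗ a).comp ((LinearMap.proj
      (2 * (hu + hv - l - 1) - p - n - 2) : (ℤ → Module.End ℂ M) →ₗ[ℂ] _).comp G))).trans ?_
    refine tripleSum_congr fun j i k h => ?_
    simp only [F, h]
    rfl
  simp only [e1]
  rw [sum_tripleSum (fun j i k h => by simp [F, hX1 j i k h])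
    (fun j i k h => by simp [F, hX2 j i k h]) (fun j i k h => by simp [F, hX3 j i k h])]
  have e2 : (-1 : ℂ) ^ (hu + hv - l - 1) = -((-1 : ℂ) ^ hu * (-1 : ℂ) ^ hv * (-1 : ℂ) ^ l) := by
    have hm : (-1 : ℂ) ≠ 0 := by norm_num
    rw [zpow_sub₀ hm, zpow_sub₀ hm, zpow_add₀ hm, zpow_one, div_neg, div_one,
      div_eq_mul_inv, ← eq_inv_of_mul_eq_one_left (neg_one_zpow_mul_self l)]
  rw [e2, neg_smul, mul_smul, ← smul_neg, Finset.smul_sum, ← Finset.sum_neg_distrib]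
  congr 1
  refine Finset.sum_congr rfl fun j hj => ?_
  rw [Finset.sum_comm, Finset.smul_sum, ← Finset.sum_neg_distrib]
  refine Finset.sum_congr rfl fun k hk => ?_
  congr 2
  rw [jacR, bsum_eq_sum (I := I) fun i hi => by rw [hI i hi j hj k hk]; simp]
  refine Finset.sum_congr rfl fun i _ => ?_
  simp only [F, X, map_smul, Pi.smul_apply, LinearMap.smul_apply]
  rw [show 2 * hu - (j : ℤ) - 2 - 0 - l = 2 * hu - j - l - 2 by ring,
    show 2 * (hu + hv - l - 1) - ((j + i + k : ℕ) : ℤ) - n - 2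
      = 2 * hu - j - l - 2 + (2 * hv - k - 2 - n - l) - i by push_cast; ring]

/-- By definition, opposite operators are signed sums over divided powers `j`, `k` of `L(1)` with
indices reflected at `c` and `d`. Reflection swaps the two product terms, so the reversed identity
of each pair `(j, k)` contributes to the usual one; what remains is the third term. -/
theorem oppositeField_jacobi_of_mem (hG : OppTruncation G) (hJac : OppJacobi A.Y G) {hu hv : ℤ}
    {u v : V} (hu' : u ∈ A.grade hu) (hv' : v ∈ A.grade hv) (a : M) :
    IsJacobi (fun m n => oppositeField A G u m (oppositeField A G v n a))
      (fun m n => oppositeField A G v n (oppositeField A G u m a))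
      (fun j n => oppositeField A G (A.Y u j v) n a) := by
  obtain ⟨J, hJ⟩ := lowering_nilpotent (A := A) u
  obtain ⟨K, hK⟩ := lowering_nilpotent (A := A) v
  set s := (-1 : ℂ) ^ hu * (-1 : ℂ) ^ hv with hs
  let I := Finset.range J ×ˢ Finset.range K
  let P : ℕ × ℕ → ℤ → ℤ → M := fun x m n => G (lowering A x.2 v) n (G (lowering A x.1 u) m a)
  let Q : ℕ × ℕ → ℤ → ℤ → M := fun x m n => G (lowering A x.1 u) m (G (lowering A x.2 v) n a)
  let R : ℕ × ℕ → ℤ → ℤ → M := fun x r n =>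
    G (A.Y (lowering A x.1 u) r (lowering A x.2 v)) n a
  let c : ℕ × ℕ → ℤ := fun x => 2 * hu - x.1 - 2
  let d : ℕ × ℕ → ℤ := fun x => 2 * hv - x.2 - 2
  have hR : ∀ x, EvZero atTop (R x) := fun x =>
    truncation_evZero_iterate A.adjoint.truncation G _ _ a
  have hRD := truncation_evZero_iterate A.adjoint.truncation (oppositeField A G) u v a
  have eP : (fun m n => oppositeField A G u m (oppositeField A G v n a))
      = s • ∑ x ∈ I, fun m n => Q x (c x - m) (d x - n) := by
    funext m n
    simp only [Pi.smul_apply, Finset.sum_apply]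
    rw [oppositeField_of_mem G hu' hJ, oppositeField_of_mem G hv' hK, Finset.sum_product, hs,
      mul_smul]
    simp only [LinearMap.smul_apply, LinearMap.sum_apply, map_smul, map_sum, Finset.smul_sum, Q, c, d]
    rw [Finset.sum_comm]
    refine Finset.sum_congr rfl fun j _ => Finset.sum_congr rfl fun k _ => ?_
    rw [show 2 * hu - (j : ℤ) - m - 2 = 2 * hu - j - 2 - m by ring,
      show 2 * hv - (k : ℤ) - n - 2 = 2 * hv - k - 2 - n by ring, smul_comm]
  have eQ : (fun m n => oppositeField A G v n (oppositeField A G u m a))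
      = s • ∑ x ∈ I, fun m n => P x (c x - m) (d x - n) := by
    funext m n
    simp only [Pi.smul_apply, Finset.sum_apply]
    rw [oppositeField_of_mem G hu' hJ, oppositeField_of_mem G hv' hK, Finset.sum_product_right, hs,
      mul_smul]
    simp only [LinearMap.smul_apply, LinearMap.sum_apply, map_smul, map_sum, Finset.smul_sum, P, c, d]
    rw [Finset.sum_comm]
    refine Finset.sum_congr rfl fun k _ => Finset.sum_congr rfl fun j _ => ?_
    rw [show 2 * hu - (j : ℤ) - m - 2 = 2 * hu - j - 2 - m by ring,
      show 2 * hv - (k : ℤ) - n - 2 = 2 * hv - k - 2 - n by ring]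
  let T : ℤ → ℤ → ℤ → M := fun l m n =>
    s • ∑ x ∈ I, -((-1 : ℂ) ^ l • jacR (R x) l (c x - m - l) (d x - n - l))
  -- Both families satisfy the recursion in `l` and vanish for large `l`, so it suffices to compare
  -- the column `m = 0`. There `oppositeField_mode` evaluates the opposite operator of a product of
  -- vectors.
  have hT : jacR (fun j n => oppositeField A G (A.Y u j v) n a) = T := by
    have h0 : ∀ l n, jacR (fun j n => oppositeField A G (A.Y u j v) n a) l 0 n = T l 0 n := by
      intro l n
      rw [jacR_zero_left, oppositeField_mode hu' hv' hJ hK]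
      simp only [T, I, Finset.sum_product]
      rfl
    obtain ⟨L, hL⟩ := exists_jacR_eq_zero hRD
    choose L' hL' using fun x => exists_jacR_eq_zero (hR x)
    have hx : ∀ᶠ l in atTop, ∀ x ∈ I, L' x ≤ l :=
      (Finset.eventually_all _).2 fun x _ => eventually_ge_atTop _
    obtain ⟨l₀, h1, h2⟩ := (hx.and (eventually_ge_atTop L)).exists
    refine diffShift_family_unique (fun l => jacR_succ hRD l) (fun l => ?_) (fun l hl => ?_) l₀ ?_
    · funext m n
      simp only [T, diffShift_apply]
      rw [← smul_sub, ← Finset.sum_sub_distrib]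
      congr 1
      refine Finset.sum_congr rfl fun x _ => ?_
      rw [jacR_reflect_succ (hR x)]
      abel
    · refine eq_zero_of_diffShift hl 0 fun n => ?_
      rw [Pi.sub_apply, Pi.sub_apply, h0, sub_self]
    · rw [hL l₀ h2]
      funext m n
      simp only [T]
      rw [Finset.sum_eq_zero, smul_zero]
      · rfl
      · intro x hx
        rw [hL' x l₀ (h1 x hx)]
        simp
  intro l m n
  have hPt : ∀ x, AntiFin fun m n => Q x (c x - m) (d x - n) := fun x =>
    AntiFin.reflect (hG.botTrunc (lowering A x.2 v) (lowering A x.1 u) a).antiFin _ _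
  have hQt : ∀ x, AntiFin fun n m => P x (c x - m) (d x - n) := fun x =>
    AntiFin.reflect (Q := fun n m => P x m n)
      (hG.botTrunc (lowering A x.1 u) (lowering A x.2 v) a).antiFin _ _
  rw [hT, eP, eQ, jacP_smul, jacQ_smul, (AntiFin.sum I hPt l).2, jacQ_sum I hQt]
  simp only [Pi.smul_apply, Finset.sum_apply]
  rw [← smul_sub, ← Finset.sum_sub_distrib]
  congr 1
  refine Finset.sum_congr rfl fun x _ => ?_
  exact IsJacobi.reflect (hJac (lowering A x.1 u) (lowering A x.2 v) a) _ _ _ _ _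

theorem oppositeField_jacobi (hG : OppTruncation G) (hJac : OppJacobi A.Y G) :
    Jacobi A.Y (oppositeField A G) := by
  refine jacobi_iff.2 fun u v a => ?_
  have ht := oppositeField_truncation (A := A) hG
  have hT := truncation_topTrunc ht ht
  have hR := truncation_evZero_iterate A.adjoint.truncation (oppositeField A G)
  have h0 : IsJacobi (0 : ℤ → ℤ → M) 0 0 := fun l m n => by simp [jacP, jacQ, jacR]
  induction u using homogeneous_induction (A := A) with
  | zero =>
    simp only [map_zero, Pi.zero_apply, LinearMap.zero_apply]
    exact h0
  | add u u' hu hu' =>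
    have := hu.add hu' (hT _ _ _).antiFin (hT _ _ _).antiFin (hT _ _ _).antiFin (hT _ _ _).antiFin
      (hR _ _ _) (hR _ _ _)
    convert this using 1 <;>
    · funext m n
      simp
  | mem hu u hu' =>
    induction v using homogeneous_induction (A := A) with
    | zero =>
    simp only [map_zero, Pi.zero_apply, LinearMap.zero_apply]
    exact h0
    | add v v' hv hv' =>
      have := hv.add hv' (hT _ _ _).antiFin (hT _ _ _).antiFin (hT _ _ _).antiFin
        (hT _ _ _).antiFin (hR _ _ _) (hR _ _ _)
      convert this using 1 <;>
      · funext m n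
        simp
    | mem hv v hv' => exact oppositeField_jacobi_of_mem hG hJac hu' hv' a

end OppositeJacobi

/-! ### The derivative and Virasoro axioms as consequences of the Jacobi identity and the vacuum
axiom. -/

section WeakModule

theorem choose_neg_one (i : ℕ) : Ring.choose (-1 : ℤ) i = (-1) ^ i := by
  induction i with
  | zero => simp
  | succ i ih =>
    have h := Ring.choose_succ_succ (-1 : ℤ) i
    rw [neg_add_cancel, Ring.choose_zero_succ, ih] at h
    rw [pow_succ]
    linear_combination -h

theorem choose_neg_two (i : ℕ) : Ring.choose (-2 : ℤ) i = (-1) ^ i * (i + 1) := by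
  induction i with
  | zero => simp
  | succ i ih =>
    have h := Ring.choose_succ_succ (-2 : ℤ) i
    rw [show (-2 : ℤ) + 1 = -1 by norm_num, choose_neg_one, ih] at h
    push_cast
    rw [pow_succ] at h ⊢
    linear_combination -h

variable {V M : Type*} [AddCommGroup V] [Module ℂ V] [AddCommGroup M] [Module ℂ M]
  {A : VertexOperatorAlgebra V} {G : FieldMap V M}

theorem L_neg_one_eq (v : V) : A.Y A.omega 0 v = A.Y v (-2) A.vac := by
  have h := LinearMap.congr_fun (A.adjoint.derivative v (-1)) A.vac
  rw [A.creation_lim] at h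
  rw [h]
  simp

/-- As `L(-1) v = v_{-2} 𝟏`, the Jacobi identity is used for `v` and `𝟏` with `l = -2`, `m = 0`.
Only the mode `-1` of `𝟏` acts, so each product sum has at most one nonzero term: the first for `n <
0`, the second for `n > 0`. -/
theorem derivative_of_jacobi (hJ : Jacobi A.Y G)
    (hvac : ∀ n : ℤ, G A.vac n = if n = -1 then 1 else 0) (v : V) (n : ℤ) :
    G (A.Y A.omega 0 v) n = (-n : ℂ) • G v (n - 1) := by
  refine LinearMap.ext fun w => ?_
  have h := jacobi_iff.1 hJ v A.vac w (-2) 0 n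
  rw [jacR_zero_left] at h
  rw [L_neg_one_eq, ← h]
  have hc : ∀ i : ℕ, ((Ring.choose (-2 : ℤ) i : ℤ) : ℂ) * (-1) ^ i = i + 1 := by
    intro i
    rw [choose_neg_two]
    push_cast
    rw [mul_right_comm, ← mul_pow]
    simp
  have e1 : jacP (-2) (fun m n => G v m (G A.vac n w)) 0 n
      = if n < 0 then (-n : ℂ) • G v (n - 1) w else 0 := by
    simp only [jacP, bsum, smul_smul, hc, hvac]
    split_ifs with hn
    · rw [finsum_eq_single _ (-1 - n).toNat]
      · rw [if_pos (by omega)]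
        have : (((-1 - n).toNat : ℕ) : ℂ) = -1 - n := by
          have : (((-1 - n).toNat : ℕ) : ℤ) = -1 - n := by omega
          exact_mod_cast congrArg (Int.cast : ℤ → ℂ) this
        rw [this, show (-2 : ℤ) + 0 - ((-1 - n).toNat : ℕ) = n - 1 by omega]
        simp only [Module.End.one_apply]
        congr 1
        ring
      · intro i hi
        rw [if_neg (by omega)]
        simp
    · refine finsum_eq_zero_of_forall_eq_zero fun i => ?_
      rw [if_neg (by omega)]
      simp
  have e2 : jacQ (-2) (fun m n => G A.vac n (G v m w)) 0 n
      = if 0 < n then (n : ℂ) • G v (n - 1) w else 0 := by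
    have hs : (-1 : ℂ) ^ (-2 : ℤ) = 1 := by norm_num
    simp only [jacQ, hs, one_smul, jacP, bsum, smul_smul, hc, hvac]
    split_ifs with hn
    · rw [finsum_eq_single _ (n - 1).toNat]
      · rw [if_pos (by omega)]
        have : (((n - 1).toNat : ℕ) : ℂ) = n - 1 := by
          have : (((n - 1).toNat : ℕ) : ℤ) = n - 1 := by omega
          exact_mod_cast congrArg (Int.cast : ℤ → ℂ) this
        rw [this, show (0 : ℤ) + ((n - 1).toNat : ℕ) = n - 1 by omega]
        simp
      · intro i hi
        rw [if_neg (by omega)]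
        simp
    · refine finsum_eq_zero_of_forall_eq_zero fun i => ?_
      rw [if_neg (by omega)]
      simp
  rw [e1, e2, LinearMap.smul_apply]
  rcases lt_trichotomy n 0 with hn | rfl | hn
  · rw [if_pos hn, if_neg (by omega), sub_zero]
  · simp
  · rw [if_neg (by omega), if_pos hn, zero_sub, neg_smul]

/-- Since `ω = L(-2) 𝟏`, the commutator of `L(k)` with `L(-2)` is applied to the vacuum, where only
its central term survives. -/
theorem omega_mode (k : ℤ) (hk : 1 ≤ k) :
    A.Y A.omega (k + 1) A.omega = (if k = 2 then A.rank / 2 else 0) • A.vac := by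
  have hv : A.Y A.omega (-1) A.vac = A.omega := A.creation_lim A.omega
  have h := LinearMap.congr_fun (A.adjoint.virasoro k (-2)) A.vac
  rw [show (-2 : ℤ) + 1 = -1 by norm_num] at h
  simp only [LinearMap.sub_apply, Module.End.mul_apply, LinearMap.add_apply, LinearMap.smul_apply,
    hv, A.creation A.omega (k + 1) (by omega), map_zero, sub_zero, Module.End.one_apply,
    A.creation A.omega (k + -2 + 1) (by omega), smul_zero, zero_add] at h
  rw [h]
  congr 1
  by_cases h2 : k = 2
  · subst h2
    norm_num
    ring
  · rw [if_neg (by omega), if_neg h2]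

/-- The commutator formula for `ω` with itself has only the terms `ω_0 ω = L(-1) ω`, `ω_1 ω = 2 ω`
and `ω_3 ω`, the latter being half the rank times the vacuum. -/
theorem virasoro_of_jacobi (hJ : Jacobi A.Y G)
    (hvac : ∀ n : ℤ, G A.vac n = if n = -1 then 1 else 0) (m n : ℤ) :
    G A.omega (m + 1) * G A.omega (n + 1) - G A.omega (n + 1) * G A.omega (m + 1)
      = ((m : ℂ) - n) • G A.omega (m + n + 1)
        + (if m + n = 0 then (((m : ℂ) ^ 3 - m) / 12) * A.rank else 0) • (1 : Module.End ℂ M) := by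
  refine LinearMap.ext fun w => ?_
  have h2 : A.Y A.omega ((2 : ℕ) : ℤ) A.omega = 0 := by
    have := omega_mode (A := A) 1 le_rfl
    rwa [if_neg (by norm_num), zero_smul] at this
  have h3 : A.Y A.omega ((3 : ℕ) : ℤ) A.omega = (A.rank / 2) • A.vac := by
    have := omega_mode (A := A) 2 (by norm_num)
    rwa [if_pos rfl] at this
  have h4 : ∀ i : ℕ, 4 ≤ i → A.Y A.omega i A.omega = 0 := fun i hi => by
    have := omega_mode (A := A) (i - 1) (by omega)
    rwa [if_neg (by omega), zero_smul, sub_add_cancel] at this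
  simp only [LinearMap.sub_apply, Module.End.mul_apply]
  rw [hJ.commutator A.omega A.omega w (m + 1) (n + 1), add_sub_cancel_left,
    bsum_eq_sum (I := 4) fun i hi => by rw [h4 i hi]; simp]
  simp only [Finset.sum_range_succ, Finset.sum_range_zero, zero_add]
  rw [h2, h3, Nat.cast_zero, Nat.cast_one, A.weight 2 _ A.omega_mem, derivative_of_jacobi hJ hvac]
  have c2 := succ_mul_choose_succ (m + 1) 1
  have c3 := succ_mul_choose_succ (m + 1) 2
  rw [Ring.choose_one_right] at c2
  have c2' : (2 : ℂ) * ((Ring.choose (m + 1) 2 : ℤ) : ℂ) = m * (m + 1) := by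
    have := congrArg (Int.cast : ℤ → ℂ) c2
    push_cast at this
    linear_combination this
  have c3' : (3 : ℂ) * ((Ring.choose (m + 1) 3 : ℤ) : ℂ)
      = (m - 1) * ((Ring.choose (m + 1) 2 : ℤ) : ℂ) := by
    have := congrArg (Int.cast : ℤ → ℂ) c3
    push_cast at this
    linear_combination this
  have c4 : ((Ring.choose (m + 1) 3 : ℤ) : ℂ) * (A.rank / 2)
      = ((m : ℂ) ^ 3 - m) / 12 * A.rank := by
    linear_combination (A.rank / 6) * c3' + (A.rank * (m - 1) / 12) * c2'
  simp only [map_smul, map_zero, Pi.smul_apply, Pi.zero_apply, LinearMap.smul_apply,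
    LinearMap.zero_apply, smul_zero, add_zero, Ring.choose_zero_right, Ring.choose_one_right,
    LinearMap.add_apply, hvac, smul_smul, c4]
  rw [show m + 1 + (n + 1) - 0 - 1 = m + n + 1 by ring,
    show m + 1 + (n + 1) - 1 = m + n + 1 by ring]
  by_cases hmn : m + n = 0
  · rw [if_pos hmn, if_pos (by push_cast; omega)]
    push_cast
    module
  · rw [if_neg hmn, if_neg (by push_cast; omega)]
    simp only [LinearMap.zero_apply, smul_zero, zero_smul, add_zero]
    push_cast
    module

/-- The derivative property and the Virasoro relations follow from the other axioms. -/
theorem isWeakModule_of_jacobi (ht : Truncation G) (hJ : Jacobi A.Y G)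
    (hvac : ∀ n : ℤ, G A.vac n = if n = -1 then 1 else 0) : IsWeakModule A.toVertexData G where
  truncation := ht
  vacuum := hvac
  jacobi := hJ
  virasoro := virasoro_of_jacobi hJ hvac
  derivative := derivative_of_jacobi hJ hvac

theorem oppositeField_vacuum (hvac : ∀ n : ℤ, G A.vac n = if n = -1 then 1 else 0) (n : ℤ) :
    oppositeField A G A.vac n = if n = -1 then 1 else 0 := by
  have hJ : ∀ j, 1 ≤ j → lowering A j A.vac = 0 := by
    intro j hj
    obtain ⟨i, rfl⟩ := Nat.exists_eq_add_of_le' hj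
    rw [lowering, LinearMap.smul_apply, pow_succ, Module.End.mul_apply, A.creation _ 2 (by norm_num),
      map_zero, smul_zero]
  rw [oppositeField_of_mem G A.vac_mem hJ]
  simp only [Finset.sum_range_one, lowering_zero, Module.End.one_apply, hvac, zpow_zero, one_smul,
    Nat.cast_zero]
  congr 1
  exact propext ⟨fun h => by omega, fun h => by omega⟩

end WeakModule

/-! ### The vacuum axiom for the two actions. -/

namespace QSetting

variable {V W : Type*} [AddCommGroup V] [Module ℂ V] [AddCommGroup W] [Module ℂ W]
  {Yv : FieldMap V V} {Y : FieldMap V W} {z : ℂ} (S : QSetting Yv Y z)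
include S

/-- The series attached to the vacuum is the constant `α`: translation of the variable fixes it, and
it has no residue at `y = 0`. -/
theorem coe_leftField_vacuum {vac : V} (hvac : ∀ n : ℤ, Y vac n = if n = -1 then 1 else 0)
    (α : Module.Dual ℂ W) :
    (∀ n, 0 ≤ n → dualSeq Y vac α n = 0) ∧ ∀ n,
      reexpand z (inftyExp z (dualSeq Y vac α)) n = if n = -1 then α else 0 := by
  have e : dualSeq Y vac α = fun n => LinearMap.toSpanSingleton ℂ _ α (polySeq 1 n) := by
    funext n
    refine LinearMap.ext fun w => ?_
    rw [dualSeq_apply, hvac, polySeq_one]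
    split_ifs with hn <;> simp [hn]
  have hev : EvZero atBot (dualSeq Y vac α) := by
    rw [e]
    exact (polySeq_evZero_atBot 1).map _
  refine ⟨fun n hn => ?_, fun n => ?_⟩
  · rw [e, polySeq_one]
    simp only
    rw [if_neg (by omega), map_zero]
  · rw [inftyExp_eq (l := 0) hev rfl, e, reexpand_map (polySeq_evZero_atBot 1), reexpand_polySeq_one,
      polySeq_one]
    simp only
    split_ifs <;> simp

theorem leftField_vacuum {vac : V} (hvac : ∀ n : ℤ, Y vac n = if n = -1 then 1 else 0) (n : ℤ) :
    S.leftField vac n = if n = -1 then 1 else 0 := by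
  refine LinearMap.ext fun α => Subtype.ext ?_
  rw [S.coe_leftField, (S.coe_leftField_vacuum hvac α).2]
  split_ifs <;> rfl

theorem rightField_vacuum {vac : V} (hvac : ∀ n : ℤ, Y vac n = if n = -1 then 1 else 0) (n : ℤ) :
    S.rightField vac n = if n = -1 then 1 else 0 := by
  refine LinearMap.ext fun α => Subtype.ext (LinearMap.ext fun w => ?_)
  obtain ⟨h0, h1⟩ := S.coe_leftField_vacuum hvac (α : Module.Dual ℂ W)
  have e : reexpandZero z (fun k => dualSeq Y vac α k w) n = 0 := by
    rw [reexpandZero, ← bsum_zero_fun (E := ℂ) n]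
    refine bsum_congr fun i => ?_
    rw [h0 i (by omega), LinearMap.zero_apply, smul_zero]
  rw [S.rightField_apply_apply, zeroVal, expDiff, h1, e, sub_zero]
  split_ifs <;> rfl

end QSetting

/-! ### Characterisation of the actions, their module structures and their commutation. -/

section Actions

variable {V W : Type*} [AddCommGroup V] [Module ℂ V] [AddCommGroup W] [Module ℂ W]
  {A : VertexOperatorAlgebra V} {Y : FieldMap V W} {z : ℂ} (S : QSetting A.Y Y z)
include S

/-- The defining condition prescribes the opposite field of `YL`; since taking opposites is an
involution, it has exactly one solution. -/
theorem isLeftAction_iff {YL : FieldMap V (DQ Y z)} :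
    IsLeftAction A Y z YL ↔ YL = oppositeField A S.leftField := by
  have h : IsLeftAction A Y z YL ↔ oppositeField A YL = S.leftField := by
    constructor
    · intro h
      refine LinearMap.ext fun v => funext fun n => LinearMap.ext fun α => Subtype.ext
        (LinearMap.ext fun w => ?_)
      rw [S.leftField_eq_iotaInfty]
      exact h v n α w
    · intro h v n α w
      rw [← oppositeField_apply, h, S.leftField_eq_iotaInfty]
  rw [h]
  constructor
  · rintro h
    rw [← h, oppositeField_involutive]
  · rintro rfl
    exact oppositeField_involutive _

theorem isRightAction_iff {YR : FieldMap V (DQ Y z)} :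
    IsRightAction Y z YR ↔ YR = S.rightField := by
  constructor
  · intro h
    refine LinearMap.ext fun v => funext fun n => LinearMap.ext fun α => Subtype.ext
      (LinearMap.ext fun w => ?_)
    rw [S.rightField_eq_iotaZero]
    exact h v n α w
  · rintro rfl
    exact S.rightField_eq_iotaZero

theorem leftAction_isWeakModule (hvac : ∀ n : ℤ, Y A.vac n = if n = -1 then 1 else 0) :
    IsWeakModule A.toVertexData (oppositeField A S.leftField) :=
  isWeakModule_of_jacobi (oppositeField_truncation S.leftField_oppTruncation)
    (oppositeField_jacobi S.leftField_oppTruncation S.leftField_oppJacobi)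
    (oppositeField_vacuum (S.leftField_vacuum hvac))

theorem rightAction_isWeakModule (hvac : ∀ n : ℤ, Y A.vac n = if n = -1 then 1 else 0) :
    IsWeakModule A.toVertexData S.rightField :=
  isWeakModule_of_jacobi S.rightField_truncation S.rightField_jacobi (S.rightField_vacuum hvac)

theorem commute_leftAction_rightAction (u v : V) (m n : ℤ) :
    Commute (oppositeField A S.leftField u m) (S.rightField v n) := by
  induction u using homogeneous_induction (A := A) with
  | zero => simp
  | add u u' hu hu' =>
    rw [map_add, Pi.add_apply]
    exact hu.add_left hu'
  | mem h u hu =>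
    obtain ⟨J, hJ⟩ := lowering_nilpotent (A := A) u
    rw [oppositeField_of_mem _ hu hJ]
    have h : ∀ (u : V) (m : ℤ), Commute (S.leftField u m) (S.rightField v n) := fun u m =>
      LinearMap.ext fun α => S.leftField_comm_rightField u v m n α
    exact (Commute.sum_left _ _ _ fun j _ => h _ _).smul_left _

end Actions

/-! ### Products of Jacobi triples, term by term. -/

section Convolution

variable {E E' E'' : Type*} [AddCommGroup E] [Module ℂ E] [AddCommGroup E'] [Module ℂ E']
  [AddCommGroup E''] [Module ℂ E''] {μ : E →ₗ[ℂ] E' →ₗ[ℂ] E''}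

/-! ### Products of Jacobi triples -/

/-- Modes of the product of two series in `x₁, x₂`. -/
def conv₂ (μ : E →ₗ[ℂ] E' →ₗ[ℂ] E'') (P : ℤ → ℤ → E) (P' : ℤ → ℤ → E') (m n : ℤ) : E'' :=
  ∑ᶠ x : ℤ × ℤ, μ (P x.1 x.2) (P' (m - 1 - x.1) (n - 1 - x.2))

/-- Finiteness of the sums `conv₂`. -/
def ConvFin (μ : E →ₗ[ℂ] E' →ₗ[ℂ] E'') (P : ℤ → ℤ → E) (P' : ℤ → ℤ → E') : Prop :=
  ∀ m n : ℤ, (Function.support fun x : ℤ × ℤ =>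
    μ (P x.1 x.2) (P' (m - 1 - x.1) (n - 1 - x.2))).Finite

theorem conv₂_swap (P : ℤ → ℤ → E) (P' : ℤ → ℤ → E') (m n : ℤ) :
    conv₂ μ (fun n m => P m n) (fun n m => P' m n) n m = conv₂ μ P P' m n :=
  finsum_comp_equiv (Equiv.prodComm ℤ ℤ)
    (f := fun x => μ (P x.1 x.2) (P' (m - 1 - x.1) (n - 1 - x.2)))

theorem ConvFin.swap {P : ℤ → ℤ → E} {P' : ℤ → ℤ → E'} (h : ConvFin μ P P') :
    ConvFin μ (fun n m => P m n) (fun n m => P' m n) := fun n m =>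
  (h m n).preimage (f := Prod.swap) Prod.swap_injective.injOn

theorem TopTrunc.exists_bounds {P : ℤ → ℤ → E} (hP : TopTrunc P) (a : ℤ) :
    ∃ K : ℤ, ∀ i j, a ≤ j → P i j ≠ 0 → i < K := by
  obtain ⟨N, hN⟩ := eventually_atTop.1 hP.1
  have : ∀ᶠ i in atTop, ∀ j ∈ Finset.Ico a N, P i j = 0 :=
    (Finset.eventually_all _).2 fun j _ => hP.2 j
  obtain ⟨K, hK⟩ := eventually_atTop.1 this
  refine ⟨K, fun i j hj h => ?_⟩
  by_contra hi
  refine h (hK i (not_lt.1 hi) j (Finset.mem_Ico.2 ⟨hj, ?_⟩))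
  by_contra hj'
  exact h (congrFun (hN j (not_lt.1 hj')) i)

theorem TopTrunc.convFin {P : ℤ → ℤ → E} {P' : ℤ → ℤ → E'} (hP : TopTrunc P)
    (hP' : TopTrunc P') : ConvFin μ P P' := by
  intro m n
  obtain ⟨N, hN⟩ := eventually_atTop.1 hP.1
  obtain ⟨N', hN'⟩ := eventually_atTop.1 hP'.1
  obtain ⟨K, hK⟩ := hP.exists_bounds (n - 1 - N')
  obtain ⟨K', hK'⟩ := hP'.exists_bounds (n - 1 - N)
  refine ((Set.finite_Icc (m - 1 - K') K).prod (Set.finite_Icc (n - 1 - N') N)).subset ?_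
  rintro ⟨i, j⟩ hx
  have h1 : P i j ≠ 0 := fun h => hx (by simp [h])
  have h2 : P' (m - 1 - i) (n - 1 - j) ≠ 0 := fun h => hx (by simp [h])
  have h3 : j < N := not_le.1 fun h => h1 (congrFun (hN j h) i)
  have h4 : n - 1 - j < N' := not_le.1 fun h => h2 (congrFun (hN' _ h) _)
  have h5 := hK i j (by omega) h1
  have h6 := hK' _ _ (by omega) h2
  simp only [Set.mem_prod, Set.mem_Icc]
  omega

theorem conv₂_eq_zero {P : ℤ → ℤ → E} {P' : ℤ → ℤ → E'} {N N' : ℤ}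
    (hN : ∀ n, N ≤ n → ∀ m, P m n = 0) (hN' : ∀ n, N' ≤ n → ∀ m, P' m n = 0) {n : ℤ}
    (hn : N + N' ≤ n) (m : ℤ) : conv₂ μ P P' m n = 0 := by
  rw [conv₂, ← finsum_zero (α := ℤ × ℤ)]
  refine finsum_congr fun x => ?_
  rcases le_or_gt N x.2 with h | h
  · simp [hN _ h]
  · rw [hN' (n - 1 - x.2) (by omega), map_zero]

theorem TopTrunc.conv₂ {P : ℤ → ℤ → E} {P' : ℤ → ℤ → E'} (hP : TopTrunc P)
    (hP' : TopTrunc P') : TopTrunc (conv₂ μ P P') := by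
  obtain ⟨N, hN⟩ := eventually_atTop.1 hP.1
  obtain ⟨N', hN'⟩ := eventually_atTop.1 hP'.1
  constructor
  · filter_upwards [eventually_ge_atTop (N + N')] with n hn
    funext m
    exact conv₂_eq_zero (fun n h m => congrFun (hN n h) m) (fun n h m => congrFun (hN' n h) m) hn m
  · intro n
    obtain ⟨K, hK⟩ := hP.exists_bounds (n - 1 - N')
    obtain ⟨K', hK'⟩ := hP'.exists_bounds (n - 1 - N)
    filter_upwards [eventually_ge_atTop (K + K')] with m hm
    rw [VOATheory.conv₂, ← finsum_zero (α := ℤ × ℤ)]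
    refine finsum_congr fun x => ?_
    by_contra hx
    have h1 : P x.1 x.2 ≠ 0 := fun h => hx (by simp [h])
    have h2 : P' (m - 1 - x.1) (n - 1 - x.2) ≠ 0 := fun h => hx (by simp [h])
    have h3 : x.2 < N := not_le.1 fun h => h1 (congrFun (hN _ h) _)
    have h4 : n - 1 - x.2 < N' := not_le.1 fun h => h2 (congrFun (hN' _ h) _)
    have h5 := hK _ _ (by omega) h1
    have h6 := hK' _ _ (by omega) h2
    omega

theorem conv₂_shift (P : ℤ → ℤ → E) (P' : ℤ → ℤ → E') (a b m n : ℤ) :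
    conv₂ μ (fun m n => P (m + a) (n + b)) P' m n = conv₂ μ P P' (m + a) (n + b) := by
  refine Eq.trans ?_ (finsum_comp_equiv ((Equiv.addRight a).prodCongr (Equiv.addRight b)))
  refine finsum_congr fun x => ?_
  simp only [Equiv.prodCongr_apply, Prod.map, Equiv.coe_addRight]
  rw [show m + a - 1 - (x.1 + a) = m - 1 - x.1 by ring,
    show n + b - 1 - (x.2 + b) = n - 1 - x.2 by ring]

theorem conv₂_shift_right (P : ℤ → ℤ → E) (P' : ℤ → ℤ → E') (a b m n : ℤ) :
    conv₂ μ P (fun m n => P' (m + a) (n + b)) m n = conv₂ μ P P' (m + a) (n + b) := by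
  refine finsum_congr fun x => ?_
  rw [show m + a - 1 - x.1 = m - 1 - x.1 + a by ring,
    show n + b - 1 - x.2 = n - 1 - x.2 + b by ring]

theorem ConvFin.shift {P : ℤ → ℤ → E} {P' : ℤ → ℤ → E'} (h : ConvFin μ P P') (a b : ℤ) :
    ConvFin μ (fun m n => P (m + a) (n + b)) P' := by
  intro m n
  have := (h (m + a) (n + b)).preimage
    (f := (Equiv.addRight a).prodCongr (Equiv.addRight b)) (Equiv.injective _).injOn
  refine this.subset fun x hx => ?_
  simp only [Set.mem_preimage, Function.mem_support, Equiv.prodCongr_apply, Prod.map,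
    Equiv.coe_addRight] at hx ⊢
  rwa [show m + a - 1 - (x.1 + a) = m - 1 - x.1 by ring,
    show n + b - 1 - (x.2 + b) = n - 1 - x.2 by ring]

theorem ConvFin.shift_right {P : ℤ → ℤ → E} {P' : ℤ → ℤ → E'} (h : ConvFin μ P P') (a b : ℤ) :
    ConvFin μ P (fun m n => P' (m + a) (n + b)) := by
  intro m n
  refine (h (m + a) (n + b)).subset fun x hx => ?_
  simp only [Function.mem_support] at hx ⊢
  rwa [show m + a - 1 - x.1 = m - 1 - x.1 + a by ring,
    show n + b - 1 - x.2 = n - 1 - x.2 + b by ring]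

theorem conv₂_smul_left (c : ℂ) (P : ℤ → ℤ → E) (P' : ℤ → ℤ → E') :
    conv₂ μ (c • P) P' = c • conv₂ μ P P' := by
  funext m n
  simp only [conv₂, Pi.smul_apply, map_smul, LinearMap.smul_apply]
  exact (smul_finsum c _).symm

theorem conv₂_smul_right (c : ℂ) (P : ℤ → ℤ → E) (P' : ℤ → ℤ → E') :
    conv₂ μ P (c • P') = c • conv₂ μ P P' := by
  funext m n
  simp only [conv₂, Pi.smul_apply, map_smul]
  exact (smul_finsum c _).symm

/-- Multiplication by the sum of `c` times the shift `(a, b)` and the shift `(a', b')`. -/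
def pairShift (c : ℂ) (a b a' b' : ℤ) (P : ℤ → ℤ → E) : ℤ → ℤ → E :=
  fun m n => P (m + a) (n + b) + c • P (m + a') (n + b')

theorem conv₂_pairShift {P : ℤ → ℤ → E} {P' : ℤ → ℤ → E'} (h : ConvFin μ P P')
    (c : ℂ) (a b a' b' : ℤ) :
    conv₂ μ (pairShift c a b a' b' P) P' = pairShift c a b a' b' (conv₂ μ P P') := by
  funext m n
  rw [pairShift, ← conv₂_shift, ← conv₂_shift, conv₂, conv₂, conv₂, smul_finsum,
    ← finsum_add_distrib (h.shift a b m n)]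
  · refine finsum_congr fun x => ?_
    simp [pairShift]
  · exact (h.shift a' b' m n).subset (Function.support_const_smul_subset c _)

theorem conv₂_pairShift_right {P : ℤ → ℤ → E} {P' : ℤ → ℤ → E'} (h : ConvFin μ P P')
    (c : ℂ) (a b a' b' : ℤ) :
    conv₂ μ P (pairShift c a b a' b' P') = pairShift c a b a' b' (conv₂ μ P P') := by
  funext m n
  rw [pairShift, ← conv₂_shift_right, ← conv₂_shift_right, conv₂, conv₂, conv₂, smul_finsum,
    ← finsum_add_distrib (h.shift_right a b m n)]
  · refine finsum_congr fun x => ?_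
    simp [pairShift]
  · exact (h.shift_right a' b' m n).subset (Function.support_const_smul_subset c _)

theorem diffShift_eq_pairShift (P : ℤ → ℤ → E) : diffShift P = pairShift (-1) 1 0 0 1 P := by
  funext m n
  simp [diffShift_apply, pairShift, sub_eq_add_neg]

/-- For nonnegative exponents the factors `x₁ - x₂` are polynomials and can be distributed over the
two series one at a time. -/
theorem conv₂_jacP {P : ℤ → ℤ → E} {P' : ℤ → ℤ → E'} (hP : TopTrunc P) (hP' : TopTrunc P')
    (k k' : ℕ) : conv₂ μ (jacP k P) (jacP k' P') = jacP (k + k' : ℕ) (conv₂ μ P P') := by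
  induction k with
  | zero =>
    induction k' with
    | zero => simp
    | succ k' ih =>
      rw [Nat.cast_succ, jacP_succ hP'.antiFin, diffShift_eq_pairShift,
        conv₂_pairShift_right ((hP.jacP _).convFin (hP'.jacP _)), ih, ← diffShift_eq_pairShift,
        ← jacP_succ (hP.conv₂ hP').antiFin]
      push_cast
      rw [add_assoc]
  | succ k ih =>
    rw [Nat.cast_succ, jacP_succ hP.antiFin, diffShift_eq_pairShift,
      conv₂_pairShift ((hP.jacP _).convFin (hP'.jacP _)), ih, ← diffShift_eq_pairShift,
      ← jacP_succ (hP.conv₂ hP').antiFin]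
    push_cast
    rw [add_right_comm]

theorem conv₂_jacQ {Q : ℤ → ℤ → E} {Q' : ℤ → ℤ → E'} (hQ : TopTrunc fun n m => Q m n)
    (hQ' : TopTrunc fun n m => Q' m n) (k k' : ℕ) :
    conv₂ μ (jacQ k Q) (jacQ k' Q') = jacQ (k + k' : ℕ) (conv₂ μ Q Q') := by
  funext m n
  have e : ∀ (k : ℕ), jacQ k Q = (-1 : ℂ) ^ k • fun m n => jacP k (fun n m => Q m n) n m :=
    fun k => by funext m n; simp [jacQ]
  have e' : ∀ (k : ℕ), jacQ k Q' = (-1 : ℂ) ^ k • fun m n => jacP k (fun n m => Q' m n) n m :=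
    fun k => by funext m n; simp [jacQ]
  rw [e, e', conv₂_smul_left, conv₂_smul_right, Pi.smul_apply, Pi.smul_apply, Pi.smul_apply,
    Pi.smul_apply, ← conv₂_swap, conv₂_jacP hQ hQ', jacQ, smul_smul, ← pow_add, zpow_natCast]
  congr 2
  funext n m
  exact conv₂_swap _ _ _ _

/-- Raising `m` multiplies the third term by `x₁ = x₀ + x₂`. -/
theorem jacR_succ_mid {R : ℤ → ℤ → E} (hR : EvZero atTop R) (m : ℤ) :
    (fun l n => jacR R l (m + 1) n) = pairShift 1 1 0 0 1 fun l n => jacR R l m n := by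
  funext l n
  rw [pairShift, one_smul, add_zero, add_zero, jacR_succ hR, diffShift_apply]
  abel

theorem jacR_topTrunc {R : ℤ → ℤ → E} (hR : TopTrunc fun n j => R j n) (m : ℤ) :
    TopTrunc fun n l => jacR R l m n := by
  constructor
  · obtain ⟨L, hL⟩ := exists_jacR_eq_zero hR.1
    filter_upwards [eventually_ge_atTop L] with l hl
    funext n
    rw [hL l hl]; rfl
  · exact fun l => (jacR_evZero tendsto_add_atTop hR.1 hR.2 l).2 m

theorem conv₂_jacR {R : ℤ → ℤ → E} {R' : ℤ → ℤ → E'} (hR : TopTrunc fun n j => R j n)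
    (hR' : TopTrunc fun n j => R' j n) (k k' : ℕ) :
    conv₂ μ (fun l n => jacR R l k n) (fun l n => jacR R' l k' n)
      = fun l n => jacR (conv₂ μ R R') l (k + k' : ℕ) n := by
  have hc : ∀ k k' : ℕ, ConvFin μ (fun l n => jacR R l k n) (fun l n => jacR R' l k' n) :=
    fun k k' => ((jacR_topTrunc hR k).convFin (jacR_topTrunc hR' k')).swap
  have hRR : EvZero atTop (conv₂ μ R R') := by
    refine (hR.conv₂ hR' (μ := μ)).1.mono fun j hj => ?_
    funext n
    rw [← conv₂_swap]
    exact congrFun hj n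
  induction k with
  | zero =>
    induction k' with
    | zero => simp [jacR_zero_left]
    | succ k' ih =>
      rw [Nat.cast_succ, jacR_succ_mid hR'.1, conv₂_pairShift_right (hc _ _), ih,
        ← jacR_succ_mid hRR]
      push_cast
      simp only [add_assoc]
  | succ k ih =>
    rw [Nat.cast_succ, jacR_succ_mid hR.1, conv₂_pairShift (hc _ _), ih, ← jacR_succ_mid hRR]
    push_cast
    simp only [add_right_comm]

/-! ### The iterate of a product -/

/-- Vandermonde's identity after negating the upper entries. -/
theorem sum_antidiagonal_choose_mul_choose (l a : ℤ) (k : ℕ) :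
    ∑ x ∈ Finset.HasAntidiagonal.antidiagonal k,
        Ring.choose (a + x.1) x.1 * Ring.choose (l - 1 - a - x.1) x.2 = Ring.choose l k := by
  have h : ∀ (p : ℤ) (i : ℕ), Ring.choose (p + i) i = Int.negOnePow i • Ring.choose (-p - 1) i := by
    intro p i
    rw [show p + (i : ℤ) = -(-p - i) by ring, Ring.choose_neg,
      show -p - (i : ℤ) + i - 1 = -p - 1 by ring]
  have h1 : ∀ x ∈ Finset.HasAntidiagonal.antidiagonal k,
      Ring.choose (a + x.1) x.1 * Ring.choose (l - 1 - a - x.1) x.2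
        = Int.negOnePow k • (Ring.choose (-a - 1) x.1 * Ring.choose (-(l - 1 - a - k) - 1) x.2) := by
    intro x hx
    have hx' : (x.1 : ℤ) + x.2 = k := by
      exact_mod_cast Finset.HasAntidiagonal.mem_antidiagonal.1 hx
    rw [h, show l - 1 - a - (x.1 : ℤ) = (l - 1 - a - k) + x.2 by rw [← hx']; ring, h, ← hx',
      Int.negOnePow_add, smul_mul_smul_comm]
  rw [Finset.sum_congr rfl h1, ← Finset.smul_sum, ← Ring.add_choose_eq k (Commute.all _ _),
    show -a - 1 + (-(l - 1 - a - k) - 1) = -(l - k) - 1 by ring, ← h, sub_add_cancel]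

/-- The numbers `jacP l P 0 n` are the modes in `x₀, x₂` of `P(x₀ + x₂, x₂)`, expanded in
nonnegative powers of `x₂`. Such a substitution is compatible with products; the coefficient check
is Vandermonde's identity. -/
theorem conv₂_jacP_zero {P : ℤ → ℤ → E} {P' : ℤ → ℤ → E'} (hP : TopTrunc P) (hP' : TopTrunc P')
    (l n : ℤ) :
    conv₂ μ (fun l n => jacP l P 0 n) (fun l n => jacP l P' 0 n) l n
      = jacP l (conv₂ μ P P') 0 n := by
  obtain ⟨N, hN⟩ := eventually_atTop.1 hP.1
  obtain ⟨N', hN'⟩ := eventually_atTop.1 hP'.1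
  replace hN : ∀ n, N ≤ n → ∀ m, P m n = 0 := fun n h m => congrFun (hN n h) m
  replace hN' : ∀ n, N' ≤ n → ∀ m, P' m n = 0 := fun n h m => congrFun (hN' n h) m
  obtain ⟨I, hI⟩ : ∃ I : ℕ, N + N' - n ≤ I := ⟨_, Int.self_le_toNat _⟩
  let t : ℕ → ℤ × ℤ → E'' := fun k x => μ (P x.1 x.2) (P' (l - k - 1 - x.1) (n + k - 1 - x.2))
  have ht0 : ∀ k x, I ≤ k → t k x = 0 := by
    intro k x hk
    rcases le_or_gt N x.2 with h | h
    · simp [t, hN _ h]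
    · simp only [t]
      rw [hN' _ (by omega), map_zero]
  have ht : ∀ k, (Function.support (t k)).Finite := fun k => hP.convFin hP' (l - k) (n + k)
  let c : ℕ → ℕ → ℤ × ℤ → ℂ := fun i j x =>
    (-1) ^ (i + j) * ((Ring.choose (x.1 + i) i * Ring.choose (l - 1 - x.1 - i) j : ℤ) : ℂ)
  -- Reindexing by `e i` makes the arguments of `P` the summation variables, so the terms with equal
  -- `i + j` involve the same product and only their coefficients are added.
  let e : ℕ → ℤ × ℤ ≃ ℤ × ℤ := fun i =>
    (Equiv.subRight (i : ℤ)).prodCongr (Equiv.addRight (i : ℤ))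
  have hct : ∀ i j, (Function.support fun x => c i j x • t (i + j) x).Finite := fun i j =>
    (ht (i + j)).subset (Function.support_smul_subset_right _ _)
  have hcte : ∀ i j, (Function.support fun x => c i j (e i x) • t (i + j) (e i x)).Finite :=
    fun i j => (hct i j).preimage (f := e i) (e i).injective.injOn
  have h1 : ∀ x : ℤ × ℤ, μ (jacP x.1 P 0 x.2) (jacP (l - 1 - x.1) P' 0 (n - 1 - x.2))
      = ∑ i ∈ Finset.range I, ∑ j ∈ Finset.range I, c i j (e i x) • t (i + j) (e i x) := by
    intro x
    have hterm : ∀ i j : ℕ, c i j (e i x) • t (i + j) (e i x)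
        = μ (((Ring.choose x.1 i : ℤ) : ℂ) • (-1 : ℂ) ^ i • P (x.1 + 0 - i) (x.2 + i))
          (((Ring.choose (l - 1 - x.1) j : ℤ) : ℂ) • (-1 : ℂ) ^ j •
            P' (l - 1 - x.1 + 0 - j) (n - 1 - x.2 + j)) := by
      intro i j
      simp only [c, t, e, Equiv.prodCongr_apply, Prod.map, Equiv.coe_addRight,
        Equiv.subRight_apply, map_smul, LinearMap.smul_apply, smul_smul]
      rw [show l - ((i + j : ℕ) : ℤ) - 1 - (x.1 - i) = l - 1 - x.1 + 0 - j by push_cast; ring,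
        show n + ((i + j : ℕ) : ℤ) - 1 - (x.2 + i) = n - 1 - x.2 + j by push_cast; ring,
        show x.1 + 0 - (i : ℤ) = x.1 - i by ring, show x.1 - (i : ℤ) + i = x.1 by ring,
        show l - 1 - (x.1 - (i : ℤ)) - i = l - 1 - x.1 by ring]
      congr 1
      push_cast
      ring
    simp only [hterm]
    by_cases hx : N ≤ x.2 ∨ N' ≤ n - 1 - x.2
    · rcases hx with hx | hx
      · rw [Finset.sum_eq_zero, jacP, bsum_eq_sum (I := 0), Finset.sum_range_zero, map_zero,
          LinearMap.zero_apply]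
        · intro i _
          rw [hN _ (by omega), smul_zero]
        · intro i _
          refine Finset.sum_eq_zero fun j _ => ?_
          rw [hN _ (by omega)]; simp
      · rw [Finset.sum_eq_zero, jacP, jacP, bsum_eq_sum (l := l - 1 - x.1) (I := 0),
          Finset.sum_range_zero, map_zero]
        · intro i _
          rw [hN' _ (by omega), smul_zero]
        · intro i _
          refine Finset.sum_eq_zero fun j _ => ?_
          rw [hN' _ (by omega)]; simp
    · rw [jacP, jacP, bsum_eq_sum (I := I), bsum_eq_sum (I := I)]
      · simp only [map_sum, LinearMap.sum_apply]
        exact Finset.sum_comm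
      · intro i hi
        rw [hN' _ (by omega), smul_zero]
      · intro i hi
        rw [hN _ (by omega), smul_zero]
  have h2 : ∀ x : ℤ × ℤ, ∑ i ∈ Finset.range I, ∑ j ∈ Finset.range I, c i j x • t (i + j) x
      = ∑ k ∈ Finset.range (I + I), ((Ring.choose l k : ℤ) : ℂ) • (-1 : ℂ) ^ k • t k x := by
    intro x
    rw [← sum_antidiagonal_rectangle (f := fun i j => c i j x • t (i + j) x)
      (fun i j h => by rw [ht0 _ _ (by omega), smul_zero])
      (fun i j h => by rw [ht0 _ _ (by omega), smul_zero])]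
    refine Finset.sum_congr rfl fun k _ => ?_
    have : ∀ y ∈ Finset.HasAntidiagonal.antidiagonal k, c y.1 y.2 x • t (y.1 + y.2) x
        = ((Ring.choose (x.1 + y.1) y.1 * Ring.choose (l - 1 - x.1 - y.1) y.2 : ℤ) : ℂ) •
          ((-1 : ℂ) ^ k • t k x) := by
      intro y hy
      rw [Finset.HasAntidiagonal.mem_antidiagonal.1 hy, smul_smul]
      simp only [c]
      rw [Finset.HasAntidiagonal.mem_antidiagonal.1 hy, mul_comm]
    rw [Finset.sum_congr rfl this, ← Finset.sum_smul, ← Int.cast_sum,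
      sum_antidiagonal_choose_mul_choose]
  have h3 : ∀ k : ℕ, I ≤ k → (-1 : ℂ) ^ k • conv₂ μ P P' (l + 0 - k) (n + k) = 0 := by
    intro k hk
    rw [conv₂_eq_zero hN hN' (by omega), smul_zero]
  rw [jacP, bsum_eq_sum (I := I + I) fun k hk => h3 k (by omega), conv₂, finsum_congr h1,
    finsum_sum_comm]
  · have h4 : ∀ i, (∑ᶠ x, ∑ j ∈ Finset.range I, c i j (e i x) • t (i + j) (e i x))
        = ∑ᶠ x, ∑ j ∈ Finset.range I, c i j x • t (i + j) x := fun i =>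
      finsum_comp_equiv (e i) (f := fun x => ∑ j ∈ Finset.range I, c i j x • t (i + j) x)
    simp only [h4]
    rw [sum_finsum_comm, finsum_congr h2, finsum_sum_comm]
    · refine Finset.sum_congr rfl fun k _ => ?_
      simp only [smul_smul]
      rw [← smul_finsum, conv₂, add_zero]
    · intro k _
      simp only [smul_smul]
      exact (ht k).subset fun x hx h => hx (by simp only [h, smul_zero])
    · intro i _
      refine (Set.Finite.biUnion (Finset.range I).finite_toSet fun j _ => hct i j).subset ?_
      intro x hx
      by_contra h
      simp only [Set.mem_iUnion, not_exists, Function.mem_support, not_not] at h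
      exact hx (Finset.sum_eq_zero fun j hj => h j hj)
  · intro i _
    refine (Set.Finite.biUnion (Finset.range I).finite_toSet fun j _ => hcte i j).subset ?_
    intro x hx
    by_contra h
    simp only [Set.mem_iUnion, not_exists, Function.mem_support, not_not] at h
    exact hx (Finset.sum_eq_zero fun j hj => h j hj)

theorem jacP_translate (P : ℤ → ℤ → E) (l M n : ℤ) :
    jacP l P M n = jacP l (fun m n => P (m + M) (n + 0)) 0 n :=
  bsum_congr fun i => by
    dsimp only
    rw [show l + 0 - (i : ℤ) + M = l + M - i by ring, add_zero (n + (i : ℤ))]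

theorem TopTrunc.translate {P : ℤ → ℤ → E} (hP : TopTrunc P) (M : ℤ) :
    TopTrunc fun m n => P (m + M) (n + 0) := by
  simp only [add_zero]
  refine ⟨hP.1.mono fun n hn => funext fun m => congrFun hn _, fun n => ?_⟩
  exact (tendsto_add_atTop M).eventually (hP.2 n)

theorem conv₂_jacP_nat {P : ℤ → ℤ → E} {P' : ℤ → ℤ → E'} (hP : TopTrunc P) (hP' : TopTrunc P')
    (M M' l n : ℤ) :
    conv₂ μ (fun l n => jacP l P M n) (fun l n => jacP l P' M' n) l n
      = jacP l (conv₂ μ P P') (M + M') n := by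
  have e1 : (fun l n => jacP l P M n) = fun l n => jacP l (fun m n => P (m + M) (n + 0)) 0 n :=
    funext fun l => funext fun n => jacP_translate P l M n
  have e2 : (fun l n => jacP l P' M' n)
      = fun l n => jacP l (fun m n => P' (m + M') (n + 0)) 0 n :=
    funext fun l => funext fun n => jacP_translate P' l M' n
  rw [e1, e2, conv₂_jacP_zero (hP.translate M) (hP'.translate M'), jacP_translate _ l (M + M')]
  congr 1
  funext m n
  rw [conv₂_shift, conv₂_shift_right, add_zero, add_assoc]

theorem jacQ_eq_zero {Q : ℤ → ℤ → E} {N : ℤ} (hN : ∀ m, N ≤ m → ∀ n, Q m n = 0) (l : ℤ)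
    {m : ℤ} (hm : N ≤ m) (n : ℤ) : jacQ l Q m n = 0 := by
  rw [jacQ, jacP, bsum_eq_sum (I := 0), Finset.sum_range_zero, smul_zero]
  intro i _
  rw [hN _ (by omega), smul_zero]

/-- Both sides solve the recursion in `l`. They agree at one high level by weak commutativity of the
factors, and the descent in `l` is injective because they agree in one column `m` by the
substitution rule. -/
theorem IsJacobi.conv₂ {P Q R : ℤ → ℤ → E} {P' Q' R' : ℤ → ℤ → E'} (h : IsJacobi P Q R)
    (h' : IsJacobi P' Q' R') (hP : TopTrunc P) (hP' : TopTrunc P')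
    (hQ : TopTrunc fun n m => Q m n) (hQ' : TopTrunc fun n m => Q' m n)
    (hR : TopTrunc fun n j => R j n) (hR' : TopTrunc fun n j => R' j n) :
    IsJacobi (conv₂ μ P P') (conv₂ μ Q Q') (conv₂ μ R R') := by
  have swap : ∀ {X : ℤ → ℤ → E} {X' : ℤ → ℤ → E'}, (TopTrunc fun n m => X m n) →
      (TopTrunc fun n m => X' m n) → TopTrunc fun n m => VOATheory.conv₂ μ X X' m n := by
    intro X X' hX hX'
    have := hX.conv₂ (μ := μ) hX'
    rwa [show VOATheory.conv₂ μ (fun n m => X m n) (fun n m => X' m n)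
      = fun n m => VOATheory.conv₂ μ X X' m n from
        funext fun n => funext fun m => conv₂_swap X X' m n] at this
  have hPP := hP.conv₂ (μ := μ) hP'
  have hQQ := swap hQ hQ'
  have hRR := swap hR hR'
  obtain ⟨N, hN⟩ := eventually_atTop.1 hQ.1
  obtain ⟨N', hN'⟩ := eventually_atTop.1 hQ'.1
  obtain ⟨N'', hN''⟩ := eventually_atTop.1 hQQ.1
  obtain ⟨L, hL⟩ := exists_jacR_eq_zero hR.1
  obtain ⟨L', hL'⟩ := exists_jacR_eq_zero hR'.1
  obtain ⟨L'', hL''⟩ := exists_jacR_eq_zero hRR.1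
  have nat : ∀ a b : ℤ, ∃ k : ℕ, a ≤ k ∧ b ≤ k := fun a b =>
    ⟨(max a b).toNat, (le_max_left a b).trans (Int.self_le_toNat _),
      (le_max_right a b).trans (Int.self_le_toNat _)⟩
  have key := diffShift_family_unique
    (X := fun l => jacP l (VOATheory.conv₂ μ P P') - jacQ l (VOATheory.conv₂ μ Q Q'))
    (Y := fun l => jacR (VOATheory.conv₂ μ R R') l)
    (fun l => by rw [map_sub, ← jacP_succ hPP.antiFin, ← jacQ_succ hQQ.antiFin])
    (fun l => jacR_succ hRR.1 l) (fun l hl => ?_)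
  -- Weak commutativity: for large `k` and `k'` the third terms vanish, and multiplying the two
  -- identities gives the identity for the products at level `k + k'`.
  · obtain ⟨k, hk, hk2⟩ := nat L L''
    obtain ⟨k', hk', _⟩ := nat L' L'
    have hX := key (k + k' : ℕ) ?_
    · intro l m n
      exact congrFun (congrFun (congrFun hX l) m) n
    · have e : jacP k P = jacQ k Q := by
        funext m n
        have := h k m n
        rwa [hL _ hk, Pi.zero_apply, Pi.zero_apply, sub_eq_zero] at this
      have e' : jacP k' P' = jacQ k' Q' := by
        funext m n
        have := h' k' m n
        rwa [hL' _ hk', Pi.zero_apply, Pi.zero_apply, sub_eq_zero] at this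
      change jacP _ _ - jacQ _ _ = jacR _ _
      rw [← conv₂_jacP hP hP', ← conv₂_jacQ hQ hQ', e, e', sub_self,
        hL'' _ (by push_cast; omega)]
  -- For large `m` the second terms vanish at every level. Then `x₁ ^ M P` at `x₁ = x₀ + x₂` equals
  -- `(x₀ + x₂) ^ M R`, likewise for the other triple, and these equalities can be multiplied.
  · obtain ⟨M, hM, hM2⟩ := nat N N''
    obtain ⟨M', hM', _⟩ := nat N' N'
    refine eq_zero_of_diffShift hl (M + M' : ℕ) fun n => ?_
    have e : (fun l n => jacP l P M n) = fun l n => jacR R l M n := by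
      funext l n
      have := h l M n
      rwa [jacQ_eq_zero (fun m hm n => congrFun (hN m hm) n) l hM, sub_zero] at this
    have e' : (fun l n => jacP l P' M' n) = fun l n => jacR R' l M' n := by
      funext l n
      have := h' l M' n
      rwa [jacQ_eq_zero (fun m hm n => congrFun (hN' m hm) n) l hM', sub_zero] at this
    simp only [Pi.sub_apply]
    rw [jacQ_eq_zero (fun m hm n => congrFun (hN'' m hm) n) l (by push_cast; omega), sub_zero,
      Nat.cast_add, ← conv₂_jacP_nat hP hP', e, e', conv₂_jacR hR hR', Nat.cast_add, sub_self]

end Convolution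

/-! ### The product of two commuting actions as a module for the tensor product. -/

section ProductField

variable {V M : Type*} [AddCommGroup V] [Module ℂ V] [AddCommGroup M] [Module ℂ M]
  {G₁ G₂ : FieldMap V M}

/-! ### The product of two commuting fields -/

/-- Because the factors commute, the truncation of either one on `a` itself is enough, although `G₁
u i` is applied to varying vectors. -/
theorem product_term_eq_zero (hc : ∀ (u v : V) (m n : ℤ), Commute (G₁ u m) (G₂ v n)) {u v : V}
    {a : M} {N N' : ℤ} (hN : ∀ n, N ≤ n → G₁ u n a = 0) (hN' : ∀ n, N' ≤ n → G₂ v n a = 0)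
    {n i : ℤ} (h : N ≤ i ∨ N' ≤ n - 1 - i) : G₁ u i (G₂ v (n - 1 - i) a) = 0 := by
  rcases h with h | h
  · rw [← Module.End.mul_apply, (hc u v _ _).eq, Module.End.mul_apply, hN i h, map_zero]
  · rw [hN' _ h, map_zero]

theorem pointwiseFinite_product (h₁ : Truncation G₁) (h₂ : Truncation G₂)
    (hc : ∀ (u v : V) (m n : ℤ), Commute (G₁ u m) (G₂ v n)) (u v : V) (n : ℤ) :
    PointwiseFinite fun i => G₁ u i * G₂ v (n - 1 - i) := by
  intro a
  obtain ⟨N, hN⟩ := h₁ u a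
  obtain ⟨N', hN'⟩ := h₂ v a
  refine (Set.finite_Icc (n - 1 - N') N).subset fun i hi => ?_
  by_contra h
  simp only [Set.mem_Icc, not_and_or, not_le] at h
  exact hi (product_term_eq_zero hc hN hN' (by omega))

/-- The field `G(u ⊗ v, x) = G₁(u, x) G₂(v, x)`. -/
def productField (h₁ : Truncation G₁) (h₂ : Truncation G₂)
    (hc : ∀ (u v : V) (m n : ℤ), Commute (G₁ u m) (G₂ v n)) : FieldMap (V ⊗[ℂ] V) M :=
  TensorProduct.lift <| LinearMap.mk₂ ℂ
    (fun u v n => sumEnd _ (pointwiseFinite_product h₁ h₂ hc u v n))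
    (fun u u' v => funext fun n => LinearMap.ext fun a => by
      refine Eq.trans (finsum_congr fun i => ?_)
        (finsum_add_distrib (pointwiseFinite_product h₁ h₂ hc u v n a)
          (pointwiseFinite_product h₁ h₂ hc u' v n a))
      simp [add_mul])
    (fun c u v => funext fun n => LinearMap.ext fun a => by
      refine Eq.trans (finsum_congr fun i => ?_)
        (smul_finsum' c (pointwiseFinite_product h₁ h₂ hc u v n a)).symm
      simp)
    (fun u v v' => funext fun n => LinearMap.ext fun a => by
      refine Eq.trans (finsum_congr fun i => ?_)
        (finsum_add_distrib (pointwiseFinite_product h₁ h₂ hc u v n a)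
          (pointwiseFinite_product h₁ h₂ hc u v' n a))
      simp [mul_add])
    (fun c u v => funext fun n => LinearMap.ext fun a => by
      refine Eq.trans (finsum_congr fun i => ?_)
        (smul_finsum' c (pointwiseFinite_product h₁ h₂ hc u v n a)).symm
      simp)

variable (h₁ : Truncation G₁) (h₂ : Truncation G₂)
  (hc : ∀ (u v : V) (m n : ℤ), Commute (G₁ u m) (G₂ v n))

theorem productField_tmul (u v : V) (n : ℤ) (a : M) :
    productField h₁ h₂ hc (u ⊗ₜ v) n a = ∑ᶠ i, G₁ u i (G₂ v (n - 1 - i) a) := rfl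

theorem isProductField_iff {G : FieldMap (V ⊗[ℂ] V) M} :
    IsProductField G₁ G₂ G ↔ G = productField h₁ h₂ hc := by
  constructor
  · intro h
    refine TensorProduct.ext' fun u v => funext fun n => LinearMap.ext fun a => ?_
    rw [productField_tmul]
    exact (h u v n a).2
  · rintro rfl u v n a
    exact ⟨pointwiseFinite_product h₁ h₂ hc u v n a, rfl⟩

theorem productField_truncation : Truncation (productField h₁ h₂ hc) := by
  intro t a
  induction t using TensorProduct.induction_on with
  | zero => exact ⟨0, fun n _ => by simp⟩
  | add s t hs ht =>
    obtain ⟨N, hN⟩ := hs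
    obtain ⟨N', hN'⟩ := ht
    refine ⟨max N N', fun n hn => ?_⟩
    simp [hN n ((le_max_left _ _).trans hn), hN' n ((le_max_right _ _).trans hn)]
  | tmul u v =>
    obtain ⟨N, hN⟩ := h₁ u a
    obtain ⟨N', hN'⟩ := h₂ v a
    refine ⟨N + N', fun n hn => ?_⟩
    rw [productField_tmul, ← finsum_zero (α := ℤ)]
    exact finsum_congr fun i => product_term_eq_zero hc hN hN' (by omega)

theorem tensorField_truncation {Y Y' : FieldMap V V} (hY : Truncation Y) (hY' : Truncation Y') :
    Truncation (tensorField Y hY Y' hY') := by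
  intro s t
  induction s using TensorProduct.induction_on with
  | zero => exact ⟨0, fun n _ => by simp⟩
  | add s s' hs hs' =>
    obtain ⟨N, hN⟩ := hs
    obtain ⟨N', hN'⟩ := hs'
    refine ⟨max N N', fun n hn => ?_⟩
    simp [hN n ((le_max_left _ _).trans hn), hN' n ((le_max_right _ _).trans hn)]
  | tmul u u' =>
    induction t using TensorProduct.induction_on with
    | zero => exact ⟨0, fun n _ => by simp⟩
    | add t t' ht ht' =>
      obtain ⟨N, hN⟩ := ht
      obtain ⟨N', hN'⟩ := ht'
      refine ⟨max N N', fun n hn => ?_⟩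
      simp [hN n ((le_max_left _ _).trans hn), hN' n ((le_max_right _ _).trans hn)]
    | tmul v v' =>
      obtain ⟨N, hN⟩ := hY u v
      obtain ⟨N', hN'⟩ := hY' u' v'
      refine ⟨N + N', fun n hn => ?_⟩
      rw [tensorField_tmul, ← finsum_zero (α := ℤ)]
      refine finsum_congr fun i => ?_
      rw [TensorProduct.map_tmul]
      rcases le_or_gt N i with h | h
      · rw [hN i h, TensorProduct.zero_tmul]
      · rw [hN' _ (by omega), TensorProduct.tmul_zero]

/-- The vectors killed by every endomorphism that commutes with the modes of `G` and kills `a`. -/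
def doubleCommutantSpan (G : FieldMap V M) (a : M) : Submodule ℂ M where
  carrier := {b | ∀ T : Module.End ℂ M, (∀ v n, Commute T (G v n)) → T a = 0 → T b = 0}
  zero_mem' := fun T _ _ => map_zero T
  add_mem' := fun hb hb' T hT h => by rw [map_add, hb T hT h, hb' T hT h, add_zero]
  smul_mem' := fun c b hb T hT h => by rw [map_smul, hb T hT h, smul_zero]

theorem self_mem_doubleCommutantSpan (G : FieldMap V M) (a : M) : a ∈ doubleCommutantSpan G a :=
  fun _ _ h => h

theorem mode_mem_doubleCommutantSpan {G : FieldMap V M} {a b : M}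
    (hb : b ∈ doubleCommutantSpan G a) (v : V) (n : ℤ) : G v n b ∈ doubleCommutantSpan G a := by
  intro T hT h
  rw [← Module.End.mul_apply, (hT v n).eq, Module.End.mul_apply, hb T hT h, map_zero]

/-- Vanishing at the single vector `a` extends at once to the whole subspace, with the same bounds.
-/
theorem topTrunc_restrict {G : FieldMap V M} {a : M} {T : ℤ → ℤ → Module.End ℂ M}
    (hT : ∀ m n v k, Commute (T m n) (G v k)) (h : TopTrunc fun m n => T m n a) :
    TopTrunc fun m n => T m n ∘ₗ (doubleCommutantSpan G a).subtype := by
  constructor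
  · exact h.1.mono fun n hn => funext fun m => LinearMap.ext fun b =>
      b.2 _ (hT m n) (congrFun hn m)
  · exact fun n => (h.2 n).mono fun m hm => LinearMap.ext fun b => b.2 _ (hT m n) hm

theorem topTrunc_of_map {E E' : Type*} [AddCommGroup E] [Module ℂ E] [AddCommGroup E']
    [Module ℂ E'] (f : E →ₗ[ℂ] E') (hf : Function.Injective f) {P : ℤ → ℤ → E}
    (h : TopTrunc fun m n => f (P m n)) : TopTrunc P := by
  constructor
  · exact h.1.mono fun n hn => funext fun m => hf ((congrFun hn m).trans (map_zero f).symm)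
  · exact fun n => (h.2 n).mono fun m hm => hf (hm.trans (map_zero f).symm)

theorem truncation_iterate_topTrunc {Y : FieldMap V V} {G : FieldMap V M} (hY : Truncation Y)
    (hG : Truncation G) (u v : V) (a : M) : TopTrunc fun n j => G (Y u j v) n a := by
  refine ⟨truncation_evZero_iterate hY G u v a, fun j => ?_⟩
  exact eventually_atTop.2 (hG _ a)

theorem finsum_iterate_eq_conv₂ {E E' E'' : Type*} [AddCommGroup E] [Module ℂ E] [AddCommGroup E']
    [Module ℂ E'] [AddCommGroup E''] [Module ℂ E''] {μ : E →ₗ[ℂ] E' →ₗ[ℂ] E''} {P : ℤ → ℤ → E}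
    {P' : ℤ → ℤ → E'} (h : ConvFin μ P P') (m n : ℤ) :
    ∑ᶠ i, ∑ᶠ j, μ (P i j) (P' (m - 1 - i) (n - 1 - j)) = conv₂ μ P P' m n :=
  (finsum_curry (fun x : ℤ × ℤ => μ (P x.1 x.2) (P' (m - 1 - x.1) (n - 1 - x.2))) (h m n)).symm

/-- After commuting the factors, each term is a product, under evaluation, of a series of maps made
from `G₁` and a series of vectors made from `G₂` and `a`; the two Jacobi triples are then
multiplied. -/
theorem productField_jacobi_tmul {Y Y' : FieldMap V V} (hY : Truncation Y) (hY' : Truncation Y')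
    (hJ₁ : Jacobi Y G₁) (hJ₂ : Jacobi Y' G₂) (u u' v v' : V) (a : M) :
    IsJacobi
      (fun m n => productField h₁ h₂ hc (u ⊗ₜ u') m (productField h₁ h₂ hc (v ⊗ₜ v') n a))
      (fun m n => productField h₁ h₂ hc (v ⊗ₜ v') n (productField h₁ h₂ hc (u ⊗ₜ u') m a))
      (fun j n => productField h₁ h₂ hc (tensorField Y hY Y' hY' (u ⊗ₜ u') j (v ⊗ₜ v')) n a) := by
  -- `G₁` is truncated on each vector separately, not on `M` uniformly. On `K`, which contains all
  -- vectors obtained from `a` by modes of `G₂`, the bounds valid at `a` hold uniformly.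
  let K := doubleCommutantSpan G₂ a
  have ha : a ∈ K := self_mem_doubleCommutantSpan G₂ a
  let P₁ : V → V → ℤ → ℤ → K →ₗ[ℂ] M := fun u v m n => (G₁ u m * G₁ v n) ∘ₗ K.subtype
  let P₂ : V → V → ℤ → ℤ → K := fun u v m n =>
    ⟨G₂ u m (G₂ v n a), mode_mem_doubleCommutantSpan (mode_mem_doubleCommutantSpan ha v n) u m⟩
  let R₁ : ℤ → ℤ → K →ₗ[ℂ] M := fun j n => G₁ (Y u j v) n ∘ₗ K.subtype
  let R₂ : ℤ → ℤ → K := fun j n =>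
    ⟨G₂ (Y' u' j v') n a, mode_mem_doubleCommutantSpan ha _ n⟩
  let μ : (K →ₗ[ℂ] M) →ₗ[ℂ] K →ₗ[ℂ] M := LinearMap.id
  have hP₁ : ∀ u v, TopTrunc (P₁ u v) := fun u v =>
    topTrunc_restrict (fun m n w k => (hc u w m k).mul_left (hc v w n k))
      (truncation_topTrunc h₁ h₁ u v a)
  have hP₂ : ∀ u v, TopTrunc (P₂ u v) := fun u v =>
    topTrunc_of_map K.subtype K.injective_subtype (truncation_topTrunc h₂ h₂ u v a)
  have hR₁ : TopTrunc fun n j => R₁ j n :=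
    topTrunc_restrict (T := fun n j => G₁ (Y u j v) n) (fun n j w k => hc _ w n k)
      (truncation_iterate_topTrunc hY h₁ u v a)
  have hR₂ : TopTrunc fun n j => R₂ j n :=
    topTrunc_of_map K.subtype K.injective_subtype (truncation_iterate_topTrunc hY' h₂ u' v' a)
  have J₁ : IsJacobi (P₁ u v) (fun m n => P₁ v u n m) R₁ :=
    IsJacobi.of_map (hP₁ u v).antiFin (hP₁ v u).antiFin hR₁.1
      (fun b : K => LinearMap.applyₗ b) (fun x hx => LinearMap.ext hx)
      fun b => jacobi_iff.1 hJ₁ u v (b : M)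
  have J₂ : IsJacobi (P₂ u' v') (fun m n => P₂ v' u' n m) R₂ :=
    IsJacobi.of_map (hP₂ u' v').antiFin (hP₂ v' u').antiFin hR₂.1
      (fun _ : Unit => K.subtype) (fun x hx => Subtype.ext (hx ()))
      fun _ => jacobi_iff.1 hJ₂ u' v' a
  have hPfin : ∀ u v u' v', ConvFin μ (P₁ u v) (P₂ u' v') := fun u v u' v' =>
    (hP₁ u v).convFin (hP₂ u' v')
  have hP : ∀ (u v u' v' : V) (m n : ℤ),
      productField h₁ h₂ hc (u ⊗ₜ u') m (productField h₁ h₂ hc (v ⊗ₜ v') n a)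
        = conv₂ μ (P₁ u v) (P₂ u' v') m n := by
    intro u v u' v' m n
    rw [← finsum_iterate_eq_conv₂ (hPfin u v u' v'), productField_tmul, productField_tmul]
    refine finsum_congr fun i => ?_
    refine (AddMonoidHom.map_finsum (G₁ u i * G₂ u' (m - 1 - i)).toAddMonoidHom
      (pointwiseFinite_product h₁ h₂ hc v v' n a)).trans ?_
    refine finsum_congr fun j => ?_
    -- The inner modes of `G₁` and `G₂` are exchanged to bring both modes of `G₁` to the left.
    change G₁ u i (G₂ u' (m - 1 - i) (G₁ v j _)) = G₁ u i (G₁ v j (G₂ u' (m - 1 - i) _))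
    rw [← Module.End.mul_apply (G₂ u' _), ← (hc v u' _ _).eq]
    rfl
  have hR : ∀ j n : ℤ,
      productField h₁ h₂ hc (tensorField Y hY Y' hY' (u ⊗ₜ u') j (v ⊗ₜ v')) n a
        = conv₂ μ R₁ R₂ j n := by
    intro j n
    let φ : V ⊗[ℂ] V →ₗ[ℂ] M :=
      LinearMap.applyₗ a ∘ₗ LinearMap.proj n ∘ₗ productField h₁ h₂ hc
    rw [← finsum_iterate_eq_conv₂ (hR₁.convFin hR₂).swap, tensorField_tmul]
    change φ _ = _
    rw [← LinearMap.toAddMonoidHom_coe,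
      AddMonoidHom.map_finsum _ (pointwiseFinite_tensor Y hY Y' hY' u u' j (v ⊗ₜ v'))]
    rfl
  have key := J₁.conv₂ (μ := μ) J₂ (hP₁ u v) (hP₂ u' v') (hP₁ v u) (hP₂ v' u') hR₁ hR₂
  have e1 : (fun m n => productField h₁ h₂ hc (v ⊗ₜ v') n (productField h₁ h₂ hc (u ⊗ₜ u') m a))
      = conv₂ μ (fun m n => P₁ v u n m) (fun m n => P₂ v' u' n m) := by
    funext m n
    rw [hP, conv₂_swap]
  rw [funext fun m => funext fun n => hP u v u' v' m n, e1, funext fun j => funext fun n => hR j n]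
  exact key

theorem productField_jacobi {Y Y' : FieldMap V V} (hY : Truncation Y) (hY' : Truncation Y')
    (hJ₁ : Jacobi Y G₁) (hJ₂ : Jacobi Y' G₂) :
    Jacobi (tensorField Y hY Y' hY') (productField h₁ h₂ hc) := by
  have ht := productField_truncation h₁ h₂ hc
  have hA := fun s t a => (truncation_topTrunc ht ht s t a).antiFin
  have hR := fun s t a => truncation_evZero_iterate (tensorField_truncation hY hY')
    (productField h₁ h₂ hc) s t a
  have h0 : IsJacobi (fun _ _ => (0 : M)) (fun _ _ => 0) fun _ _ => 0 := by
    intro l m n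
    simp [jacP, jacQ, jacR]
  refine jacobi_iff.2 fun s t a => ?_
  induction s using TensorProduct.induction_on with
  | zero => simpa using h0
  | add s s' hs hs' =>
    have := hs.add hs' (hA _ _ _) (hA _ _ _) (hA _ _ _) (hA _ _ _) (hR _ _ _) (hR _ _ _)
    convert this using 1 <;> (funext m n; simp)
  | tmul u u' =>
    induction t using TensorProduct.induction_on with
    | zero => simpa using h0
    | add t t' ht ht' =>
      have := ht.add ht' (hA _ _ _) (hA _ _ _) (hA _ _ _) (hA _ _ _) (hR _ _ _) (hR _ _ _)
      convert this using 1 <;> (funext m n; simp)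
    | tmul v v' => exact productField_jacobi_tmul h₁ h₂ hc hY hY' hJ₁ hJ₂ u u' v v' a

theorem productField_tmul_vacuum {w : V} (hw : ∀ n : ℤ, G₂ w n = if n = -1 then 1 else 0)
    (u : V) (n : ℤ) : productField h₁ h₂ hc (u ⊗ₜ w) n = G₁ u n := by
  refine LinearMap.ext fun a => ?_
  rw [productField_tmul, finsum_eq_single _ n]
  · simp [hw]
  · intro i hi
    rw [hw, if_neg (by omega)]
    simp

theorem productField_vacuum_tmul {w : V} (hw : ∀ n : ℤ, G₁ w n = if n = -1 then 1 else 0)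
    (u : V) (n : ℤ) : productField h₁ h₂ hc (w ⊗ₜ u) n = G₂ u n := by
  refine LinearMap.ext fun a => ?_
  rw [productField_tmul, finsum_eq_single _ (-1)]
  · simp [hw]
  · intro i hi
    rw [hw, if_neg hi]
    simp

theorem tensorField_tmul_vacuum {Y Y' : FieldMap V V} (hY : Truncation Y) (hY' : Truncation Y')
    {w : V} (hw : ∀ n : ℤ, Y' w n = if n = -1 then 1 else 0) (u v v' : V) (n : ℤ) :
    tensorField Y hY Y' hY' (u ⊗ₜ w) n (v ⊗ₜ v') = Y u n v ⊗ₜ v' := by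
  rw [tensorField_tmul, finsum_eq_single _ n]
  · simp [hw]
  · intro i hi
    rw [TensorProduct.map_tmul, hw, if_neg (by omega)]
    simp

theorem tensorField_vacuum_tmul {Y Y' : FieldMap V V} (hY : Truncation Y) (hY' : Truncation Y')
    {w : V} (hw : ∀ n : ℤ, Y w n = if n = -1 then 1 else 0) (u v v' : V) (n : ℤ) :
    tensorField Y hY Y' hY' (w ⊗ₜ u) n (v ⊗ₜ v') = v ⊗ₜ Y' u n v' := by
  rw [tensorField_tmul, finsum_eq_single _ (-1)]
  · simp [hw]
  · intro i hi
    rw [TensorProduct.map_tmul, hw, if_neg hi]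
    simp

theorem productField_derivative {D : V → V}
    (hD₁ : ∀ (v : V) (n : ℤ), G₁ (D v) n = (-n : ℂ) • G₁ v (n - 1))
    (hD₂ : ∀ (v : V) (n : ℤ), G₂ (D v) n = (-n : ℂ) • G₂ v (n - 1)) (u v : V) (n : ℤ) :
    productField h₁ h₂ hc (D u ⊗ₜ v + u ⊗ₜ D v) n
      = (-n : ℂ) • productField h₁ h₂ hc (u ⊗ₜ v) (n - 1) := by
  refine LinearMap.ext fun a => ?_
  have hfin := pointwiseFinite_product h₁ h₂ hc u v (n - 1) a
  have e1 : (∑ᶠ i, G₁ (D u) i (G₂ v (n - 1 - i) a))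
      = ∑ᶠ i : ℤ, (-(i + 1) : ℂ) • G₁ u i (G₂ v (n - 1 - 1 - i) a) := by
    -- Differentiating the first factor shifts its index; shifting back aligns both sums, and the
    -- coefficients `-(i + 1)` and `-(n - 1 - i)` add up to `-n`.
    rw [← finsum_comp_equiv (Equiv.addRight (1 : ℤ))]
    refine finsum_congr fun i => ?_
    rw [Equiv.coe_addRight, hD₁, add_sub_cancel_right, show n - 1 - (i + 1) = n - 1 - 1 - i by ring]
    simp
  have e2 : (∑ᶠ i, G₁ u i (G₂ (D v) (n - 1 - i) a))
      = ∑ᶠ i : ℤ, (-(n - 1 - i) : ℂ) • G₁ u i (G₂ v (n - 1 - 1 - i) a) := by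
    refine finsum_congr fun i => ?_
    rw [hD₂, show n - 1 - i - 1 = n - 1 - 1 - i by ring]
    simp
  rw [map_add, Pi.add_apply, LinearMap.add_apply, LinearMap.smul_apply, productField_tmul,
    productField_tmul, productField_tmul, e1, e2, ← finsum_add_distrib, smul_finsum]
  · refine finsum_congr fun i => ?_
    rw [← add_smul]
    congr 1
    ring
  · exact hfin.subset (Function.support_smul_subset_right _ _)
  · exact hfin.subset (Function.support_smul_subset_right _ _)

theorem productField_isWeakModule {A : VertexOperatorAlgebra V}
    (hM₁ : IsWeakModule A.toVertexData G₁) (hM₂ : IsWeakModule A.toVertexData G₂) :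
    IsWeakModule (tensorData A A) (productField hM₁.truncation hM₂.truncation hc) where
  truncation := productField_truncation _ _ hc
  vacuum n := (productField_tmul_vacuum _ _ hc hM₂.vacuum A.vac n).trans (hM₁.vacuum n)
  jacobi := productField_jacobi _ _ hc A.adjoint.truncation A.adjoint.truncation hM₁.jacobi hM₂.jacobi
  virasoro m n := by
    have e : ∀ n, productField hM₁.truncation hM₂.truncation hc (tensorData A A).omega n
        = G₁ A.omega n + G₂ A.omega n := by
      intro n
      rw [tensorData, map_add, Pi.add_apply, productField_tmul_vacuum _ _ hc hM₂.vacuum,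
        productField_vacuum_tmul _ _ hc hM₁.vacuum]
    have h1 := hM₁.virasoro m n
    have h2 := hM₂.virasoro m n
    have c1 := (hc A.omega A.omega (m + 1) (n + 1)).eq
    have c2 := (hc A.omega A.omega (n + 1) (m + 1)).eq
    have hr : (tensorData A A).rank = A.rank + A.rank := rfl
    have h3 : (if m + n = 0 then (((m : ℂ) ^ 3 - m) / 12) * (A.rank + A.rank) else 0)
        = (if m + n = 0 then (((m : ℂ) ^ 3 - m) / 12) * A.rank else 0)
          + (if m + n = 0 then (((m : ℂ) ^ 3 - m) / 12) * A.rank else 0) := by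
      split_ifs
      · ring
      · simp
    rw [e, e, e, hr, h3, add_smul, smul_add, add_add_add_comm, ← h1, ← h2]
    simp only [add_mul, mul_add, c1, c2]
    abel
  derivative t n := by
    induction t using TensorProduct.induction_on with
    | zero => simp
    | add s t hs ht => simp only [map_add, Pi.add_apply, hs, ht, smul_add]
    | tmul u v =>
      have e : (tensorData A A).Y (tensorData A A).omega 0 (u ⊗ₜ v)
          = A.Y A.omega 0 u ⊗ₜ v + u ⊗ₜ A.Y A.omega 0 v := by
        rw [tensorData, map_add, Pi.add_apply, LinearMap.add_apply,
          tensorField_tmul_vacuum _ _ A.adjoint.vacuum,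
          tensorField_vacuum_tmul _ _ A.adjoint.vacuum]
      rw [e]
      exact productField_derivative _ _ hc (D := A.Y A.omega 0) hM₁.derivative hM₂.derivative u v n

end ProductField

end VOATheory

end

theorem theorem3p12 {V W : Type*} [AddCommGroup V] [Module ℂ V] [AddCommGroup W] [Module ℂ W]
    (A : VOATheory.VertexOperatorAlgebra V) (Y : VOATheory.FieldMap V W)
    (hY : VOATheory.IsWeakModule A.toVertexData Y) (z : ℂ) (hz : z ≠ 0) :
    (∃! YL : VOATheory.FieldMap V (VOATheory.DQ Y z), VOATheory.IsLeftAction A Y z YL) ∧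
    (∃! YR : VOATheory.FieldMap V (VOATheory.DQ Y z), VOATheory.IsRightAction Y z YR) ∧
    ∀ YL YR : VOATheory.FieldMap V (VOATheory.DQ Y z),
      VOATheory.IsLeftAction A Y z YL → VOATheory.IsRightAction Y z YR →
        VOATheory.IsWeakModule A.toVertexData YL ∧
        VOATheory.IsWeakModule A.toVertexData YR ∧
        (∀ (u v : V) (m n : ℤ), Commute (YL u m) (YR v n)) ∧
        (∃! YQ : VOATheory.FieldMap (V ⊗[ℂ] V) (VOATheory.DQ Y z),
          VOATheory.IsProductField YL YR YQ) ∧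
        ∀ YQ : VOATheory.FieldMap (V ⊗[ℂ] V) (VOATheory.DQ Y z),
          VOATheory.IsProductField YL YR YQ →
            VOATheory.IsWeakModule (VOATheory.tensorData A A) YQ := by
  have S : VOATheory.QSetting A.Y Y z := ⟨A.adjoint.truncation, hY.truncation, hY.jacobi, hz⟩
  refine ⟨?_, ?_, fun YL YR hL hR => ?_⟩
  · exact ⟨_, (VOATheory.isLeftAction_iff S).2 rfl, fun _ h => (VOATheory.isLeftAction_iff S).1 h⟩
  · exact ⟨_, (VOATheory.isRightAction_iff S).2 rfl, fun _ h => (VOATheory.isRightAction_iff S).1 h⟩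
  · rw [VOATheory.isLeftAction_iff S] at hL
    rw [VOATheory.isRightAction_iff S] at hR
    subst hL hR
    have h₁ := VOATheory.leftAction_isWeakModule S hY.vacuum
    have h₂ := VOATheory.rightAction_isWeakModule S hY.vacuum
    have hc := VOATheory.commute_leftAction_rightAction S
    have hp := fun {G} => VOATheory.isProductField_iff h₁.truncation h₂.truncation hc (G := G)
    refine ⟨h₁, h₂, hc, ⟨_, hp.2 rfl, fun _ h => hp.1 h⟩, fun YQ h => ?_⟩
    rw [hp.1 h]
    exact VOATheory.productField_isWeakModule hc h₁ h₂
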